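/- **Setting.** Let $(\mathcal H_{\tau,\mathbb R})_{\tau\in T}$ be a family of real separable Hilbert spaces, all continuously embedded into one of them, $\mathcal H_{0,\mathbb R}=\mathcal H_{\tau_0,\mathbb R}$. Assume that any two of them contain a third one with continuous embeddings, that for each $\tau_1\in T$ there is $\tau_2\in T$ with $\mathcal H_{\tau_2,\mathbb R}\subset\mathcal H_{\tau_1,\mathbb R}$ and the embedding of Hilbert–Schmidt class, and that $\bigcap_{\tau}\mathcal H_{\tau,\mathbb R}$ is dense in each $\mathcal H_{\tau,\mathbb R}$. Let $\mathcal H_\tau$ be the complexification of $\mathcal H_{\tau,\mathbb R}$, let $\Phi=\bigcap_\tau\mathcal H_\tau$ with the projective limit topology, let $\mathcal H_{-\tau}$ (with norm $\|\cdot\|_{-\tau}$) be the dual of $\mathcal H_\tau$ with respect to $\mathcal H_0=\mathcal H_{\tau_0}$, and let $\Phi'=\bigcup_\tau\mathcal H_{-\tau}$ be the dual of $\Phi$, with bilinear pairing $\langle\cdot,\cdot\rangle$. For $n\ge0$ let $\mathcal H_\tau^{\odot n}$ be the symmetric Hilbert tensor powers (norm again denoted by $\|\cdot\|_\tau$), $\Phi^{\odot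 n}$ the projective limit of the $\mathcal H_\tau^{\odot n}$, and $\Phi'^{\odot n}$, the dual of $\Phi^{\odot n}$, the locally convex inductive limit of the $\mathcal H_{-\tau}^{\odot n}$; for $n=0$ all these spaces are $\mathbb C$. A function is called *holomorphic* on an open set if it is continuous there and holomorphic along complex lines, and *entire* if it is holomorphic on the whole space. For $\alpha>0$, let $\mathcal E^\alpha_{\min}(\Phi')$ be the space of all $f:\Phi'\to\mathbb C$ whose restriction to each $\mathcal H_{-\tau}$ is entire and satisfies $$\mathbf n_{\tau,l,\alpha}(f)=\sup_{\omega\in\mathcal H_{-\tau}}|f(\omega)|\exp\big(-2^{-l}\|\omega\|_{-\tau}^\alpha\big)<\infty\qquad\text{for all }\tau\in T,\ l\in\{0,1,2,\dots\},$$ with the topology defined by all the norms $\mathbf n_{\tau,l,\alpha}$. Let $\mathcal E^0_{\min}(\Phi')=\bigcap_{\alpha>0}\mathcal E^\alpha_{\min}(\Phi')$ with the projective limit topology. Let $\mathcal P(\Phi')$ be the space of polynomials $p(\omega)=\sum_{k=0}^N\langle\omega^{\otimes k},\varphi^{(k)}\rangle$ with $\varphi^{(k)}\in\Phi^{\odot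 k}$. Let $S^{(n)}:\Phi'\to\Phi'^{\odot n}$, $n\ge0$, be a sequence of monic polynomials, i.e. $S^{(n)}(\omega)=\sum_{k=0}^nU_{n,k}\,\omega^{\otimes k}$ with continuous linear operators $U_{n,k}:\Phi'^{\odot k}\to\Phi'^{\odot n}$ and $U_{n,n}=\mathbf 1$. It is called a *Sheffer sequence* if, as formal power series in $\xi\in\Phi$, for every $\omega\in\Phi'$, $$\sum_{n=0}^\infty\frac1{n!}\langle S^{(n)}(\omega),\xi^{\otimes n}\rangle=\frac{\exp\langle\omega,A(\xi)\rangle}{\rho(A(\xi))},$$ where $A(\xi)=\sum_{k\ge1}A_k\xi^{\otimes k}$ with continuous linear operators $A_k:\Phi^{\odot k}\to\Phi$, $A_1=\mathbf 1$, and $\rho(\xi)=\sum_{n\ge0}\langle\rho^{(n)},\xi^{\otimes n}\rangle$ with $\rho^{(n)}\in\Phi'^{\odot n}$, $\rho^{(0)}=1$. The corresponding *Sheffer operator* is the linear map $\mathfrak S$ on $\mathcal P(\Phi')$ with $\mathfrak S\langle\omega^{\otimes n},\varphi^{(n)}\rangle=\langle S^{(n)}(\omega),\varphi^{(n)}\rangle$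 for all $n\ge0$ and $\varphi^{(n)}\in\Phi^{\odot n}$. A formal power series $F(\xi)=\sum_{n\ge1}F_n\xi^{\otimes n}$ with continuous linear operators $F_n:\Phi^{\odot n}\to\Phi$ is called *quasi-holomorphic on a neighborhood of zero* if for each $\tau\in T$ there are $\tau'\in T$ and $C\ge0$ such that, for all $n\ge1$, $F_n$ extends to a bounded operator from $\mathcal H_{\tau'}^{\odot n}$ to $\mathcal H_\tau$ of norm at most $C^n$. **Theorem.** Let $(S^{(n)})_{n\ge0}$ be a Sheffer sequence with generating function as above. Assume that $\rho$ is holomorphic on a neighborhood of zero in $\Phi$ (the series $\rho(\xi)$ converges there to a holomorphic function). Let $B(\xi)=\sum_{k\ge1}B_k\xi^{\otimes k}$, with continuous linear operators $B_k:\Phi^{\odot k}\to\Phi$, be the compositional inverse of $A(\xi)$, that is, $A(B(\xi))=B(A(\xi))=\xi$ as formal power series, and assume that both $A$ and $B$ are quasi-holomorphic on a neighborhood of zero. Then, for every $\alpha\in[0,1]$, the Sheffer operator $\mathfrak S$ extends by continuity to a linear self-homeomorphism of $\mathcal E^\alpha_{\min}(\Phi')$. That is, $\mathcal P(\Phi')$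 is a dense subset of $\mathcal E^\alpha_{\min}(\Phi')$, and there is a linear homeomorphism of $\mathcal E^\alpha_{\min}(\Phi')$ onto itself which coincides with $\mathfrak S$ on $\mathcal P(\Phi')$. -/

import Mathlib

open scoped Topology

universe u v

noncomputable section

/-- An operator between Hilbert spaces is of Hilbert--Schmidt class if the sums `∑ ‖j eᵢ‖²` over
finite orthonormal families are bounded (equivalently: `∑ ‖j eᵢ‖² < ∞` over an orthonormal basis). -/
def IsHilbertSchmidt {E F : Type*} [NormedAddCommGroup E] [InnerProductSpace ℂ E]
    [NormedAddCommGroup F] [InnerProductSpace ℂ F] (j : E →L[ℂ] F) : Prop :=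
  ∃ C : ℝ, ∀ (m : ℕ) (e : Fin m → E), Orthonormal ℂ e → ∑ i, ‖j (e i)‖ ^ 2 ≤ C

/-- The data from which a complex Gel'fand triple `Φ ⊂ H₀ ⊂ Φ'` is built.  The complexification of
a real Hilbert space is given as a complex Hilbert space with a conjugation `conj` (an isometric
antilinear involution, whose fixed points form the real space).  All spaces `H τ` are continuously
embedded into the center space `H τ₀` by `emb τ`, compatibly with the conjugations. -/
structure GelfandTriple (T : Type u) where
  /-- the Hilbert spaces -/
  H : T → Type v
  [normed : ∀ τ, NormedAddCommGroup (H τ)]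
  [innerProd : ∀ τ, InnerProductSpace ℂ (H τ)]
  [complete : ∀ τ, CompleteSpace (H τ)]
  [separable : ∀ τ, TopologicalSpace.SeparableSpace (H τ)]
  /-- the complex conjugation -/
  conj : ∀ τ, H τ ≃ₗᵢ⋆[ℂ] H τ
  conj_conj : ∀ τ x, conj τ (conj τ x) = x
  /-- the index of the center space -/
  τ₀ : T
  /-- the inclusion into the center space -/
  emb : ∀ τ, H τ →L[ℂ] H τ₀
  emb_injective : ∀ τ, Function.Injective (emb τ)
  emb_center : ∀ x, emb τ₀ x = x
  emb_conj : ∀ τ x, emb τ (conj τ x) = conj τ₀ (emb τ x)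
  /-- any two of the spaces contain a third one, with continuous inclusions -/
  directed : ∀ τ₁ τ₂, ∃ (τ₃ : T) (j₁ : H τ₃ →L[ℂ] H τ₁) (j₂ : H τ₃ →L[ℂ] H τ₂),
    (∀ x, emb τ₁ (j₁ x) = emb τ₃ x) ∧ ∀ x, emb τ₂ (j₂ x) = emb τ₃ x
  /-- each of the spaces contains another one, with Hilbert--Schmidt inclusion -/
  nuclear : ∀ τ₁, ∃ (τ₂ : T) (j : H τ₂ →L[ℂ] H τ₁),
    (∀ x, emb τ₁ (j x) = emb τ₂ x) ∧ IsHilbertSchmidt j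
  /-- the intersection of all the spaces is dense in each of them -/
  dense : ∀ τ, Dense {x : H τ | ∀ σ, ∃ y : H σ, emb σ y = emb τ x}

attribute [instance] GelfandTriple.normed GelfandTriple.innerProd GelfandTriple.complete
  GelfandTriple.separable

/-- A scalar function is holomorphic on `U` if it is continuous and Gâteaux holomorphic there.
(`U` is meant to be open.) -/
def IsHolomorphicOn {E : Type*} [AddCommGroup E] [Module ℂ E] [TopologicalSpace E]
    (f : E → ℂ) (U : Set E) : Prop :=
  ContinuousOn f U ∧ ∀ ξ ∈ U, ∀ η : E,
    ∃ V ∈ 𝓝 (0 : ℂ), DifferentiableOn ℂ (fun z : ℂ => f (ξ + z • η)) V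

/-- The pointwise supremum of seminorms, on a subspace on which it is finite. -/
def supSeminorm {V ι : Type*} [AddCommGroup V] [Module ℂ V] (q : ι → Seminorm ℂ V)
    (W : Submodule ℂ V) (h : ∀ w ∈ W, BddAbove (Set.range fun i => q i w)) : Seminorm ℂ W :=
  Seminorm.of (fun w => ⨆ i, q i w)
    (fun x y => by
      refine Real.iSup_le (fun i => ?_) (add_nonneg (Real.iSup_nonneg fun i => apply_nonneg _ _)
        (Real.iSup_nonneg fun i => apply_nonneg _ _))
      exact (map_add_le_add (q i) _ _).trans
        (add_le_add (le_ciSup (h x x.2) i) (le_ciSup (h y y.2) i)))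
    (fun a x => by
      simp only [Submodule.coe_smul, map_smul_eq_mul]
      exact (Real.mul_iSup_of_nonneg (norm_nonneg a) _).symm)

namespace GelfandTriple

variable {T : Type u} (G : GelfandTriple.{u, v} T)

/-- The intersection of the `H τ`; an element is given by the family of its copies in all the
spaces `H τ`. -/
def testSubmodule : Submodule ℂ (∀ τ, G.H τ) where
  carrier := {x | ∀ τ, G.emb τ (x τ) = x G.τ₀}
  add_mem' := fun {x y} hx hy τ => by simp [hx τ, hy τ]
  zero_mem' := fun τ => by simp
  smul_mem' := fun c x hx τ => by simp [hx τ]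

/-- The nuclear space `Φ = ⋂ H τ`, with the projective limit topology, i.e. the topology induced
from the product of the `H τ`. -/
abbrev Test : Type (max u v) := ↥G.testSubmodule

/-- The co-nuclear space `Φ'`, the dual of `Φ`; the pairing `⟨ω, ξ⟩` is `ω ξ`. -/
abbrev CoTest : Type (max u v) := StrongDual ℂ G.Test

/-- The inclusion `Φ ⊂ H τ`. -/
def toH (τ : T) : G.Test →L[ℂ] G.H τ :=
  (ContinuousLinearMap.proj τ).comp G.testSubmodule.subtypeL

/-- The space `H₋τ`, i.e. the dual of `H τ`, with the dual norm. -/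
abbrev Neg (τ : T) : Type v := StrongDual ℂ (G.H τ)

/-- The inclusion `H₋τ ⊂ Φ'`. -/
def ofNeg (τ : T) : G.Neg τ →ₗ[ℂ] G.CoTest where
  toFun ω := ω.comp (G.toH τ)
  map_add' ω ω' := ContinuousLinearMap.add_comp ω ω' _
  map_smul' c ω := ContinuousLinearMap.smul_comp c ω _

theorem ofNeg_apply (τ : T) (ω : G.Neg τ) (ξ : G.Test) : G.ofNeg τ ω ξ = ω (G.toH τ ξ) := rfl

/-! ### Tensor powers

The Hilbert tensor power `H τ ^⊗ n` is realised as the space of the `n`-linear forms of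
Hilbert--Schmidt class on `H₋τ`: a tensor `φ` is the form `(ω₁, …, ωₙ) ↦ ⟨ω₁ ⊗ ⋯ ⊗ ωₙ, φ⟩`.
Accordingly `Φ^⊗ n`, the projective limit of the `H τ ^⊗ n`, consists of the `n`-linear forms on
`Φ' = ⋃ H₋τ` whose restriction to each `H₋τ` is of Hilbert--Schmidt class. -/

/-- The square root of `∑ |φ(e_{i₁}, …, e_{iₙ})|²`, for a finite family `e` in `H τ`, which is
carried over to `H₋τ` by the Riesz map. -/
def famSeminorm (n : ℕ) (τ : T) {m : ℕ} (e : Fin m → G.H τ) :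
    Seminorm ℂ (MultilinearMap ℂ (fun _ : Fin n => G.CoTest) ℂ) :=
  (normSeminorm ℂ (EuclideanSpace ℂ (Fin n → Fin m))).comp
    ({ toFun := fun φ => WithLp.toLp 2 fun i =>
        φ fun j => G.ofNeg τ (InnerProductSpace.toDual ℂ (G.H τ) (e (i j)))
       map_add' := fun _ _ => rfl
       map_smul' := fun _ _ => rfl } :
      MultilinearMap ℂ (fun _ : Fin n => G.CoTest) ℂ →ₗ[ℂ] EuclideanSpace ℂ (Fin n → Fin m))

theorem famSeminorm_apply (n : ℕ) (τ : T) {m : ℕ} (e : Fin m → G.H τ)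
    (φ : MultilinearMap ℂ (fun _ : Fin n => G.CoTest) ℂ) :
    G.famSeminorm n τ e φ = Real.sqrt (∑ i : Fin n → Fin m,
      ‖φ fun j => G.ofNeg τ (InnerProductSpace.toDual ℂ (G.H τ) (e (i j)))‖ ^ 2) := by
  exact EuclideanSpace.norm_eq (𝕜 := ℂ) (n := Fin n → Fin m) (WithLp.toLp 2 _)

/-- The finite orthonormal families in `H τ`. -/
abbrev OrthoFam (τ : T) : Type v := Σ m : ℕ, {e : Fin m → G.H τ // Orthonormal ℂ e}

/-- `Φ^⊗ n`. -/
def tensorSubmodule (n : ℕ) : Submodule ℂ (MultilinearMap ℂ (fun _ : Fin n => G.CoTest) ℂ) where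
  carrier := {φ | ∀ τ, BddAbove (Set.range fun e : G.OrthoFam τ => G.famSeminorm n τ e.2.1 φ)}
  add_mem' := fun {x y} hx hy τ => by
    obtain ⟨a, ha⟩ := hx τ
    obtain ⟨b, hb⟩ := hy τ
    refine ⟨a + b, ?_⟩
    rintro _ ⟨e, rfl⟩
    exact (map_add_le_add _ _ _).trans (add_le_add (ha ⟨e, rfl⟩) (hb ⟨e, rfl⟩))
  zero_mem' := fun τ => ⟨0, by rintro _ ⟨e, rfl⟩; simp⟩
  smul_mem' := fun c x hx τ => by
    obtain ⟨a, ha⟩ := hx τ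
    refine ⟨‖c‖ * a, ?_⟩
    rintro _ ⟨e, rfl⟩
    simp only [map_smul_eq_mul]
    exact mul_le_mul_of_nonneg_left (ha ⟨e, rfl⟩) (norm_nonneg c)

/-- `Φ^⊙ n`: the symmetric elements of `Φ^⊗ n`. -/
def symSubmodule (n : ℕ) : Submodule ℂ (MultilinearMap ℂ (fun _ : Fin n => G.CoTest) ℂ) where
  carrier := {φ | φ ∈ G.tensorSubmodule n ∧
    ∀ (σ : Equiv.Perm (Fin n)) (ω : Fin n → G.CoTest), φ (ω ∘ σ) = φ ω}
  add_mem' := fun {x y} hx hy =>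
    ⟨add_mem hx.1 hy.1, fun σ ω => by simp [hx.2 σ ω, hy.2 σ ω]⟩
  zero_mem' := ⟨zero_mem _, fun σ ω => rfl⟩
  smul_mem' := fun c x hx => ⟨Submodule.smul_mem _ c hx.1, fun σ ω => by simp [hx.2 σ ω]⟩

/-- `Φ^⊙ n`, with its projective limit topology (given below). -/
def SymPow (n : ℕ) : Type (max u v) := ↥(G.symSubmodule n)

instance (n : ℕ) : AddCommGroup (G.SymPow n) := inferInstanceAs (AddCommGroup ↥(G.symSubmodule n))

instance (n : ℕ) : Module ℂ (G.SymPow n) := inferInstanceAs (Module ℂ ↥(G.symSubmodule n))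

/-- `φ.eval ω = ⟨ω₁ ⊗ ⋯ ⊗ ωₙ, φ⟩`. -/
def SymPow.eval {G : GelfandTriple.{u, v} T} {n : ℕ} (φ : G.SymPow n) (ω : Fin n → G.CoTest) : ℂ :=
  φ.1 ω

/-- The norm `‖·‖_τ` of `H τ ^⊙ n`, restricted to `Φ^⊙ n`. -/
def powSeminorm (n : ℕ) (τ : T) : Seminorm ℂ (G.SymPow n) :=
  supSeminorm (fun e : G.OrthoFam τ => G.famSeminorm n τ e.2.1) (G.symSubmodule n)
    fun _ hφ => hφ.1 τ

instance (n : ℕ) : TopologicalSpace (G.SymPow n) :=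
  haveI : Nonempty T := ⟨G.τ₀⟩
  SeminormFamily.moduleFilterBasis (𝕜 := ℂ) (G.powSeminorm n) |>.topology

theorem powSeminorm_withSeminorms (n : ℕ) :
    haveI : Nonempty T := ⟨G.τ₀⟩
    WithSeminorms (𝕜 := ℂ) (G.powSeminorm n) :=
  haveI : Nonempty T := ⟨G.τ₀⟩
  ⟨rfl⟩

instance (n : ℕ) : IsTopologicalAddGroup (G.SymPow n) :=
  haveI : Nonempty T := ⟨G.τ₀⟩
  (G.powSeminorm_withSeminorms n).topologicalAddGroup

instance (n : ℕ) : ContinuousSMul ℂ (G.SymPow n) :=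
  haveI : Nonempty T := ⟨G.τ₀⟩
  (G.powSeminorm_withSeminorms n).continuousSMul

/-- `Φ'^⊙ n`, the dual of `Φ^⊙ n`; the pairing `⟨F, φ⟩` is `F φ`. -/
abbrev CoPow (n : ℕ) : Type (max u v) := StrongDual ℂ (G.SymPow n)

/-- The inductive limit topology of `Φ'^⊙ n`: the finest locally convex topology for which all the
inclusions `H₋τ ^⊙ n ⊂ Φ'^⊙ n` are continuous (at zero).  Here `H₋τ ^⊙ n` is the dual of
`H τ ^⊙ n`, with the dual norm. -/
abbrev indTopology (n : ℕ) : TopologicalSpace (G.CoPow n) :=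
  sInf {t | @IsTopologicalAddGroup (G.CoPow n) t _ ∧ @ContinuousSMul ℂ (G.CoPow n) _ _ t ∧
    @LocallyConvexSpace ℝ (G.CoPow n) _ _ _ _ t ∧
    ∀ τ, ∀ W ∈ @nhds (G.CoPow n) t 0, ∃ ε : ℝ, 0 < ε ∧
      ∀ F : G.CoPow n, (∀ φ, ‖F φ‖ ≤ ε * G.powSeminorm n τ φ) → F ∈ W}

/-! ### Elementary tensors -/

/-- The simple tensor `x₁ ⊗ ⋯ ⊗ xₙ` of elements of `Φ`. -/
def pureTensor {n : ℕ} (x : Fin n → G.Test) :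
    MultilinearMap ℂ (fun _ : Fin n => G.CoTest) ℂ :=
  (MultilinearMap.mkPiAlgebra ℂ (Fin n) ℂ).compLinearMap fun j =>
    { toFun := fun ω : G.CoTest => ω (x j)
      map_add' := fun _ _ => rfl
      map_smul' := fun _ _ => rfl }

theorem pureTensor_apply {n : ℕ} (x : Fin n → G.Test) (ω : Fin n → G.CoTest) :
    G.pureTensor x ω = ∏ j, ω j (x j) := by
  simp [pureTensor]

theorem pureTensor_mem {n : ℕ} (x : Fin n → G.Test) : G.pureTensor x ∈ G.tensorSubmodule n := by
  intro τ
  refine ⟨∏ j, ‖G.toH τ (x j)‖, ?_⟩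
  rintro _ ⟨⟨m, e, he⟩, rfl⟩
  have h0 : 0 ≤ ∏ j, ‖G.toH τ (x j)‖ := Finset.prod_nonneg fun _ _ => norm_nonneg _
  simp only [famSeminorm_apply]
  rw [Real.sqrt_le_left h0, ← Finset.prod_pow]
  simp only [pureTensor_apply, ofNeg_apply, InnerProductSpace.toDual_apply_apply, norm_prod]
  simp only [← Finset.prod_pow]
  have key := Finset.prod_univ_sum (fun _ : Fin n => (Finset.univ : Finset (Fin m)))
    (fun j a => ‖inner ℂ (e a) (G.toH τ (x j))‖ ^ 2)
  rw [Fintype.piFinset_univ] at key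
  rw [← key]
  exact Finset.prod_le_prod (fun _ _ => Finset.sum_nonneg fun _ _ => by positivity)
    fun j _ => he.sum_inner_products_le _

/-- The symmetric tensor product `x₁ ⊙ ⋯ ⊙ xₙ`, the symmetrization of `x₁ ⊗ ⋯ ⊗ xₙ`. -/
def symProd {n : ℕ} (x : Fin n → G.Test) : G.SymPow n :=
  ⟨(n.factorial : ℂ)⁻¹ • ∑ σ : Equiv.Perm (Fin n), G.pureTensor (x ∘ σ),
    Submodule.smul_mem _ _ (Submodule.sum_mem _ fun _ _ => G.pureTensor_mem _), by
    intro σ ω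
    simp only [smul_apply, sum_apply, pureTensor_apply,
      Function.comp_apply]
    congr 1
    refine Fintype.sum_equiv (Equiv.mulRight σ⁻¹) _ _ fun π => ?_
    refine Fintype.prod_equiv σ _ _ fun j => ?_
    simp⟩

/-- `ξ^⊗ n`. -/
def tpow (ξ : G.Test) (n : ℕ) : G.SymPow n := G.symProd fun _ => ξ

/-- Each `ω ∈ Φ'` belongs to some `H₋τ`. -/
theorem exists_ofNeg (ω : G.CoTest) : ∃ (τ : T) (w : G.Neg τ), G.ofNeg τ w = ω := by
  classical
  -- a common lower bound for finitely many indices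
  have hdir : ∀ s : Finset T, ∃ τ, ∀ σ ∈ s, ∃ j : G.H τ →L[ℂ] G.H σ,
      ∀ x, G.emb σ (j x) = G.emb τ x := by
    intro s
    induction s using Finset.induction_on with
    | empty => exact ⟨G.τ₀, by simp⟩
    | insert a s _ ih =>
      obtain ⟨τ, hτ⟩ := ih
      obtain ⟨τ₃, j₁, j₂, h₁, h₂⟩ := G.directed a τ
      refine ⟨τ₃, fun σ hσ => ?_⟩
      rcases Finset.mem_insert.1 hσ with rfl | hσ
      · exact ⟨j₁, h₁⟩
      · obtain ⟨j, hj⟩ := hτ σ hσ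
        exact ⟨j.comp j₂, fun x => by simp [hj, h₂]⟩
  have hcont : ∀ᶠ ξ in 𝓝 (0 : G.Test), ‖ω ξ‖ < 1 := by
    have : Filter.Tendsto (fun ξ => ‖ω ξ‖) (𝓝 0) (𝓝 0) := by
      simpa using (ω.continuous.norm.tendsto 0)
    exact this.eventually (gt_mem_nhds one_pos)
  rw [nhds_subtype_eq_comap] at hcont
  obtain ⟨S, hS, hSω⟩ := hcont
  rw [nhds_pi, Filter.mem_pi] at hS
  obtain ⟨I, hI, t, ht, htS⟩ := hS
  obtain ⟨τ, hτ⟩ := hdir hI.toFinset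
  choose! j hj using hτ
  have hjx : ∀ σ ∈ I, ∀ ξ : G.Test, j σ (ξ.1 τ) = ξ.1 σ := fun σ hσ ξ =>
    G.emb_injective σ (by rw [hj σ (hI.mem_toFinset.2 hσ), ξ.2 τ, ξ.2 σ])
  have hnear : ∀ᶠ x in 𝓝 (0 : G.H τ), ∀ σ ∈ I, j σ x ∈ t σ := by
    rw [Filter.eventually_all_finite hI]
    intro σ hσ
    have : Filter.Tendsto (j σ) (𝓝 0) (𝓝 0) := by simpa using (j σ).continuous.tendsto 0
    exact this.eventually (ht σ)
  obtain ⟨r, hr, hball⟩ := Metric.eventually_nhds_iff.1 hnear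
  have hsmall : ∀ ξ : G.Test, ‖ξ.1 τ‖ < r → ‖ω ξ‖ < 1 := fun ξ hξ =>
    hSω (htS fun σ hσ => by
      have := hball (y := ξ.1 τ) (by simpa using hξ) σ hσ
      rwa [hjx σ hσ] at this)
  have hbound : ∀ ξ : G.Test, ‖ω ξ‖ ≤ (2 / r) * ‖G.toH τ ξ‖ := by
    intro ξ
    change _ ≤ (2 / r) * ‖ξ.1 τ‖
    by_contra! hlt
    have h1 : 0 < ‖ω ξ‖ := lt_of_le_of_lt (by positivity) hlt
    have := hsmall (((‖ω ξ‖⁻¹ : ℝ) : ℂ) • ξ) (by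
      change ‖((‖ω ξ‖⁻¹ : ℝ) : ℂ) • ξ.1 τ‖ < r
      rw [norm_smul, Complex.norm_real, norm_inv, norm_norm, inv_mul_lt_iff₀ h1]
      have : 2 * ‖ξ.1 τ‖ < r * ‖ω ξ‖ := by
        have := mul_lt_mul_of_pos_left hlt hr
        rwa [← mul_assoc, mul_div_cancel₀ _ hr.ne'] at this
      nlinarith [norm_nonneg (ξ.1 τ)])
    rw [map_smul, norm_smul, Complex.norm_real, norm_inv, norm_norm,
      inv_mul_cancel₀ h1.ne'] at this
    exact lt_irrefl _ this
  have hinj : Function.Injective (G.toH τ : G.Test →ₗ[ℂ] G.H τ) := by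
    intro x y hxy
    have hxy' : x.1 τ = y.1 τ := hxy
    refine Subtype.ext (funext fun σ => G.emb_injective σ ?_)
    rw [x.2 σ, y.2 σ, ← x.2 τ, ← y.2 τ, hxy']
  let L := LinearEquiv.ofInjective (G.toH τ : G.Test →ₗ[ℂ] G.H τ) hinj
  let f : StrongDual ℂ (LinearMap.range (G.toH τ : G.Test →ₗ[ℂ] G.H τ)) :=
    LinearMap.mkContinuous ((ω : G.Test →ₗ[ℂ] ℂ) ∘ₗ (L.symm : _ →ₗ[ℂ] G.Test)) (2 / r) (by
      intro x
      obtain ⟨ξ, rfl⟩ := L.surjective x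
      simpa [L] using hbound ξ)
  obtain ⟨w, hw, -⟩ := exists_extension_norm_eq _ f
  refine ⟨τ, w, ContinuousLinearMap.ext fun ξ => ?_⟩
  have := hw (L ξ)
  rw [ofNeg_apply]
  simpa [f, L] using this

/-- `|⟨ω^⊗ n, φ⟩| ≤ ‖ω‖₋τ ^ n ‖φ‖_τ`. -/
theorem norm_eval_le {n : ℕ} (τ : T) (w : G.Neg τ) (φ : G.SymPow n) :
    ‖φ.eval fun _ => G.ofNeg τ w‖ ≤ ‖w‖ ^ n * G.powSeminorm n τ φ := by
  have hsup : ∀ E : G.OrthoFam τ, G.famSeminorm n τ E.2.1 φ.1 ≤ G.powSeminorm n τ φ :=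
    fun E => le_ciSup (φ.2.1 τ) E
  have hnn : 0 ≤ G.powSeminorm n τ φ := apply_nonneg _ _
  by_cases hw : w = 0
  · subst hw
    rcases Nat.eq_zero_or_pos n with rfl | hn
    · have := hsup ⟨0, Fin.elim0, by simp⟩
      rw [famSeminorm_apply] at this
      simp only [Finset.univ_unique, Finset.sum_singleton, Real.sqrt_sq (norm_nonneg _)] at this
      simp only [pow_zero, one_mul]
      have h : (fun _ : Fin 0 => G.ofNeg τ 0) = default := Subsingleton.elim _ _
      change ‖φ.1 _‖ ≤ _
      rw [h]
      refine le_of_eq_of_le ?_ this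
      congr 2
      exact Subsingleton.elim _ _
    · have : Nonempty (Fin n) := ⟨⟨0, hn⟩⟩
      have : φ.eval (fun _ => G.ofNeg τ 0) = 0 := by
        rw [map_zero]
        exact φ.1.map_zero
      rw [this, norm_zero]
      positivity
  · set h := (InnerProductSpace.toDual ℂ (G.H τ)).symm w with hh
    have hn0 : ‖w‖ ≠ 0 := norm_ne_zero_iff.2 hw
    have hhn : ‖h‖ = ‖w‖ := by simp [hh]
    have hwh : w = InnerProductSpace.toDual ℂ (G.H τ) h := by simp [hh]
    let e : G.H τ := ((‖w‖⁻¹ : ℝ) : ℂ) • h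
    have he : ‖e‖ = 1 := by
      simp only [e, norm_smul, Complex.norm_real, norm_inv, norm_norm, hhn]
      exact inv_mul_cancel₀ hn0
    have hE : Orthonormal ℂ (fun _ : Fin 1 => e) :=
      ⟨fun _ => he, fun i j hij => (hij (Subsingleton.elim i j)).elim⟩
    have := hsup ⟨1, fun _ => e, hE⟩
    rw [famSeminorm_apply] at this
    simp only [Finset.univ_unique, Finset.sum_singleton, Real.sqrt_sq (norm_nonneg _)] at this
    have hwe : w = (‖w‖ : ℂ) • InnerProductSpace.toDual ℂ (G.H τ) e := by
      simp only [e, map_smulₛₗ, Complex.conj_ofReal, ← hwh, smul_smul]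
      rw [← Complex.ofReal_mul, mul_inv_cancel₀ hn0, Complex.ofReal_one, one_smul]
    have heval : φ.eval (fun _ => G.ofNeg τ w) = (‖w‖ : ℂ) ^ n *
        φ.1 fun _ => G.ofNeg τ (InnerProductSpace.toDual ℂ (G.H τ) e) := by
      conv_lhs => rw [hwe]
      simp only [map_smul]
      change φ.1 _ = _
      rw [φ.1.map_smul_univ (fun _ => (‖w‖ : ℂ))]
      simp
    rw [heval, norm_mul, norm_pow, Complex.norm_real, norm_norm]
    exact mul_le_mul_of_nonneg_left this (by positivity)

/-- `ω^⊗ n`, as an element of `Φ'^⊙ n`. -/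
def coPow (ω : G.CoTest) (n : ℕ) : G.CoPow n where
  toFun φ := φ.eval fun _ => ω
  map_add' _ _ := rfl
  map_smul' _ _ := rfl
  cont := by
    have : Nonempty T := ⟨G.τ₀⟩
    obtain ⟨τ, w, rfl⟩ := G.exists_ofNeg ω
    let f : G.SymPow n →ₗ[ℂ] ℂ :=
      { toFun := fun φ => φ.eval fun _ => G.ofNeg τ w
        map_add' := fun _ _ => rfl
        map_smul' := fun _ _ => rfl }
    refine WithSeminorms.continuous_normedSpace_rng (𝕝 := ℂ) ℂ
      (G.powSeminorm_withSeminorms n) f ⟨{τ}, ⟨‖w‖ ^ n, by positivity⟩, fun φ => ?_⟩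
    rw [Finset.sup_singleton]
    exact G.norm_eval_le τ w φ

/-! ### Formal power series on `Φ` -/

/-- A formal power series `F(ξ) = ∑ₖ Fₖ ξ^⊗ k` with `Fₖ ∈ L(Φ^⊙ k, Φ)`. -/
abbrev FormalMap : Type (max u v) := ∀ k : ℕ, G.SymPow k →L[ℂ] G.Test

variable {G}

/-- The coefficient of `zⁿ` in the formal power series `F(z ξ)^⊗ m`. -/
def FormalMap.powCoeff (F : G.FormalMap) (ξ : G.Test) (m n : ℕ) : G.SymPow m :=
  ∑ k ∈ Finset.Nat.antidiagonalTuple m n, G.symProd fun i => F (k i) (G.tpow ξ (k i))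

/-- `F` has no constant term. -/
def FormalMap.NoConst (F : G.FormalMap) : Prop := F 0 = 0

/-- `F(K(ξ)) = ξ` as formal power series, for `K` without constant term. -/
def FormalMap.IsLeftInverse (F K : G.FormalMap) : Prop :=
  ∀ (ξ : G.Test) (n : ℕ),
    ∑ m ∈ Finset.range (n + 1), F m (K.powCoeff ξ m n) = if n = 1 then ξ else 0

/-- `B` is the compositional inverse of `A`. -/
def FormalMap.IsCompInverse (B A : G.FormalMap) : Prop :=
  A.NoConst ∧ B.NoConst ∧ A.IsLeftInverse B ∧ B.IsLeftInverse A

/-- The series is quasi-holomorphic on a neighborhood of zero: for each `τ` there are `τ'` and `C`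
such that `Fₙ` extends to a bounded operator `H τ' ^⊙ n → H τ` of norm at most `C ^ n`, `n ≥ 1`. -/
def FormalMap.IsQuasiHolomorphic (F : G.FormalMap) : Prop :=
  ∀ τ : T, ∃ (τ' : T) (C : ℝ), 0 ≤ C ∧ ∀ n : ℕ, 1 ≤ n → ∀ φ : G.SymPow n,
    ‖G.toH τ (F n φ)‖ ≤ C ^ n * G.powSeminorm n τ' φ

variable (G)

/-- The coefficients of a scalar formal power series `ρ(ξ) = ∑ₙ ⟨ρₙ, ξ^⊗ n⟩` on `Φ`. -/
abbrev FormalFun : Type (max u v) := ∀ n : ℕ, G.CoPow n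

variable {G}

/-- The formal power series `z ↦ ρ(A(z ξ))`, for `A` without constant term. -/
def FormalFun.comp (ρ : G.FormalFun) (A : G.FormalMap) (ξ : G.Test) : PowerSeries ℂ :=
  PowerSeries.mk fun n => ∑ m ∈ Finset.range (n + 1), ρ m (A.powCoeff ξ m n)

/-- The formal power series `ρ` converges on a neighborhood of zero in `Φ`, to a holomorphic
function. -/
def FormalFun.IsHolomorphicNearZero (ρ : G.FormalFun) : Prop :=
  ∃ (U : Set G.Test) (r : G.Test → ℂ), IsOpen U ∧ 0 ∈ U ∧ IsHolomorphicOn r U ∧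
    ∀ ξ ∈ U, HasSum (fun n => ρ n (G.tpow ξ n)) (r ξ)

/-! ### Sheffer sequences -/

/-- `S` is a sequence of monic polynomials on `Φ'`: `Sₙ(ω) = ∑_{k ≤ n} U_{n,k} ω^⊗ k` with
continuous linear operators `U_{n,k}` and `U_{n,n} = 1`. -/
def IsMonicSequence (S : ∀ n : ℕ, G.CoTest → G.CoPow n) : Prop :=
  ∃ U : ∀ n k : ℕ, G.CoPow k →ₗ[ℂ] G.CoPow n,
    (∀ n k, k ≤ n → Continuous[G.indTopology k, G.indTopology n] (U n k)) ∧
    (∀ n, U n n = LinearMap.id) ∧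
    ∀ n ω, S n ω = ∑ k ∈ Finset.range (n + 1), U n k (G.coPow ω k)

/-- `S` is the Sheffer sequence with the generating function
`∑ₙ ⟨Sₙ(ω), ξ^⊗ n⟩ / n! = exp ⟨ω, A(ξ)⟩ / ρ(A(ξ))`, where `A(ξ) = ξ + ∑_{k ≥ 2} Aₖ ξ^⊗ k` and
`ρ(0) = 1`.  This is an identity of formal power series in `ξ`, i.e. for all `ω` and `ξ` an identity
of formal power series in `z` when `ξ` is replaced by `z ξ`. -/
structure IsSheffer (S : ∀ n : ℕ, G.CoTest → G.CoPow n) (A : G.FormalMap) (ρ : G.FormalFun) :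
    Prop where
  monic : IsMonicSequence S
  noConst : A.NoConst
  linear_term : ∀ ξ : G.Test, A 1 (G.tpow ξ 1) = ξ
  const_term : ∀ ξ : G.Test, ρ 0 (G.tpow ξ 0) = 1
  genFun : ∀ (ω : G.CoTest) (ξ : G.Test),
    PowerSeries.mk (fun n => (n.factorial : ℂ)⁻¹ * S n ω (G.tpow ξ n)) =
      (PowerSeries.exp ℂ).subst (PowerSeries.mk fun n => ω (A n (G.tpow ξ n))) * (ρ.comp A ξ)⁻¹

variable (G)

/-- The polynomial `ω ↦ ∑_{k ≤ N} ⟨ω^⊗ k, φₖ⟩`. -/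
def poly (N : ℕ) (φ : ∀ k, G.SymPow k) (ω : G.CoTest) : ℂ :=
  ∑ k ∈ Finset.range (N + 1), G.coPow ω k (φ k)

/-- The set `𝒫(Φ')` of polynomials on `Φ'`. -/
def polynomials : Set (G.CoTest → ℂ) := {p | ∃ N φ, p = G.poly N φ}

/-! ### Entire functions of minimal type -/

/-- For fixed `ω ∈ H₋τ`, the seminorm `f ↦ |f(ω)| exp(-2^{-l} ‖ω‖₋τ ^ β)`. -/
def weightSeminorm (β : ℝ) (τ : T) (l : ℕ) (ω : G.Neg τ) : Seminorm ℂ (G.CoTest → ℂ) :=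
  Seminorm.of (fun f => ‖f (G.ofNeg τ ω)‖ * Real.exp (-(‖ω‖ ^ β / 2 ^ l)))
    (fun f g => by
      rw [← add_mul]
      exact mul_le_mul_of_nonneg_right (norm_add_le _ _) (Real.exp_nonneg _))
    (fun c f => by
      simp only [Pi.smul_apply, norm_smul, mul_assoc])

/-- The orders which enter the definition of `E^α_min`: only `α` itself if `α > 0`, and all positive
numbers if `α = 0`, because `E⁰_min` is the projective limit of the spaces `E^β_min`, `β > 0`. -/
def orders (α : ℝ) : Set ℝ := {β | β = α ∧ 0 < α ∨ α = 0 ∧ 0 < β}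

/-- The functions on `Φ'` whose restriction to each `H₋τ` is entire with
`sup_ω |f(ω)| exp(-2^{-l} ‖ω‖₋τ ^ β) < ∞` for all `l`; here `β = α` if `α > 0`, and `β` is
an arbitrary positive number if `α = 0`. -/
def eminSubmodule (α : ℝ) : Submodule ℂ (G.CoTest → ℂ) where
  carrier := {f | (∀ τ, IsHolomorphicOn (fun ω : G.Neg τ => f (G.ofNeg τ ω)) Set.univ) ∧
    ∀ β ∈ orders α, ∀ (τ : T) (l : ℕ),
      BddAbove (Set.range fun ω : G.Neg τ => G.weightSeminorm β τ l ω f)}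
  add_mem' := fun {f g} hf hg => by
    refine ⟨fun τ => ⟨(hf.1 τ).1.add (hg.1 τ).1, fun ξ hξ η => ?_⟩, fun β hβ τ l => ?_⟩
    · obtain ⟨V, hV, hfV⟩ := (hf.1 τ).2 ξ hξ η
      obtain ⟨V', hV', hgV⟩ := (hg.1 τ).2 ξ hξ η
      exact ⟨V ∩ V', Filter.inter_mem hV hV',
        (hfV.mono Set.inter_subset_left).add (hgV.mono Set.inter_subset_right)⟩
    · obtain ⟨a, ha⟩ := hf.2 β hβ τ l
      obtain ⟨b, hb⟩ := hg.2 β hβ τ l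
      refine ⟨a + b, ?_⟩
      rintro _ ⟨ω, rfl⟩
      exact (map_add_le_add _ _ _).trans (add_le_add (ha ⟨ω, rfl⟩) (hb ⟨ω, rfl⟩))
  zero_mem' := by
    refine ⟨fun τ => ⟨continuousOn_const, fun ξ _ η =>
      ⟨Set.univ, Filter.univ_mem, differentiableOn_const _⟩⟩, fun β _ τ l => ⟨0, ?_⟩⟩
    rintro _ ⟨ω, rfl⟩
    simp
  smul_mem' := fun c f hf => by
    refine ⟨fun τ => ⟨(hf.1 τ).1.const_smul c, fun ξ hξ η => ?_⟩, fun β hβ τ l => ?_⟩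
    · obtain ⟨V, hV, hfV⟩ := (hf.1 τ).2 ξ hξ η
      exact ⟨V, hV, hfV.const_smul c⟩
    · obtain ⟨a, ha⟩ := hf.2 β hβ τ l
      refine ⟨‖c‖ * a, ?_⟩
      rintro _ ⟨ω, rfl⟩
      simp only [map_smul_eq_mul]
      exact mul_le_mul_of_nonneg_left (ha ⟨ω, rfl⟩) (norm_nonneg c)

/-- The space `E^α_min(Φ')`, with its projective limit topology (given below). -/
def Emin (α : ℝ) : Type (max u v) := ↥(G.eminSubmodule α)

instance (α : ℝ) : AddCommGroup (G.Emin α) := inferInstanceAs (AddCommGroup ↥(G.eminSubmodule α))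

instance (α : ℝ) : Module ℂ (G.Emin α) := inferInstanceAs (Module ℂ ↥(G.eminSubmodule α))

instance (α : ℝ) : CoeFun (G.Emin α) fun _ => G.CoTest → ℂ := ⟨fun f => f.1⟩

/-- The norms `sup_ω |f(ω)| exp(-2^{-l} ‖ω‖₋τ ^ β)`. -/
def eminSeminorm (α : ℝ) (i : orders α × T × ℕ) : Seminorm ℂ (G.Emin α) :=
  supSeminorm (fun ω : G.Neg i.2.1 => G.weightSeminorm i.1 i.2.1 i.2.2 ω) (G.eminSubmodule α)
    fun _ hf => hf.2 i.1 i.1.2 i.2.1 i.2.2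

/-- The projective limit topology, i.e. the coarsest topology for which all the seminorm distances
are continuous. -/
instance (α : ℝ) : TopologicalSpace (G.Emin α) :=
  ⨅ i, (G.eminSeminorm α i).toSeminormedAddCommGroup.toUniformSpace.toTopologicalSpace

end GelfandTriple

end

/-!
Write `ξ^⊗ n` for the powers of test functions and let a *polynomial of finite rank* be a linear
combination of the functions `ω ↦ ⟨ω, ξ⟩ⁿ`.  A Sheffer operator `𝔖` acts on these by
`𝔖 ⟨·, ξ⟩ⁿ = n! [zⁿ] exp ⟨·, A(zξ)⟩ / ρ(A(zξ))`, which is again a polynomial of finite rank, and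
composing the generating function with the curve `z ↦ B(zξ)` shows that
`𝔖 (n! [zⁿ] ρ(zξ) exp ⟨·, B(zξ)⟩) = ⟨·, ξ⟩ⁿ`
(`alongCurve_eq_mul_exp`, `IsSheffer.shefferOp_expPoly`).  Here `ρ(zξ)` enters as the inverse of the
power series obtained by composing `1 / ρ(A(·))` with `B`.  As `𝔖` is injective by monicity, it is
a bijection of the space of polynomials of finite rank, and its inverse has a generating function
of the same form `s_ξ(z) exp ⟨·, F(zξ)⟩`.

Both operators are continuous on the polynomials of finite rank.  Holomorphy of `ρ` and
quasi-holomorphy of `A` and `B` give geometric bounds for the coefficients of `s_ξ` and of `F(zξ)`,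
so that the image of `⟨·, ξ⟩ⁿ` at `ω ∈ H₋τ` is at most
`n! (C ‖ξ‖_σ)ⁿ ∑_{k ≤ n} ‖ω‖ᵏ / k!`.
By nuclearity such a bound on powers carries over to all tensors of finite rank
(`exists_norm_finRank_le`), with `‖ξ‖_σⁿ` replaced by the supremum of the corresponding homogeneous
polynomial over the unit ball of some `H₋σ'`, up to a factor `Kⁿ`.  Cauchy's estimate on a ball of
radius comparable with `n^{1/β} + ‖ω‖` bounds this supremum by a seminorm of the whole polynomial,
and for `β ≤ 1` the resulting series is dominated by `exp(2^{-l} ‖ω‖ ^ β)`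
(`exists_radius`, `exists_eminSeminorm_le`).

Since `E^α_min` is complete (`completeSpace_emin`), both operators extend to it as soon as the
polynomials of finite rank are dense (`denseRange_finPoly`).  For this, the Taylor series of
`f ∈ E^α_min` converges to `f`, its homogeneous components are in `E^α_min`, and each component is
approximated by its composition with operators of finite rank, because the inclusions are
Hilbert–Schmidt operators.  On finite-dimensional spaces a homogeneous entire function is a
polynomial.  The extensions are inverse to each other, and they act on all monomials
`⟨ω^⊗ n, φ⟩` as required, because the tensors of finite rank are dense in `Φ^⊙ n`
(`dense_finRank`).
-/


noncomputable section

/-! ### Polarization -/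

/-- Polarization: the symmetrization of a multilinear map is recovered from its values on the
diagonal, by inclusion–exclusion. -/
theorem MultilinearMap.sum_neg_one_pow_diagonal {V X : Type*} [AddCommGroup V] [Module ℂ V]
    [AddCommGroup X] [Module ℂ X] {n : ℕ} (g : MultilinearMap ℂ (fun _ : Fin n => V) X)
    (x : Fin n → V) :
    ∑ U : Finset (Fin n), (-1 : ℤ) ^ U.card • g (fun _ => ∑ i ∈ Uᶜ, x i) =
      ∑ σ : Equiv.Perm (Fin n), g (x ∘ σ) := by
  classical
  have h1 : ∀ U : Finset (Fin n), g (fun _ => ∑ i ∈ Uᶜ, x i) =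
      ∑ f : Fin n → Fin n, if (∀ j, f j ∉ U) then g (x ∘ f) else 0 := by
    intro U
    rw [g.map_sum_finset (fun _ i => x i) (fun _ => Uᶜ), ← Finset.sum_filter]
    refine Finset.sum_congr ?_ fun _ _ => rfl
    ext f
    simp [Fintype.mem_piFinset]
  simp_rw [h1, Finset.smul_sum]
  rw [Finset.sum_comm]
  -- the alternating sum over the sets `U` which avoid the range of `f` vanishes unless `f` is onto
  have h2 : ∀ f : Fin n → Fin n, (∑ U : Finset (Fin n), (-1 : ℤ) ^ U.card •
      (if (∀ j, f j ∉ U) then g (x ∘ f) else 0)) =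
      if Function.Bijective f then g (x ∘ f) else 0 := by
    intro f
    have h3 : (∑ U : Finset (Fin n), (-1 : ℤ) ^ U.card •
        (if (∀ j, f j ∉ U) then g (x ∘ f) else 0)) =
        (∑ U ∈ (Finset.univ.image f)ᶜ.powerset, (-1 : ℤ) ^ U.card) • g (x ∘ f) := by
      rw [Finset.sum_smul]
      simp only [smul_ite, smul_zero]
      rw [← Finset.sum_filter]
      refine Finset.sum_congr ?_ fun _ _ => rfl
      ext U
      simp only [Finset.mem_filter, Finset.mem_univ, true_and, Finset.mem_powerset,
        Finset.subset_iff, Finset.mem_compl, Finset.mem_image, not_exists]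
      exact ⟨fun h i hi j hj => h j (hj ▸ hi), fun h j hj => h hj j rfl⟩
    rw [h3, Finset.sum_powerset_neg_one_pow_card]
    have h4 : (Finset.univ.image f)ᶜ = ∅ ↔ Function.Bijective f := by
      rw [Finset.compl_eq_empty_iff, ← Finite.surjective_iff_bijective, Finset.eq_univ_iff_forall]
      simp [Function.Surjective]
    simp only [h4]
    split_ifs <;> simp
  rw [Finset.sum_congr rfl fun f _ => h2 f, ← Finset.sum_filter]
  symm
  refine Finset.sum_bij (fun σ _ => ⇑σ)
    (fun σ _ => by rw [Finset.mem_filter]; exact ⟨Finset.mem_univ _, σ.bijective⟩)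
    (fun σ _ π _ h => DFunLike.coe_injective h) (fun f hf => ?_) (fun _ _ => rfl)
  exact ⟨Equiv.ofBijective f (by simpa using hf), by simp, rfl⟩

/-- If `g` is symmetric and bounded on the diagonal then it is bounded, with a constant which grows
geometrically in the number of variables. -/
theorem MultilinearMap.norm_le_of_diagonal {V : Type*} [AddCommGroup V] [Module ℂ V] {n : ℕ}
    (g : MultilinearMap ℂ (fun _ : Fin n => V) ℂ) (hsym : ∀ (σ : Equiv.Perm (Fin n)) x,
      g (x ∘ σ) = g x) (N : Seminorm ℂ V) (hN : ∀ v, N v = 0 → v = 0) {M : ℝ} (hM : 0 ≤ M)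
    (hg : ∀ v, ‖g fun _ => v‖ ≤ M * N v ^ n) (x : Fin n → V) :
    ‖g x‖ ≤ 6 ^ n * M * ∏ j, N (x j) := by
  classical
  have hunit : ∀ u : Fin n → V, (∀ j, N (u j) ≤ 1) → ‖g u‖ ≤ 6 ^ n * M := by
    intro u hu
    have h1 := g.sum_neg_one_pow_diagonal u
    simp only [hsym, Finset.sum_const, Finset.card_univ, Fintype.card_perm, Fintype.card_fin,
      nsmul_eq_mul] at h1
    -- the polarization formula has `2ⁿ` terms, with arguments of norm at most `n`
    have h2 : ‖(n.factorial : ℂ) * g u‖ ≤ 2 ^ n * (M * (n : ℝ) ^ n) := by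
      rw [← h1]
      refine (norm_sum_le_of_le _ (f := fun U : Finset (Fin n) => _)
        (n := fun _ => M * (n : ℝ) ^ n) fun U _ => ?_).trans_eq (by simp)
      rw [zsmul_eq_mul]
      push_cast
      simp only [norm_mul, norm_pow, norm_neg, norm_one, one_pow, one_mul]
      refine (hg _).trans (mul_le_mul_of_nonneg_left (pow_le_pow_left₀ (apply_nonneg _ _) ?_ n) hM)
      refine (Finset.le_sum_of_subadditive N (by simp) (map_add_le_add N) _ u).trans ?_
      refine (Finset.sum_le_card_nsmul _ _ 1 fun j _ => hu j).trans ?_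
      simpa using (Finset.card_le_univ Uᶜ)
    have h3 : (n : ℝ) ^ n ≤ 3 ^ n * n.factorial := by
      have := Real.pow_div_factorial_le_exp (n : ℝ) (by positivity) n
      rw [div_le_iff₀ (by positivity)] at this
      refine this.trans (mul_le_mul_of_nonneg_right ?_ (by positivity))
      rw [← Real.exp_one_pow]
      exact pow_le_pow_left₀ (by positivity) (Real.exp_one_lt_d9.le.trans (by norm_num)) n
    rw [norm_mul, Complex.norm_natCast] at h2
    have hf : (0 : ℝ) < n.factorial := by positivity
    have h4 : (n.factorial : ℝ) * ‖g u‖ ≤ n.factorial * (6 ^ n * M) := by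
      refine h2.trans ((mul_le_mul_of_nonneg_left (mul_le_mul_of_nonneg_left h3 hM)
        (by positivity)).trans_eq ?_)
      rw [show (6 : ℝ) = 2 * 3 by norm_num, mul_pow]
      ring
    exact le_of_mul_le_mul_left h4 hf
  by_cases hx : ∃ j, N (x j) = 0
  · obtain ⟨j, hj⟩ := hx
    rw [g.map_coord_zero j (hN _ hj), norm_zero]
    have : 0 ≤ ∏ j, N (x j) := Finset.prod_nonneg fun _ _ => apply_nonneg _ _
    positivity
  · push Not at hx
    have hx' : ∀ j, 0 < N (x j) := fun j => (apply_nonneg _ _).lt_of_ne (hx j).symm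
    have h5 : x = fun j => (N (x j) : ℂ) • ((N (x j) : ℂ)⁻¹ • x j) := by
      funext j
      rw [smul_smul, mul_inv_cancel₀ (by exact_mod_cast hx j), one_smul]
    have h6 := hunit (fun j => (N (x j) : ℂ)⁻¹ • x j) fun j => by
      rw [map_smul_eq_mul, norm_inv, Complex.norm_real, Real.norm_of_nonneg (hx' j).le,
        inv_mul_cancel₀ (hx j)]
    conv_lhs => rw [h5]
    rw [g.map_smul_univ, norm_smul, norm_prod, mul_comm]
    simp only [Complex.norm_real, Real.norm_of_nonneg (hx' _).le]
    exact mul_le_mul_of_nonneg_right h6 (Finset.prod_nonneg fun j _ => (hx' j).le)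

/-! ### Coefficients of formal power series -/

namespace PowerSeries

theorem norm_coeff_pow_le {a : ℂ⟦X⟧} {W c : ℝ} (hW : 0 ≤ W) (hc : 0 ≤ c) (h0 : coeff 0 a = 0)
    (h : ∀ n, ‖coeff n a‖ ≤ W * c ^ n) (k n : ℕ) : ‖coeff n (a ^ k)‖ ≤ W ^ k * (2 * c) ^ n := by
  induction k generalizing n with
  | zero =>
    rw [pow_zero, coeff_one]
    split_ifs with hn
    · simp [hn]
    · simp; positivity
  | succ k ih =>
    rw [pow_succ, coeff_mul, Finset.Nat.sum_antidiagonal_eq_sum_range_succ_mk,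
      Finset.sum_range_succ]
    simp only [Nat.sub_self, h0, mul_zero, add_zero]
    refine (norm_sum_le_of_le _ (n := fun i => W ^ (k + 1) * c ^ n * 2 ^ i) fun i hi => ?_).trans ?_
    · rw [norm_mul]
      refine (mul_le_mul (ih i) (h _) (norm_nonneg _) (by positivity)).trans_eq ?_
      have : c ^ n = c ^ i * c ^ (n - i) := by
        rw [← pow_add, Nat.add_sub_cancel' (Finset.mem_range.1 hi).le]
      rw [this, mul_pow]
      ring
    · rw [← Finset.mul_sum, mul_pow, mul_assoc, mul_comm (2 ^ n)]
      have : ∑ i ∈ Finset.range n, (2 : ℝ) ^ i ≤ 2 ^ n := by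
        rw [geom_sum_eq (by norm_num)]
        norm_num
      gcongr

theorem norm_coeff_inv_le {f : ℂ⟦X⟧} {c : ℝ} (hc : 0 ≤ c) (h0 : constantCoeff f = 1)
    (h : ∀ n, ‖coeff n f‖ ≤ c ^ n) (n : ℕ) : ‖coeff n f⁻¹‖ ≤ (2 * c) ^ n := by
  induction n using Nat.strong_induction_on with
  | _ n ih =>
    rcases Nat.eq_zero_or_pos n with rfl | hn
    · simp [h0]
    · have h1 : coeff n (f⁻¹ * f) = 0 := by
        rw [PowerSeries.inv_mul_cancel f (by simp [h0]), coeff_one, if_neg hn.ne']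
      rw [coeff_mul, Finset.Nat.sum_antidiagonal_eq_sum_range_succ_mk, Finset.sum_range_succ] at h1
      simp only [Nat.sub_self, coeff_zero_eq_constantCoeff, h0, mul_one] at h1
      rw [eq_neg_of_add_eq_zero_right h1, norm_neg]
      refine (norm_sum_le_of_le _ (n := fun i => c ^ n * 2 ^ i) fun i hi => ?_).trans ?_
      · rw [norm_mul]
        refine (mul_le_mul (ih i (Finset.mem_range.1 hi)) (h _) (norm_nonneg _)
          (by positivity)).trans_eq ?_
        have : c ^ n = c ^ i * c ^ (n - i) := by
          rw [← pow_add, Nat.add_sub_cancel' (Finset.mem_range.1 hi).le]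
        rw [this, mul_pow]
        ring
      · rw [← Finset.mul_sum, mul_pow, mul_comm (2 ^ n)]
        have : ∑ i ∈ Finset.range n, (2 : ℝ) ^ i ≤ 2 ^ n := by
          rw [geom_sum_eq (by norm_num)]
          norm_num
        gcongr

theorem coeff_pow_eq_zero {R : Type*} [CommRing R] {a : R⟦X⟧} (h0 : coeff 0 a = 0) {k n : ℕ}
    (hkn : n < k) : coeff n (a ^ k) = 0 :=
  coeff_of_lt_order _ ((by exact_mod_cast hkn : (n : ℕ∞) < k).trans_le
    (le_order_pow_of_constantCoeff_eq_zero k (by simpa using h0)))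

theorem coeff_exp_subst {a : ℂ⟦X⟧} (h0 : coeff 0 a = 0) {n m : ℕ} (hnm : n ≤ m) :
    coeff n ((PowerSeries.exp ℂ).subst a) =
      ∑ k ∈ Finset.range (m + 1), (k.factorial : ℂ)⁻¹ * coeff n (a ^ k) := by
  rw [coeff_subst' (HasSubst.of_constantCoeff_zero' (by simpa using h0))]
  rw [finsum_eq_sum_of_support_subset]
  · refine Finset.sum_congr rfl fun k _ => ?_
    simp [coeff_exp]
  · intro k hk
    by_contra hk'
    have : n < k := by simp at hk'; omega
    exact hk (by simp [coeff_pow_eq_zero h0 this])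

/-- If the coefficients of `s` and of `a / W` are bounded geometrically then the `n`-th coefficient of
`s exp(a)` grows in `W` only like the partial sum of order `n` of `exp W`. -/
theorem norm_coeff_mul_exp_subst_le {s a : ℂ⟦X⟧} {W c : ℝ} (hW : 0 ≤ W) (hc : 0 ≤ c)
    (h0 : coeff 0 a = 0) (hs : ∀ n, ‖coeff n s‖ ≤ c ^ n) (h : ∀ n, ‖coeff n a‖ ≤ W * c ^ n)
    (n : ℕ) : ‖coeff n (s * (PowerSeries.exp ℂ).subst a)‖ ≤
      (4 * c) ^ n * ∑ k ∈ Finset.range (n + 1), W ^ k / k.factorial := by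
  set Q := ∑ k ∈ Finset.range (n + 1), W ^ k / k.factorial with hQ
  have hQ0 : 0 ≤ Q := Finset.sum_nonneg fun k _ => by positivity
  rw [coeff_mul]
  refine (norm_sum_le_of_le _ (n := fun _ => (2 * c) ^ n * Q) fun p hp => ?_).trans ?_
  · have hp' := Finset.HasAntidiagonal.mem_antidiagonal.1 hp
    rw [norm_mul, coeff_exp_subst h0 (m := n) (by omega)]
    have h1 : ‖∑ k ∈ Finset.range (n + 1), (k.factorial : ℂ)⁻¹ * coeff p.2 (a ^ k)‖ ≤
        (2 * c) ^ p.2 * Q := by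
      rw [hQ, Finset.mul_sum]
      refine norm_sum_le_of_le _ fun k _ => ?_
      rw [norm_mul, norm_inv, Complex.norm_natCast]
      refine (mul_le_mul_of_nonneg_left (norm_coeff_pow_le hW hc h0 h k p.2)
        (by positivity)).trans_eq ?_
      field_simp
    have h2 : c ^ p.1 ≤ (2 * c) ^ p.1 := pow_le_pow_left₀ hc (by linarith) _
    refine (mul_le_mul ((hs _).trans h2) h1 (norm_nonneg _) (by positivity)).trans_eq ?_
    rw [← mul_assoc, ← pow_add, hp']
  · rw [Finset.sum_const, Finset.Nat.card_antidiagonal, nsmul_eq_mul, ← mul_assoc]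
    refine mul_le_mul_of_nonneg_right ?_ hQ0
    rw [show 4 * c = 2 * (2 * c) by ring, mul_pow 2 (2 * c)]
    refine mul_le_mul_of_nonneg_right ?_ (by positivity)
    exact_mod_cast Nat.lt_two_pow_self (n := n)

/-- The substitution `t = z` in a power series in `t` whose coefficients are polynomials in `z`. -/
def diag (h : PowerSeries (Polynomial ℂ)) : ℂ⟦X⟧ :=
  mk fun n => ∑ p ∈ Finset.HasAntidiagonal.antidiagonal n, (coeff p.1 h).coeff p.2

theorem coeff_diag (h : PowerSeries (Polynomial ℂ)) (n : ℕ) :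
    coeff n (diag h) =
      ∑ p ∈ Finset.HasAntidiagonal.antidiagonal n, (coeff p.1 h).coeff p.2 := coeff_mk _ _

theorem coeff_diag_coe (P : Polynomial (Polynomial ℂ)) (n : ℕ) :
    coeff n (diag (P : PowerSeries (Polynomial ℂ))) = (P.eval Polynomial.X).coeff n := by
  rw [coeff_diag]
  induction P using Polynomial.induction_on' with
  | add p q hp hq =>
    simp only [Polynomial.coe_add, map_add, Polynomial.coeff_add, Finset.sum_add_distrib, hp, hq,
      Polynomial.eval_add]
  | monomial m a =>
    simp only [Polynomial.coeff_coe, Polynomial.eval_monomial, Polynomial.coeff_mul_X_pow',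
      Polynomial.coeff_monomial]
    rw [Finset.Nat.sum_antidiagonal_eq_sum_range_succ_mk]
    have h1 : ∀ k, (if m = k then a else 0).coeff (n - k) = if m = k then a.coeff (n - k) else 0 := by
      intro k
      split_ifs <;> simp
    simp only [h1]
    rw [Finset.sum_ite_eq]
    simp

theorem coeff_diag_trunc (h : PowerSeries (Polynomial ℂ)) {n N : ℕ} (hn : n < N) :
    coeff n (diag (trunc N h : PowerSeries (Polynomial ℂ))) = coeff n (diag h) := by
  rw [coeff_diag, coeff_diag]
  refine Finset.sum_congr rfl fun p hp => ?_
  have := Finset.HasAntidiagonal.mem_antidiagonal.1 hp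
  rw [Polynomial.coeff_coe, coeff_trunc, if_pos (by omega)]

/-- The substitution `t = z` is multiplicative. This follows from the case of polynomials in `t`, for
which it is an evaluation. -/
theorem diag_mul (h h' : PowerSeries (Polynomial ℂ)) : diag (h * h') = diag h * diag h' := by
  ext n
  rw [← coeff_diag_trunc (h * h') n.lt_succ_self, ← trunc_trunc_mul_trunc, ← Polynomial.coe_mul,
    coeff_diag_trunc _ n.lt_succ_self, coeff_diag_coe, Polynomial.eval_mul, Polynomial.coeff_mul,
    coeff_mul]
  refine Finset.sum_congr rfl fun p hp => ?_
  have := Finset.HasAntidiagonal.mem_antidiagonal.1 hp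
  rw [← coeff_diag_coe, ← coeff_diag_coe, coeff_diag_trunc _ (by omega),
    coeff_diag_trunc _ (by omega)]

theorem diag_one : diag 1 = 1 := by
  ext n
  have := coeff_diag_coe 1 n
  rw [Polynomial.coe_one] at this
  simp [this, Polynomial.coeff_one, coeff_one]

theorem diag_pow (h : PowerSeries (Polynomial ℂ)) (k : ℕ) : diag (h ^ k) = diag h ^ k := by
  induction k with
  | zero => simp [diag_one]
  | succ k ih => rw [pow_succ, diag_mul, ih, pow_succ]

end PowerSeries

/-! ### Symmetric tensors of finite rank -/

theorem PowerSeries.coeff_pow_eq_sum_antidiagonalTuple {R : Type*} [CommRing R]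
    (a : PowerSeries R) (m n : ℕ) : PowerSeries.coeff n (a ^ m) =
      ∑ k ∈ Finset.Nat.antidiagonalTuple m n, ∏ i, PowerSeries.coeff (k i) a := by
  have := PowerSeries.coeff_prod (fun _ : Fin m => a) n Finset.univ
  rw [Finset.prod_const, Finset.card_univ, Fintype.card_fin] at this
  rw [this]
  refine Finset.sum_bij (fun l _ => ⇑l) (fun l hl => ?_) (fun _ _ _ _ h => DFunLike.coe_injective h)
    (fun k hk => ⟨Finsupp.equivFunOnFinite.symm k, ?_, rfl⟩) fun _ _ => rfl
  · rw [Finset.Nat.mem_antidiagonalTuple]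
    exact (Finset.mem_finsuppAntidiag.1 hl).1
  · rw [Finset.mem_finsuppAntidiag]
    exact ⟨Finset.Nat.mem_antidiagonalTuple.1 hk, fun _ _ => Finset.mem_univ _⟩

namespace GelfandTriple

variable {T : Type u} (G : GelfandTriple.{u, v} T)

variable {G} in
theorem SymPow.eval_comp {n : ℕ} (φ : G.SymPow n) (σ : Equiv.Perm (Fin n))
    (ω : Fin n → G.CoTest) : φ.1 (ω ∘ σ) = φ.1 ω := φ.2.2 σ ω

theorem coPow_apply {n : ℕ} (ω : G.CoTest) (φ : G.SymPow n) : G.coPow ω n φ = φ.1 fun _ => ω := rfl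

theorem coPow_smul {n : ℕ} (c : ℂ) (ω : G.CoTest) (φ : G.SymPow n) :
    G.coPow (c • ω) n φ = c ^ n * G.coPow ω n φ := by
  rw [coPow_apply, coPow_apply, φ.1.map_smul_univ (fun _ => c)]
  simp

variable {G} in
/-- An element of `Φ^⊙ n` is determined by the homogeneous polynomial `ω ↦ ⟨ω^⊗ n, φ⟩`. -/
theorem SymPow.eq_of_coPow_eq {n : ℕ} {φ ψ : G.SymPow n}
    (h : ∀ ω, G.coPow ω n φ = G.coPow ω n ψ) : φ = ψ := by
  refine Subtype.ext (MultilinearMap.ext fun ω => ?_)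
  have h1 := φ.1.sum_neg_one_pow_diagonal ω
  have h2 := ψ.1.sum_neg_one_pow_diagonal ω
  simp only [φ.eval_comp, ψ.eval_comp, Finset.sum_const, Finset.card_univ, Fintype.card_perm,
      Fintype.card_fin, nsmul_eq_mul] at h1 h2
  simp only [← coPow_apply, h] at h1
  simp only [← coPow_apply] at h2
  exact mul_left_cancel₀ (Nat.cast_ne_zero.2 n.factorial_ne_zero) (h1.symm.trans h2)

theorem symProd_val_apply {n : ℕ} (x : Fin n → G.Test) (ω : Fin n → G.CoTest) :
    (G.symProd x).1 ω = (n.factorial : ℂ)⁻¹ * ∑ σ : Equiv.Perm (Fin n), ∏ j, ω (σ j) (x j) := by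
  have : (G.symProd x).1 ω =
      (n.factorial : ℂ)⁻¹ * ∑ σ : Equiv.Perm (Fin n), ∏ j, ω j (x (σ j)) := by
    simp [symProd, pureTensor_apply]
  rw [this]
  congr 1
  refine Fintype.sum_equiv (Equiv.inv _) _ _ fun σ => ?_
  refine Fintype.prod_equiv σ _ _ fun j => ?_
  simp

theorem coPow_symProd {n : ℕ} (ω : G.CoTest) (x : Fin n → G.Test) :
    G.coPow ω n (G.symProd x) = ∏ j, ω (x j) := by
  rw [coPow_apply, symProd_val_apply, Finset.sum_const, Finset.card_univ, Fintype.card_perm,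
    Fintype.card_fin, nsmul_eq_mul, ← mul_assoc,
    inv_mul_cancel₀ (Nat.cast_ne_zero.2 n.factorial_ne_zero), one_mul]

theorem coPow_tpow {n : ℕ} (ω : G.CoTest) (ξ : G.Test) :
    G.coPow ω n (G.tpow ξ n) = ω ξ ^ n := by
  rw [tpow, coPow_symProd]
  simp

/-- The symmetric tensor product `(x₁, …, xₙ) ↦ x₁ ⊙ ⋯ ⊙ xₙ` as a multilinear map. -/
def symProdMultilinear (n : ℕ) : MultilinearMap ℂ (fun _ : Fin n => G.Test) (G.SymPow n) where
  toFun := G.symProd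
  map_update_add' {_} x i a b := by
    refine SymPow.eq_of_coPow_eq fun ω => ?_
    have h : ∀ y : Fin n → G.Test, G.coPow ω n (G.symProd y) =
        (MultilinearMap.mkPiAlgebra ℂ (Fin n) ℂ).compLinearMap
          (fun _ => (ω : G.Test →ₗ[ℂ] ℂ)) y := fun y => by simp [coPow_symProd]
    rw [map_add, h, h, h]
    convert! MultilinearMap.map_update_add _ x i a b
  map_update_smul' {_} x i c a := by
    refine SymPow.eq_of_coPow_eq fun ω => ?_
    have h : ∀ y : Fin n → G.Test, G.coPow ω n (G.symProd y) =
        (MultilinearMap.mkPiAlgebra ℂ (Fin n) ℂ).compLinearMap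
          (fun _ => (ω : G.Test →ₗ[ℂ] ℂ)) y := fun y => by simp [coPow_symProd]
    rw [map_smul, h, h]
    convert! MultilinearMap.map_update_smul _ x i c a

theorem symProdMultilinear_apply {n : ℕ} (x : Fin n → G.Test) :
    G.symProdMultilinear n x = G.symProd x := rfl

theorem symProd_comp_perm {n : ℕ} (x : Fin n → G.Test) (σ : Equiv.Perm (Fin n)) :
    G.symProd (x ∘ σ) = G.symProd x := by
  refine SymPow.eq_of_coPow_eq fun ω => ?_
  simp only [coPow_symProd, Function.comp_apply]
  exact Equiv.prod_comp σ fun j => ω (x j)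

/-- The tensors of finite rank in `Φ^⊙ n`. -/
def finRank (n : ℕ) : Submodule ℂ (G.SymPow n) :=
  Submodule.span ℂ (Set.range fun ξ => G.tpow ξ n)

theorem tpow_mem_finRank (ξ : G.Test) (n : ℕ) : G.tpow ξ n ∈ G.finRank n :=
  Submodule.subset_span ⟨ξ, rfl⟩

theorem symProd_mem_finRank {n : ℕ} (x : Fin n → G.Test) : G.symProd x ∈ G.finRank n := by
  have h := (G.symProdMultilinear n).sum_neg_one_pow_diagonal x
  simp only [symProdMultilinear_apply, symProd_comp_perm, Finset.sum_const, Finset.card_univ,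
    Fintype.card_perm, Fintype.card_fin] at h
  have h1 : G.symProd x = (n.factorial : ℂ)⁻¹ • (n.factorial • G.symProd x) := by
    rw [← Nat.cast_smul_eq_nsmul ℂ, smul_smul,
      inv_mul_cancel₀ (Nat.cast_ne_zero.2 n.factorial_ne_zero), one_smul]
  rw [h1, ← h]
  refine Submodule.smul_mem _ _ (Submodule.sum_mem _ fun U _ => ?_)
  exact zsmul_mem (G.tpow_mem_finRank _ n) _

/-- The coefficient of `zⁿ` in `(∑ₖ zᵏ xₖ)^⊗ m`. -/
def symCoeff (x : ℕ → G.Test) (m n : ℕ) : G.SymPow m :=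
  ∑ k ∈ Finset.Nat.antidiagonalTuple m n, G.symProd fun i => x (k i)

theorem symCoeff_mem_finRank (x : ℕ → G.Test) (m n : ℕ) : G.symCoeff x m n ∈ G.finRank m :=
  Submodule.sum_mem _ fun _ _ => G.symProd_mem_finRank _

theorem coPow_symCoeff (ω : G.CoTest) (x : ℕ → G.Test) (m n : ℕ) :
    G.coPow ω m (G.symCoeff x m n) =
      PowerSeries.coeff n ((PowerSeries.mk fun k => ω (x k)) ^ m) := by
  rw [symCoeff, map_sum, PowerSeries.coeff_pow_eq_sum_antidiagonalTuple]
  simp [coPow_symProd]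

end GelfandTriple

/-! ### Identities of formal power series along curves -/

namespace PowerSeries

theorem coeff_pow_congr {R : Type*} [CommRing R] {f g : R⟦X⟧} {N : ℕ}
    (h : ∀ i ≤ N, coeff i f = coeff i g) (k : ℕ) {n : ℕ} (hn : n ≤ N) :
    coeff n (f ^ k) = coeff n (g ^ k) := by
  have h1 : X ^ (N + 1) ∣ f - g := X_pow_dvd_iff.2 fun m hm => by
    rw [map_sub, h m (by omega), sub_self]
  have h2 := X_pow_dvd_iff.1 (h1.trans (sub_dvd_pow_sub_pow f g k)) n (by omega)
  rwa [map_sub, sub_eq_zero] at h2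

theorem diag_sum_C_mul {ι : Type*} (s : Finset ι) (c : ι → ℂ)
    (h : ι → PowerSeries (Polynomial ℂ)) :
    diag (∑ i ∈ s, C (Polynomial.C (c i)) * h i) = ∑ i ∈ s, C (c i) * diag (h i) := by
  ext n
  simp only [coeff_diag, map_sum, coeff_C_mul, Polynomial.finsetSum_coeff, Polynomial.coeff_C_mul]
  rw [Finset.sum_comm]
  simp only [Finset.mul_sum]

theorem coeff_diag_congr {h h' : PowerSeries (Polynomial ℂ)} {n : ℕ}
    (H : ∀ i ≤ n, coeff i h = coeff i h') : coeff n (diag h) = coeff n (diag h') := by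
  rw [coeff_diag, coeff_diag]
  refine Finset.sum_congr rfl fun p hp => ?_
  have := Finset.HasAntidiagonal.mem_antidiagonal.1 hp
  rw [H _ (by omega)]

end PowerSeries

namespace GelfandTriple

variable {T : Type u} (G : GelfandTriple.{u, v} T)

/-- Lowering all the exponents of a curve without constant term. -/
theorem symCoeff_shift {x : ℕ → G.Test} (hx : x 0 = 0) {m n : ℕ} (hmn : m ≤ n) :
    G.symCoeff x m n = G.symCoeff (fun k => x (k + 1)) m (n - m) := by
  refine SymPow.eq_of_coPow_eq fun ω => ?_
  rw [coPow_symCoeff, coPow_symCoeff]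
  have : (PowerSeries.mk fun k => ω (x k)) =
      PowerSeries.X * PowerSeries.mk fun k => ω (x (k + 1)) := by
    ext n
    cases n with
    | zero => simp [hx]
    | succ n => simp [PowerSeries.coeff_succ_X_mul]
  rw [this, mul_pow, PowerSeries.coeff_X_pow_mul', if_pos hmn]

/-- The composition `∑ₘ ℓₘ(x(z)^⊗ m)` of a sequence of linear functionals with a formal curve
`x(z) = ∑ₖ zᵏ xₖ` without constant term. -/
def alongCurve (ℓ : ∀ m, G.SymPow m →ₗ[ℂ] ℂ) (x : ℕ → G.Test) : PowerSeries ℂ :=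
  PowerSeries.mk fun n => ∑ m ∈ Finset.range (n + 1), ℓ m (G.symCoeff x m n)

/-- The polynomial `z ↦ ℓ(x(z)^⊗ m)`, where `x(z) = ∑ zᵏ xₖ` with the sum over `k ≤ N`. -/
def curvePoly {m : ℕ} (ℓ : G.SymPow m →ₗ[ℂ] ℂ) (x : ℕ → G.Test) (N : ℕ) : Polynomial ℂ :=
  ∑ f ∈ Fintype.piFinset fun _ : Fin m => Finset.range (N + 1),
    Polynomial.monomial (∑ i, f i) (ℓ (G.symProd fun i => x (f i)))

theorem eval_curvePoly {m : ℕ} (ℓ : G.SymPow m →ₗ[ℂ] ℂ) (x : ℕ → G.Test) (N : ℕ) (z : ℂ) :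
    (G.curvePoly ℓ x N).eval z =
      ℓ (G.tpow (∑ k ∈ Finset.range (N + 1), z ^ k • x k) m) := by
  rw [tpow, ← symProdMultilinear_apply, (G.symProdMultilinear m).map_sum_finset
    (fun _ k => z ^ k • x k) (fun _ => Finset.range (N + 1)), map_sum, curvePoly,
    Polynomial.eval_finsetSum]
  refine Finset.sum_congr rfl fun f _ => ?_
  rw [(G.symProdMultilinear m).map_smul_univ (fun i => z ^ f i) (fun i => x (f i)), map_smul,
    Polynomial.eval_monomial, smul_eq_mul, mul_comm, Finset.prod_pow_eq_pow_sum]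
  rfl

theorem coeff_curvePoly {m : ℕ} (ℓ : G.SymPow m →ₗ[ℂ] ℂ) (x : ℕ → G.Test) {N n : ℕ}
    (hn : n ≤ N) : (G.curvePoly ℓ x N).coeff n = ℓ (G.symCoeff x m n) := by
  rw [curvePoly, Polynomial.finsetSum_coeff, symCoeff, map_sum]
  simp only [Polynomial.coeff_monomial]
  rw [← Finset.sum_filter]
  refine Finset.sum_congr ?_ fun _ _ => rfl
  ext f
  simp only [Finset.mem_filter, Fintype.mem_piFinset, Finset.mem_range,
    Finset.Nat.mem_antidiagonalTuple, and_iff_right_iff_imp]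
  intro h i
  have : f i ≤ ∑ i, f i := Finset.single_le_sum (fun _ _ => Nat.zero_le _) (Finset.mem_univ i)
  omega

theorem coeff_diag_curvePoly (ℓ : ∀ m, G.SymPow m →ₗ[ℂ] ℂ) {x : ℕ → G.Test} (hx : x 0 = 0)
    {N n : ℕ} (hn : n ≤ N) : PowerSeries.coeff n (PowerSeries.diag (PowerSeries.mk fun m =>
      G.curvePoly (ℓ m) (fun k => x (k + 1)) N)) = PowerSeries.coeff n (G.alongCurve ℓ x) := by
  rw [PowerSeries.coeff_diag, alongCurve, PowerSeries.coeff_mk,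
    Finset.Nat.sum_antidiagonal_eq_sum_range_succ_mk]
  refine Finset.sum_congr rfl fun m hm => ?_
  have : m ≤ n := Nat.lt_succ_iff.1 (Finset.mem_range.1 hm)
  rw [PowerSeries.coeff_mk, G.coeff_curvePoly _ _ (by omega), G.symCoeff_shift hx this]

/-- An identity `F(η) = σ(η) exp(a(η))` of formal power series on `Φ` which holds on all lines
`η = zξ` holds on all formal curves without constant term.

For the curve `x(z) = z y(z)`, with `y` truncated to a polynomial in `z`, the identity on the line
spanned by `y(z)`, with parameter `t`, is an identity of power series in `t` whose coefficients are
polynomials in `z`, because it holds for all values of `z`. The substitution `t = z` gives the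
identity on the curve. -/
theorem alongCurve_eq_mul_exp {F σ a : ∀ m, G.SymPow m →ₗ[ℂ] ℂ} (ha : a 0 = 0)
    (h : ∀ η, (PowerSeries.mk fun n => F n (G.tpow η n)) =
      (PowerSeries.mk fun n => σ n (G.tpow η n)) *
        (PowerSeries.exp ℂ).subst (PowerSeries.mk fun n => a n (G.tpow η n)))
    {x : ℕ → G.Test} (hx : x 0 = 0) :
    G.alongCurve F x = G.alongCurve σ x * (PowerSeries.exp ℂ).subst (G.alongCurve a x) := by
  ext N
  set y : ℕ → G.Test := fun k => x (k + 1) with hy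
  let Θ : (∀ m, G.SymPow m →ₗ[ℂ] ℂ) → PowerSeries (Polynomial ℂ) := fun ℓ =>
    PowerSeries.mk fun m => G.curvePoly (ℓ m) y N
  let E : PowerSeries (Polynomial ℂ) := ∑ k ∈ Finset.range (N + 1),
    PowerSeries.C (Polynomial.C (k.factorial : ℂ)⁻¹) * Θ a ^ k
  have hΘ : ∀ ℓ z, PowerSeries.map (Polynomial.evalRingHom z) (Θ ℓ) = PowerSeries.mk fun m =>
      ℓ m (G.tpow (∑ k ∈ Finset.range (N + 1), z ^ k • y k) m) := by
    intro ℓ z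
    ext m
    rw [PowerSeries.coeff_map, PowerSeries.coeff_mk, PowerSeries.coeff_mk,
      Polynomial.coe_evalRingHom, eval_curvePoly]
  have hid : ∀ i ≤ N, PowerSeries.coeff i (Θ F) = PowerSeries.coeff i (Θ σ * E) := by
    intro i hi
    refine Polynomial.funext fun z => ?_
    have h1 := congrArg (PowerSeries.coeff i) (h (∑ k ∈ Finset.range (N + 1), z ^ k • y k))
    rw [← hΘ, ← hΘ, ← hΘ, PowerSeries.coeff_map] at h1
    refine h1.trans ?_
    rw [← Polynomial.coe_evalRingHom, ← PowerSeries.coeff_map, RingHom.map_mul, PowerSeries.coeff_mul,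
      PowerSeries.coeff_mul]
    refine Finset.sum_congr rfl fun p hp => ?_
    have hp' := Finset.HasAntidiagonal.mem_antidiagonal.1 hp
    rw [PowerSeries.coeff_exp_subst (by simp [Θ, hΘ, ha]) (m := N) (by omega)]
    simp only [E, map_sum, map_mul, map_pow, PowerSeries.map_C, Polynomial.coe_evalRingHom,
      Polynomial.eval_C, PowerSeries.coeff_C_mul]
  have hcomp : ∀ ℓ, ∀ n ≤ N, PowerSeries.coeff n (PowerSeries.diag (Θ ℓ)) =
      PowerSeries.coeff n (G.alongCurve ℓ x) := fun ℓ n hn => G.coeff_diag_curvePoly ℓ hx hn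
  rw [← hcomp F N le_rfl, PowerSeries.coeff_diag_congr hid, PowerSeries.diag_mul,
    PowerSeries.diag_sum_C_mul, PowerSeries.coeff_mul, PowerSeries.coeff_mul]
  refine Finset.sum_congr rfl fun p hp => ?_
  have hp' := Finset.HasAntidiagonal.mem_antidiagonal.1 hp
  rw [hcomp σ _ (by omega), PowerSeries.coeff_exp_subst (m := N) (by simp [alongCurve, ha])
    (by omega), map_sum]
  refine congrArg _ (Finset.sum_congr rfl fun k _ => ?_)
  rw [PowerSeries.coeff_C_mul, PowerSeries.diag_pow,
    PowerSeries.coeff_pow_congr (hcomp a) k (by omega)]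

end GelfandTriple

/-! ### Estimates of tensors in nuclear scales -/

/-- The adjoint of a Hilbert–Schmidt operator is again of Hilbert–Schmidt class. -/
theorem IsHilbertSchmidt.sum_norm_toDual_comp_le {E F : Type*} [NormedAddCommGroup E]
    [InnerProductSpace ℂ E] [CompleteSpace E] [NormedAddCommGroup F] [InnerProductSpace ℂ F]
    [CompleteSpace F] {j : E →L[ℂ] F} (hj : IsHilbertSchmidt j) :
    ∃ C : ℝ, 0 ≤ C ∧ ∀ (m : ℕ) (e : Fin m → F), Orthonormal ℂ e →
      ∑ i, ‖(InnerProductSpace.toDual ℂ F (e i)).comp j‖ ^ 2 ≤ C := by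
  obtain ⟨C, hC⟩ := hj
  refine ⟨C, by simpa using hC 0 Fin.elim0 (by simp), fun m e he => ?_⟩
  have h1 : ∀ i, (InnerProductSpace.toDual ℂ F (e i)).comp j =
      InnerProductSpace.toDual ℂ E (j.adjoint (e i)) := fun i => by
    ext x
    simp [ContinuousLinearMap.adjoint_inner_left]
  simp only [h1, LinearIsometryEquiv.norm_map]
  let S : Submodule ℂ E := Submodule.span ℂ (Set.range fun i => j.adjoint (e i))
  have : FiniteDimensional ℂ S := FiniteDimensional.span_of_finite ℂ (Set.finite_range _)
  let b := stdOrthonormalBasis ℂ S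
  have hb : Orthonormal ℂ fun k => (b k : E) := by
    simpa [Function.comp_def] using b.orthonormal.comp_linearIsometry S.subtypeₗᵢ
  have h2 : ∀ i, ‖j.adjoint (e i)‖ ^ 2 = ∑ k, ‖inner ℂ (e i) (j (b k : E))‖ ^ 2 := by
    intro i
    have := b.sum_sq_norm_inner_right ⟨j.adjoint (e i), Submodule.subset_span ⟨i, rfl⟩⟩
    refine this.symm.trans (Finset.sum_congr rfl fun k _ => ?_)
    rw [Submodule.coe_inner, ContinuousLinearMap.adjoint_inner_right, norm_inner_symm]
  simp only [h2]
  rw [Finset.sum_comm]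
  refine (Finset.sum_le_sum fun k _ => ?_).trans (hC _ _ hb)
  exact he.sum_inner_products_le _

namespace GelfandTriple

variable {T : Type u} (G : GelfandTriple.{u, v} T)

/-- The norm of `H τ` on `Φ`. -/
def testSeminorm (τ : T) : Seminorm ℂ G.Test := (normSeminorm ℂ (G.H τ)).comp (G.toH τ).toLinearMap

theorem emb_toH (τ : T) (ξ : G.Test) : G.emb τ (G.toH τ ξ) = ξ.1 G.τ₀ := ξ.2 τ

theorem toH_injective (τ : T) : Function.Injective (G.toH τ) := by
  intro x y hxy
  refine Subtype.ext (funext fun σ => G.emb_injective σ ?_)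
  rw [x.2 σ, y.2 σ, ← G.emb_toH τ, ← G.emb_toH τ, hxy]

theorem eq_zero_of_testSeminorm (τ : T) (ξ : G.Test) (h : G.testSeminorm τ ξ = 0) : ξ = 0 :=
  G.toH_injective τ (by rw [map_zero]; exact norm_eq_zero.1 h)

/-- The inclusion `H τ₂ ⊂ H τ₁` is the identity on `Φ`. -/
theorem incl_toH {τ₁ τ₂ : T} {j : G.H τ₂ →L[ℂ] G.H τ₁} (hj : ∀ x, G.emb τ₁ (j x) = G.emb τ₂ x)
    (ξ : G.Test) : j (G.toH τ₂ ξ) = G.toH τ₁ ξ :=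
  G.emb_injective τ₁ (by rw [hj, emb_toH, emb_toH])

theorem ofNeg_comp {τ₁ τ₂ : T} {j : G.H τ₂ →L[ℂ] G.H τ₁} (hj : ∀ x, G.emb τ₁ (j x) = G.emb τ₂ x)
    (w : G.Neg τ₁) : G.ofNeg τ₂ (w.comp j) = G.ofNeg τ₁ w := by
  ext ξ
  rw [ofNeg_apply, ofNeg_apply, ContinuousLinearMap.comp_apply, G.incl_toH hj]

theorem norm_toH_le {τ₁ τ₂ : T} {j : G.H τ₂ →L[ℂ] G.H τ₁}
    (hj : ∀ x, G.emb τ₁ (j x) = G.emb τ₂ x) (ξ : G.Test) :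
    ‖G.toH τ₁ ξ‖ ≤ ‖j‖ * ‖G.toH τ₂ ξ‖ := by
  rw [← G.incl_toH hj]
  exact j.le_opNorm _

theorem norm_ofNeg_apply_le (τ : T) (w : G.Neg τ) (ξ : G.Test) :
    ‖G.ofNeg τ w ξ‖ ≤ ‖w‖ * ‖G.toH τ ξ‖ := w.le_opNorm _

variable {G} in
/-- The norm of an `n`-linear form on `H₋τ` is controlled by its values on the diagonal. -/
theorem SymPow.norm_apply_le {n : ℕ} (φ : G.SymPow n) (τ : T) {M : ℝ} (hM : 0 ≤ M)
    (h : ∀ w : G.Neg τ, ‖w‖ ≤ 1 → ‖G.coPow (G.ofNeg τ w) n φ‖ ≤ M) (w : Fin n → G.Neg τ) :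
    ‖φ.1 fun i => G.ofNeg τ (w i)‖ ≤ 6 ^ n * M * ∏ i, ‖w i‖ := by
  refine (φ.1.compLinearMap fun _ => G.ofNeg τ).norm_le_of_diagonal (fun σ x => ?_)
    (normSeminorm ℂ (G.Neg τ)) (fun w (hw : ‖w‖ = 0) => norm_eq_zero.1 hw) hM (fun w => ?_) w
  · exact φ.eval_comp σ fun i => G.ofNeg τ (x i)
  · change ‖φ.1 fun _ => G.ofNeg τ w‖ ≤ M * ‖w‖ ^ n
    by_cases hw : ‖w‖ = 0
    · have h0 := h 0 (by simp)
      have hw' : w = 0 := norm_eq_zero.1 hw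
      subst hw'
      rcases Nat.eq_zero_or_pos n with rfl | hn
      · simpa [coPow_apply] using h0
      · have : Nonempty (Fin n) := ⟨⟨0, hn⟩⟩
        rw [map_zero]
        have h1 : (φ.1 fun _ => (0 : G.CoTest)) = 0 := φ.1.map_zero
        rw [h1]
        simp [hn.ne']
    · have h1 := h ((‖w‖ : ℂ)⁻¹ • w) (by
        rw [norm_smul, norm_inv, Complex.norm_real, norm_norm, inv_mul_cancel₀ hw])
      rw [map_smul, coPow_smul, norm_mul, norm_pow, norm_inv, Complex.norm_real, norm_norm,
        inv_pow, inv_mul_le_iff₀ (by positivity), mul_comm, coPow_apply] at h1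
      exact h1

/-- A linear functional on the tensors of finite rank which is bounded on the powers `ξ^⊗ n` is
bounded on the symmetric products. -/
theorem norm_finRank_symProd_le {n : ℕ} (F : G.finRank n →ₗ[ℂ] ℂ) (τ : T) {M : ℝ} (hM : 0 ≤ M)
    (hF : ∀ ξ, ‖F ⟨G.tpow ξ n, G.tpow_mem_finRank ξ n⟩‖ ≤ M * ‖G.toH τ ξ‖ ^ n)
    (x : Fin n → G.Test) :
    ‖F ⟨G.symProd x, G.symProd_mem_finRank x⟩‖ ≤ 6 ^ n * M * ∏ i, ‖G.toH τ (x i)‖ := by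
  refine (F.compMultilinearMap ((G.symProdMultilinear n).codRestrict (G.finRank n)
    G.symProd_mem_finRank)).norm_le_of_diagonal (fun σ x => ?_) (G.testSeminorm τ)
    (G.eq_zero_of_testSeminorm τ) hM hF x
  simp only [LinearMap.compMultilinearMap_apply]
  congr 1
  exact Subtype.ext (G.symProd_comp_perm x σ)

/-- Each tensor of finite rank can be expanded in tensor products of a finite family in `Φ` which is
orthonormal in `H τ`. -/
theorem exists_orthonormal_expansion (τ : T) {n : ℕ} {φ : G.SymPow n} (hφ : φ ∈ G.finRank n) :
    ∃ (m : ℕ) (e : Fin m → G.Test), Orthonormal ℂ (fun a => G.toH τ (e a)) ∧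
      φ = ∑ i : Fin n → Fin m, (φ.1 fun k => G.ofNeg τ
        (InnerProductSpace.toDual ℂ (G.H τ) (G.toH τ (e (i k))))) • G.symProd (e ∘ i) := by
  obtain ⟨p, c, ξ, rfl⟩ := Submodule.mem_span_set'.1 hφ
  choose ζ hζ using fun a => (ξ a).2
  let E : Submodule ℂ (G.H τ) := Submodule.span ℂ (Set.range fun a => G.toH τ (ζ a))
  have : FiniteDimensional ℂ E := FiniteDimensional.span_of_finite ℂ (Set.finite_range _)
  let b := stdOrthonormalBasis ℂ E
  have hb : Orthonormal ℂ fun k => (b k : G.H τ) := by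
    simpa [Function.comp_def] using b.orthonormal.comp_linearIsometry E.subtypeₗᵢ
  have hE : ∀ x ∈ E, ∃ y, G.toH τ y = x := by
    intro x hx
    have : E ≤ LinearMap.range (G.toH τ).toLinearMap := by
      rw [Submodule.span_le]
      rintro _ ⟨a, rfl⟩
      exact ⟨ζ a, rfl⟩
    exact this hx
  choose e he using fun k => hE _ (b k).2
  have he' : (fun a => G.toH τ (e a)) = fun k => (b k : G.H τ) := funext he
  refine ⟨_, e, by rw [he']; exact hb, ?_⟩
  have hexp : ∀ a, ζ a = ∑ k, inner ℂ (G.toH τ (e k)) (G.toH τ (ζ a)) • e k := by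
    intro a
    apply G.toH_injective τ
    have h1 := congrArg Subtype.val
      (b.sum_repr' ⟨G.toH τ (ζ a), Submodule.subset_span ⟨a, rfl⟩⟩)
    simp only [Submodule.coe_sum, Submodule.coe_smul, Submodule.coe_inner] at h1
    simp only [map_sum, map_smul, he]
    exact h1.symm
  have hpow : ∀ a, G.tpow (ζ a) n = ∑ i : Fin n → Fin _,
      ((G.tpow (ζ a) n).1 fun k => G.ofNeg τ
        (InnerProductSpace.toDual ℂ (G.H τ) (G.toH τ (e (i k))))) • G.symProd (e ∘ i) := by
    intro a
    conv_lhs => rw [hexp a, tpow, ← symProdMultilinear_apply]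
    rw [(G.symProdMultilinear n).map_sum
      (fun _ k => inner ℂ (G.toH τ (e k)) (G.toH τ (ζ a)) • e k)]
    refine Finset.sum_congr rfl fun i _ => ?_
    rw [(G.symProdMultilinear n).map_smul_univ
      (fun k => inner ℂ (G.toH τ (e (i k))) (G.toH τ (ζ a))) (fun k => e (i k))]
    congr 1
    rw [tpow, symProd_val_apply]
    simp only [ofNeg_apply, InnerProductSpace.toDual_apply_apply]
    have : ∀ σ : Equiv.Perm (Fin n), ∏ k, inner ℂ (G.toH τ (e (i (σ k)))) (G.toH τ (ζ a)) =
        ∏ k, inner ℂ (G.toH τ (e (i k))) (G.toH τ (ζ a)) := fun σ =>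
      Equiv.prod_comp σ fun k => inner ℂ (G.toH τ (e (i k))) (G.toH τ (ζ a))
    simp only [this, Finset.sum_const, Finset.card_univ, Fintype.card_perm, Fintype.card_fin,
      nsmul_eq_mul]
    rw [← mul_assoc, inv_mul_cancel₀ (Nat.cast_ne_zero.2 n.factorial_ne_zero), one_mul]
  have hval : ∀ ω : Fin n → G.CoTest, (∑ a, c a • (ξ a : G.SymPow n)).1 ω =
      ∑ a, c a * (G.tpow (ζ a) n).1 ω := by
    intro ω
    let ev : G.SymPow n →ₗ[ℂ] ℂ :=
      { toFun := fun φ => φ.1 ω, map_add' := fun _ _ => rfl, map_smul' := fun _ _ => rfl }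
    change ev _ = _
    simp only [map_sum, map_smul, smul_eq_mul, ← hζ]
    rfl
  simp only [hval, Finset.sum_smul]
  rw [Finset.sum_comm]
  refine Finset.sum_congr rfl fun a _ => ?_
  simp only [mul_smul, ← Finset.smul_sum]
  rw [← hpow, ← hζ]

/-- A kernel theorem with explicit bounds: a functional on the tensors of finite rank which is
bounded on the powers `ξ^⊗ n` by a norm `‖·‖_τ` is bounded by the supremum of the
polynomial `⟨ω^⊗ n, φ⟩` over the unit ball of some `H₋σ`. -/
theorem exists_norm_finRank_le (τ : T) : ∃ (σ : T) (K : ℝ), 0 ≤ K ∧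
    ∀ (n : ℕ) (F : G.finRank n →ₗ[ℂ] ℂ) (M : ℝ), 0 ≤ M →
      (∀ ξ, ‖F ⟨G.tpow ξ n, G.tpow_mem_finRank ξ n⟩‖ ≤ M * ‖G.toH τ ξ‖ ^ n) →
      ∀ (φ : G.finRank n) (N : ℝ), 0 ≤ N →
        (∀ w : G.Neg σ, ‖w‖ ≤ 1 → ‖G.coPow (G.ofNeg σ w) n φ.1‖ ≤ N) →
        ‖F φ‖ ≤ K ^ n * M * N := by
  obtain ⟨τ₁, j₁, hj₁, C₁, hC₁⟩ := G.nuclear τ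
  obtain ⟨σ, j₂, hj₂, hS⟩ := G.nuclear τ₁
  obtain ⟨C₂, hC₂0, hC₂⟩ := hS.sum_norm_toDual_comp_le
  have hC₁0 : 0 ≤ C₁ := by simpa using hC₁ 0 Fin.elim0 (by simp)
  refine ⟨σ, 36 * (C₁ + C₂), by positivity, fun n F M hM hF φ N hN hφ => ?_⟩
  obtain ⟨m, e, he, hexp⟩ := G.exists_orthonormal_expansion τ₁ φ.2
  have hφ' : φ = ∑ i : Fin n → Fin m, (φ.1.1 fun k => G.ofNeg τ₁
      (InnerProductSpace.toDual ℂ (G.H τ₁) (G.toH τ₁ (e (i k))))) •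
        (⟨G.symProd (e ∘ i), G.symProd_mem_finRank _⟩ : G.finRank n) := by
    refine Subtype.ext (hexp.trans ?_)
    simp
  let s : Fin m → ℝ := fun a => ‖G.toH τ (e a)‖
  let t : Fin m → ℝ := fun a =>
    ‖(InnerProductSpace.toDual ℂ (G.H τ₁) (G.toH τ₁ (e a))).comp j₂‖
  have hst : ∑ a, s a * t a ≤ C₁ + C₂ := by
    have h1 : ∑ a, s a ^ 2 ≤ C₁ := by
      have := hC₁ m _ he
      simpa only [G.incl_toH hj₁] using this
    have h2 : ∑ a, t a ^ 2 ≤ C₂ := hC₂ m _ he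
    calc ∑ a, s a * t a ≤ ∑ a, (s a ^ 2 + t a ^ 2) := Finset.sum_le_sum fun a _ => by
          nlinarith [sq_nonneg (s a - t a), sq_nonneg (s a + t a)]
      _ ≤ C₁ + C₂ := by rw [Finset.sum_add_distrib]; exact add_le_add h1 h2
  rw [hφ', map_sum]
  refine (norm_sum_le_of_le _ (n := fun i => (36 : ℝ) ^ n * M * N * ∏ k, (s (i k) * t (i k)))
    fun i _ => ?_).trans ?_
  · rw [map_smul, norm_smul]
    have h1 := G.norm_finRank_symProd_le F τ hM hF (e ∘ i)
    have h2 := φ.1.norm_apply_le σ hN hφ fun k =>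
      (InnerProductSpace.toDual ℂ (G.H τ₁) (G.toH τ₁ (e (i k)))).comp j₂
    simp only [G.ofNeg_comp hj₂] at h2
    refine (mul_le_mul h2 h1 (norm_nonneg _) (by positivity)).trans_eq ?_
    rw [Finset.prod_mul_distrib, show (36 : ℝ) = 6 * 6 by norm_num, mul_pow]
    simp only [s, t, Function.comp_apply]
    ring
  · rw [← Finset.mul_sum, ← Fintype.sum_pow (fun a => s a * t a), mul_pow]
    have : (∑ a, s a * t a) ^ n ≤ (C₁ + C₂) ^ n := pow_le_pow_left₀
      (Finset.sum_nonneg fun a _ => mul_nonneg (norm_nonneg _) (norm_nonneg _)) hst n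
    calc _ ≤ (36 : ℝ) ^ n * M * N * (C₁ + C₂) ^ n := by gcongr
      _ = _ := by ring

/-- The Hilbert–Schmidt norm of a tensor is controlled by the supremum of the corresponding
polynomial over the unit ball of some `H₋σ`. -/
theorem exists_powSeminorm_le (τ : T) : ∃ (σ : T) (K : ℝ), 0 ≤ K ∧
    ∀ (n : ℕ) (φ : G.SymPow n) (N : ℝ), 0 ≤ N →
      (∀ w : G.Neg σ, ‖w‖ ≤ 1 → ‖G.coPow (G.ofNeg σ w) n φ‖ ≤ N) →
      G.powSeminorm n τ φ ≤ K ^ n * N := by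
  obtain ⟨σ, j, hj, hS⟩ := G.nuclear τ
  obtain ⟨C, hC0, hC⟩ := hS.sum_norm_toDual_comp_le
  refine ⟨σ, 6 * Real.sqrt C, by positivity, fun n φ N hN hφ => ?_⟩
  refine Real.iSup_le (fun e => ?_) (by positivity)
  obtain ⟨m, e, he⟩ := e
  change G.famSeminorm n τ e φ.1 ≤ _
  rw [famSeminorm_apply]
  refine Real.sqrt_le_iff.2 ⟨by positivity, ?_⟩
  let t : Fin m → ℝ := fun a => ‖(InnerProductSpace.toDual ℂ (G.H τ) (e a)).comp j‖
  have h1 : ∀ i : Fin n → Fin m, ‖φ.1 fun k => G.ofNeg τ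
      (InnerProductSpace.toDual ℂ (G.H τ) (e (i k)))‖ ^ 2 ≤
      (6 ^ n * N) ^ 2 * ∏ k, t (i k) ^ 2 := by
    intro i
    have h2 := φ.norm_apply_le σ hN hφ fun k =>
      (InnerProductSpace.toDual ℂ (G.H τ) (e (i k))).comp j
    simp only [G.ofNeg_comp hj] at h2
    rw [Finset.prod_pow, ← mul_pow]
    exact pow_le_pow_left₀ (norm_nonneg _) h2 2
  refine (Finset.sum_le_sum fun i _ => h1 i).trans ?_
  rw [← Finset.mul_sum, ← Fintype.sum_pow (fun a => t a ^ 2)]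
  have h3 : (∑ a, t a ^ 2) ^ n ≤ C ^ n :=
    pow_le_pow_left₀ (Finset.sum_nonneg fun a _ => by positivity) (hC m e he) n
  calc _ ≤ (6 ^ n * N) ^ 2 * C ^ n := by gcongr
    _ = _ := by
      conv_lhs => rw [← Real.sq_sqrt hC0]
      ring

end GelfandTriple

/-! ### Cauchy's estimate -/

/-- Cauchy's estimate for the coefficients of a convergent power series. -/
theorem Complex.norm_coeff_mul_pow_le {a : ℕ → ℂ} {g : ℂ → ℂ} {R M : ℝ} (hR : 0 < R)
    (hsum : ∀ z : ℂ, ‖z‖ < R → HasSum (fun n => a n * z ^ n) (g z))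
    (hM : ∀ z : ℂ, ‖z‖ < R → ‖g z‖ ≤ M) (n : ℕ) : ‖a n‖ * R ^ n ≤ M := by
  let p := FormalMultilinearSeries.ofScalars ℂ a
  have hrad : ENNReal.ofReal R ≤ p.radius := by
    refine ENNReal.le_of_forall_nnreal_lt fun r hr => ?_
    have hr' : (r : ℝ) < R := by
      rw [← ENNReal.ofReal_coe_nnreal, ENNReal.ofReal_lt_ofReal_iff hR] at hr
      exact hr
    have h1 := (hsum (r : ℝ) (by simpa using hr')).summable.tendsto_atTop_zero.norm
    refine p.le_radius_of_tendsto (l := 0) ?_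
    simpa [p, FormalMultilinearSeries.ofScalars_norm] using h1
  have hp : HasFPowerSeriesOnBall g p 0 (ENNReal.ofReal R) :=
    { r_le := hrad
      r_pos := by simpa using hR
      hasSum := fun {y} hy => by
        have hy' : ‖y‖ < R := by
          rw [Metric.mem_eball, edist_zero_right, ← ofReal_norm,
            ENNReal.ofReal_lt_ofReal_iff hR] at hy
          exact hy
        simpa [p, FormalMultilinearSeries.ofScalars_apply_eq, mul_comm] using hsum y hy' }
  have hcoef : iteratedDeriv n g 0 = n.factorial * a n := by
    have := hp.factorial_smul (1 : ℂ) n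
    rw [iteratedDeriv_eq_iteratedFDeriv, ← this]
    simp [p]
  have hball : Metric.eball (0 : ℂ) (ENNReal.ofReal R) = Metric.ball 0 R := Metric.eball_ofReal
  have hd : DifferentiableOn ℂ g (Metric.ball 0 R) := by
    have := hp.differentiableOn
    rwa [hball] at this
  have key : ∀ r : ℝ, 0 < r → r < R → ‖a n‖ * r ^ n ≤ M := by
    intro r hr hrR
    have h1 := Complex.norm_iteratedDeriv_le_of_forall_mem_sphere_norm_le (f := g) (c := 0) (C := M)
      n hr ((hd.mono (Metric.closedBall_subset_ball hrR)).diffContOnCl_ball subset_rfl)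
      (fun z hz => hM z (by rw [mem_sphere_zero_iff_norm.1 hz]; exact hrR))
    rw [hcoef, norm_mul, Complex.norm_natCast, mul_div_assoc] at h1
    have h2 := le_of_mul_le_mul_left h1 (by positivity : (0 : ℝ) < n.factorial)
    rwa [le_div_iff₀ (by positivity)] at h2
  have hlim : Filter.Tendsto (fun r : ℝ => ‖a n‖ * r ^ n) (𝓝[<] R) (𝓝 (‖a n‖ * R ^ n)) :=
    ((continuous_const.mul (continuous_pow n)).tendsto R).mono_left nhdsWithin_le_nhds
  refine le_of_tendsto hlim ?_
  filter_upwards [Ioo_mem_nhdsLT hR] with r hr using key r hr.1 hr.2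

/-! ### Elementary inequalities for the weights -/

/-- Powers are dominated by `s ↦ exp(s ^ β / 2 ^ l)`. -/
theorem exists_pow_le_exp_rpow {β : ℝ} (hβ : 0 < β) (l n : ℕ) :
    ∃ K : ℝ, 0 ≤ K ∧ ∀ s : ℝ, 0 ≤ s → s ^ n ≤ K * Real.exp (s ^ β / 2 ^ l) := by
  obtain ⟨k, hk⟩ := exists_nat_ge (n / β)
  rw [div_le_iff₀ hβ] at hk
  refine ⟨1 + (2 ^ l) ^ k * k.factorial, by positivity, fun s hs => ?_⟩
  have hsβ : 0 ≤ s ^ β := Real.rpow_nonneg hs _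
  have h1 : 1 ≤ Real.exp (s ^ β / 2 ^ l) := Real.one_le_exp (by positivity)
  have h2 := Real.pow_div_factorial_le_exp (s ^ β / 2 ^ l) (by positivity) k
  rw [div_le_iff₀ (by positivity), div_pow, div_le_iff₀ (by positivity)] at h2
  have h0 : 0 ≤ Real.exp (s ^ β / 2 ^ l) := (Real.exp_pos _).le
  rcases le_total s 1 with h | h
  · refine (pow_le_one₀ hs h).trans (h1.trans ?_)
    have : (0 : ℝ) ≤ (2 ^ l) ^ k * k.factorial := by positivity
    nlinarith
  · have h3 : s ^ n ≤ (s ^ β) ^ k := by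
      rw [← Real.rpow_natCast, ← Real.rpow_natCast, ← Real.rpow_mul hs]
      exact Real.rpow_le_rpow_of_exponent_le h (by linarith)
    refine h3.trans (h2.trans ?_)
    nlinarith

/-- A dilation of the argument of a weight is absorbed by its type. -/
theorem exists_mul_rpow_div_le {β : ℝ} (c : ℝ) (hc : 0 ≤ c) (l : ℕ) :
    ∃ l' : ℕ, ∀ s : ℝ, 0 ≤ s → (c * s) ^ β / 2 ^ l' ≤ s ^ β / 2 ^ l := by
  obtain ⟨m, hm⟩ := pow_unbounded_of_one_lt (c ^ β) (one_lt_two (α := ℝ))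
  refine ⟨m + l, fun s hs => ?_⟩
  rw [Real.mul_rpow hc hs, pow_add, div_le_div_iff₀ (by positivity) (by positivity)]
  have : 0 ≤ s ^ β * 2 ^ l := by have := Real.rpow_nonneg hs β; positivity
  nlinarith

theorem factorial_mul_sum_le (n : ℕ) {s : ℝ} (hs : 0 ≤ s) :
    n.factorial * ∑ k ∈ Finset.range (n + 1), s ^ k / k.factorial ≤ (n + 1) * (n + s + 1) ^ n := by
  rw [Finset.mul_sum]
  refine (Finset.sum_le_card_nsmul _ _ ((n + s + 1) ^ n) fun k hk => ?_).trans_eq (by simp)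
  have hk' : k ≤ n := Nat.lt_succ_iff.1 (Finset.mem_range.1 hk)
  have h1 : (n.factorial : ℝ) ≤ (n : ℝ) ^ (n - k) * k.factorial := by
    have h := Nat.factorial_mul_descFactorial (n := n) (k := n - k) (by omega)
    have h' := Nat.descFactorial_le_pow n (n - k)
    rw [Nat.sub_sub_self hk'] at h
    have : n.factorial ≤ n ^ (n - k) * k.factorial := by
      rw [← h, mul_comm]
      exact Nat.mul_le_mul_right _ h'
    exact_mod_cast this
  have h2 : (n.factorial : ℝ) * (s ^ k / k.factorial) ≤ (n : ℝ) ^ (n - k) * s ^ k := by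
    rw [mul_div_assoc', div_le_iff₀ (by positivity)]
    nlinarith [pow_nonneg hs k]
  refine h2.trans ?_
  calc (n : ℝ) ^ (n - k) * s ^ k ≤ (n + s + 1) ^ (n - k) * (n + s + 1) ^ k := by
        have hn : (0 : ℝ) ≤ n := n.cast_nonneg
        gcongr <;> linarith
    _ = _ := by rw [← pow_add, Nat.sub_add_cancel hk']

/-- The radius `r` which makes Cauchy's estimate for the `n`-th coefficient strong enough to
compensate a factor `cⁿ n! ∑_{k ≤ n} sᵏ / k!`.  Here it matters that `β ≤ 1`. -/
theorem exists_radius {β : ℝ} (hβ : 0 < β) (hβ1 : β ≤ 1) (l : ℕ) {c : ℝ} (hc : 0 ≤ c) :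
    ∃ l' : ℕ, ∀ (n : ℕ) (s : ℝ), 0 ≤ s → ∃ r : ℝ, 0 < r ∧
      c ^ n * n.factorial * (∑ k ∈ Finset.range (n + 1), s ^ k / k.factorial) *
        (Real.exp (r ^ β / 2 ^ l') / r ^ n) ≤ 3 * (1 / 2) ^ n * Real.exp (s ^ β / 2 ^ l) := by
  set L : ℝ := 12 * c + 1 with hL
  have hL0 : 0 < L := by positivity
  obtain ⟨l', hl'⟩ := exists_mul_rpow_div_le (β := β) L hL0.le l
  refine ⟨l', fun n s hs => ?_⟩
  -- the radius is `L * t`, where `t ^ β` is at most `n + s ^ β + 1`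
  set t : ℝ := (n : ℝ) ^ (1 / β) + s + 1 with ht
  have hn0 : (0 : ℝ) ≤ (n : ℝ) ^ (1 / β) := Real.rpow_nonneg n.cast_nonneg _
  have hnn : (n : ℝ) ≤ (n : ℝ) ^ (1 / β) := by
    rcases Nat.eq_zero_or_pos n with rfl | hn
    · simpa using hn0
    · have h1 : (1 : ℝ) ≤ n := by exact_mod_cast hn
      calc (n : ℝ) = (n : ℝ) ^ (1 : ℝ) := (Real.rpow_one _).symm
        _ ≤ _ := Real.rpow_le_rpow_of_exponent_le h1 (by rw [le_div_iff₀ hβ]; linarith)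
  have ht0 : 0 < t := by positivity
  refine ⟨L * t, by positivity, ?_⟩
  have h1 := factorial_mul_sum_le n hs
  have h2 : ((n : ℝ) + s + 1) ^ n ≤ t ^ n := by
    refine pow_le_pow_left₀ (by positivity) ?_ n
    linarith
  have htβ : t ^ β ≤ n + s ^ β + 1 := by
    refine (Real.rpow_add_le_add_rpow (by positivity) zero_le_one hβ.le hβ1).trans ?_
    refine (add_le_add_left (Real.rpow_add_le_add_rpow hn0 hs hβ.le hβ1) _).trans_eq ?_
    rw [← Real.rpow_mul n.cast_nonneg, one_div_mul_cancel hβ.ne', Real.rpow_one, Real.one_rpow]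
  have h3 : Real.exp ((L * t) ^ β / 2 ^ l') ≤ 3 ^ (n + 1) * Real.exp (s ^ β / 2 ^ l) := by
    have h4 : (L * t) ^ β / 2 ^ l' ≤ (n + 1 : ℕ) * 1 + s ^ β / 2 ^ l := by
      refine (hl' t ht0.le).trans ((div_le_div_of_nonneg_right htβ (by positivity)).trans ?_)
      rw [show (n + s ^ β + 1 : ℝ) = (n + 1) + s ^ β by ring, add_div]
      refine add_le_add_left ?_ _
      push_cast
      rw [mul_one]
      exact div_le_self (by positivity) (one_le_pow₀ one_le_two)
    refine (Real.exp_le_exp.2 h4).trans ?_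
    rw [Real.exp_add, Real.exp_nat_mul]
    refine mul_le_mul_of_nonneg_right (pow_le_pow_left₀ (Real.exp_pos _).le ?_ _)
      (Real.exp_pos _).le
    exact Real.exp_one_lt_d9.le.trans (by norm_num)
  set X := Real.exp (s ^ β / 2 ^ l) with hX
  have hX0 : 0 < X := Real.exp_pos _
  have h5 : (n + 1 : ℝ) ≤ 2 ^ n := by exact_mod_cast Nat.lt_two_pow_self (n := n)
  rw [mul_div_assoc', div_le_iff₀ (by positivity), mul_assoc (c ^ n)]
  calc c ^ n * (n.factorial * ∑ k ∈ Finset.range (n + 1), s ^ k / k.factorial) *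
        Real.exp ((L * t) ^ β / 2 ^ l')
      ≤ c ^ n * (2 ^ n * t ^ n) * (3 ^ (n + 1) * X) := by
        have h6 := h1.trans (mul_le_mul h5 h2 (by positivity) (by positivity))
        exact mul_le_mul (mul_le_mul_of_nonneg_left h6 (by positivity)) h3 (Real.exp_pos _).le
          (by positivity)
    _ = 3 * (1 / 2) ^ n * X * ((12 * c) ^ n * t ^ n) := by
        rw [show (12 : ℝ) * c = 2 * 2 * 3 * c by ring, mul_pow (2 * 2 * 3), mul_pow (2 * 2),
          mul_pow 2 2, pow_succ, one_div, inv_pow]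
        field_simp
    _ ≤ 3 * (1 / 2) ^ n * X * (L * t) ^ n := by
        rw [mul_pow L]
        gcongr
        linarith

/-! ### The locally convex space of entire functions -/

theorem IsHolomorphicOn.differentiable_line {E : Type*} [AddCommGroup E] [Module ℂ E]
    [TopologicalSpace E] {f : E → ℂ} (hf : IsHolomorphicOn f Set.univ) (ξ η : E) :
    Differentiable ℂ fun z : ℂ => f (ξ + z • η) := by
  intro z₀
  obtain ⟨V, hV, hfV⟩ := hf.2 (ξ + z₀ • η) (Set.mem_univ _) η
  have h1 := hfV.differentiableAt hV
  have h2 : (fun z : ℂ => f (ξ + z • η)) =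
      (fun u : ℂ => f (ξ + z₀ • η + u • η)) ∘ fun z => z - z₀ := by
    funext z
    simp only [Function.comp_apply]
    congr 1
    module
  rw [h2]
  refine DifferentiableAt.comp z₀ ?_ (by fun_prop)
  simpa using h1

theorem isHolomorphicOn_univ {E : Type*} [AddCommGroup E] [Module ℂ E]
    [TopologicalSpace E] {f : E → ℂ} (hc : Continuous f)
    (hd : ∀ ξ η : E, Differentiable ℂ fun z : ℂ => f (ξ + z • η)) :
    IsHolomorphicOn f Set.univ :=
  ⟨hc.continuousOn, fun ξ _ η => ⟨Set.univ, Filter.univ_mem, (hd ξ η).differentiableOn⟩⟩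

theorem IsHolomorphicOn.continuous {E : Type*} [AddCommGroup E] [Module ℂ E]
    [TopologicalSpace E] {f : E → ℂ} (hf : IsHolomorphicOn f Set.univ) : Continuous f :=
  continuousOn_univ.1 hf.1

/-- A function which can be approximated by entire functions, uniformly on balls, is entire. -/
theorem isHolomorphicOn_of_approx {E : Type*} [NormedAddCommGroup E] [NormedSpace ℂ E]
    {f : E → ℂ} (h : ∀ R ε : ℝ, 0 < ε → ∃ g : E → ℂ, IsHolomorphicOn g Set.univ ∧
      ∀ w, ‖w‖ ≤ R → ‖f w - g w‖ ≤ ε) : IsHolomorphicOn f Set.univ := by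
  refine isHolomorphicOn_univ (continuous_iff_continuousAt.2 fun w => ?_) fun ξ η z₀ => ?_
  · refine continuousAt_of_locally_uniform_approx_of_continuousAt fun u hu => ?_
    obtain ⟨ε, hε, hεu⟩ := Metric.mem_uniformity_dist.1 hu
    obtain ⟨g, hg, hfg⟩ := h (‖w‖ + 1) (ε / 2) (by positivity)
    refine ⟨Metric.ball w 1, Metric.ball_mem_nhds w one_pos, g, hg.continuous.continuousAt,
      fun y hy => hεu ?_⟩
    rw [dist_eq_norm]
    refine (hfg y ?_).trans_lt (by linarith)
    have := norm_lt_of_mem_ball hy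
    linarith
  · choose g hg hfg using fun j : ℕ =>
      h (‖ξ‖ + (‖z₀‖ + 1) * ‖η‖) (1 / (j + 1 : ℝ)) (by positivity)
    have hu : TendstoUniformlyOn (fun (j : ℕ) z => g j (ξ + z • η)) (fun z : ℂ => f (ξ + z • η))
        Filter.atTop (Metric.ball 0 (‖z₀‖ + 1)) := by
      rw [Metric.tendstoUniformlyOn_iff]
      intro ε hε
      obtain ⟨N, hN⟩ := exists_nat_one_div_lt hε
      filter_upwards [Filter.eventually_ge_atTop N] with j hj z hz
      rw [dist_eq_norm]
      refine (hfg j _ ?_).trans_lt ((one_div_le_one_div_of_le (by positivity) ?_).trans_lt hN)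
      · refine (norm_add_le _ _).trans ?_
        rw [norm_smul]
        have := (mem_ball_zero_iff.1 hz).le
        gcongr
      · have : (N : ℝ) ≤ j := by exact_mod_cast hj
        linarith
    have := hu.tendstoLocallyUniformlyOn.differentiableOn
      (Filter.Eventually.of_forall fun j => ((hg j).differentiable_line ξ η).differentiableOn)
      Metric.isOpen_ball
    exact this.differentiableAt (Metric.isOpen_ball.mem_nhds (by simp))

namespace GelfandTriple

variable {T : Type u} (G : GelfandTriple.{u, v} T)

theorem orders_pos {α β : ℝ} (h : β ∈ orders α) : 0 < β := by
  rcases h with ⟨rfl, h⟩ | ⟨_, h⟩ <;> exact h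

theorem nonempty_orders {α : ℝ} (hα : 0 ≤ α) : Nonempty (orders α) := by
  rcases hα.eq_or_lt with h | h
  · exact ⟨⟨1, Or.inr ⟨h.symm, one_pos⟩⟩⟩
  · exact ⟨⟨α, Or.inl ⟨rfl, h⟩⟩⟩

theorem weightSeminorm_le_iff {β : ℝ} {τ : T} {l : ℕ} {w : G.Neg τ} {f : G.CoTest → ℂ} {C : ℝ} :
    G.weightSeminorm β τ l w f ≤ C ↔ ‖f (G.ofNeg τ w)‖ ≤ C * Real.exp (‖w‖ ^ β / 2 ^ l) := by
  change ‖f (G.ofNeg τ w)‖ * Real.exp (-(‖w‖ ^ β / 2 ^ l)) ≤ C ↔ _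
  rw [Real.exp_neg, ← div_eq_mul_inv, div_le_iff₀ (Real.exp_pos _)]

theorem mem_eminSubmodule_iff {α : ℝ} {f : G.CoTest → ℂ} : f ∈ G.eminSubmodule α ↔
    (∀ τ, IsHolomorphicOn (fun w : G.Neg τ => f (G.ofNeg τ w)) Set.univ) ∧
    ∀ β ∈ orders α, ∀ (τ : T) (l : ℕ), ∃ C : ℝ, ∀ w : G.Neg τ,
      ‖f (G.ofNeg τ w)‖ ≤ C * Real.exp (‖w‖ ^ β / 2 ^ l) := by
  refine and_congr_right fun _ => forall₄_congr fun β _ τ l => exists_congr fun C => ?_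
  rw [mem_upperBounds, Set.forall_mem_range]
  exact forall_congr' fun w => G.weightSeminorm_le_iff

theorem norm_le_eminSeminorm {α : ℝ} (f : G.Emin α) (i : orders α × T × ℕ) (w : G.Neg i.2.1) :
    ‖f (G.ofNeg i.2.1 w)‖ ≤ G.eminSeminorm α i f * Real.exp (‖w‖ ^ i.1.1 / 2 ^ i.2.2) :=
  G.weightSeminorm_le_iff.1 (le_ciSup (f.2.2 i.1 i.1.2 i.2.1 i.2.2) w)

theorem eminSeminorm_le {α : ℝ} (f : G.Emin α) (i : orders α × T × ℕ) {C : ℝ}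
    (h : ∀ w : G.Neg i.2.1, ‖f (G.ofNeg i.2.1 w)‖ ≤ C * Real.exp (‖w‖ ^ i.1.1 / 2 ^ i.2.2)) :
    G.eminSeminorm α i f ≤ C :=
  ciSup_le fun w => G.weightSeminorm_le_iff.2 (h w)

/-- The space `E^α_min` is closed under approximation in all its norms. -/
theorem mem_eminSubmodule_of_approx {α : ℝ} (hα : 0 ≤ α) {f : G.CoTest → ℂ}
    (h : ∀ (i : orders α × T × ℕ) (ε : ℝ), 0 < ε → ∃ g ∈ G.eminSubmodule α, ∀ w : G.Neg i.2.1,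
      ‖f (G.ofNeg i.2.1 w) - g (G.ofNeg i.2.1 w)‖ ≤ ε * Real.exp (‖w‖ ^ i.1.1 / 2 ^ i.2.2)) :
    f ∈ G.eminSubmodule α := by
  refine G.mem_eminSubmodule_iff.2 ⟨fun τ => isHolomorphicOn_of_approx fun R ε hε => ?_,
    fun β hβ τ l => ?_⟩
  · obtain ⟨β, hβ⟩ := nonempty_orders hα
    obtain ⟨g, hg, hfg⟩ := h (⟨β, hβ⟩, τ, 0) (ε / Real.exp (R ^ β / 2 ^ 0)) (by positivity)
    refine ⟨_, hg.1 τ, fun w hw => (hfg w).trans ?_⟩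
    rw [div_mul_eq_mul_div, div_le_iff₀ (Real.exp_pos _)]
    have := orders_pos hβ
    dsimp only
    gcongr
  · obtain ⟨g, hg, hfg⟩ := h (⟨β, hβ⟩, τ, l) 1 one_pos
    obtain ⟨C, hC⟩ := (G.mem_eminSubmodule_iff.1 hg).2 β hβ τ l
    refine ⟨1 + C, fun w => ?_⟩
    rw [add_mul]
    exact (norm_le_norm_sub_add _ _).trans (add_le_add (hfg w) (hC w))

/-- The topology of `E^α_min`, an infimum of topologies of seminorms, is the one generated by the
family. -/
theorem eminSeminorm_withSeminorms {α : ℝ} (hα : 0 ≤ α) :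
    haveI : Nonempty (orders α × T × ℕ) := ⟨(nonempty_orders hα).some, G.τ₀, 0⟩
    WithSeminorms (𝕜 := ℂ) (G.eminSeminorm α) := by
  have : Nonempty (orders α × T × ℕ) := ⟨(nonempty_orders hα).some, G.τ₀, 0⟩
  have : IsTopologicalAddGroup (G.Emin α) := topologicalAddGroup_iInf fun i =>
    letI := (G.eminSeminorm α i).toSeminormedAddCommGroup
    inferInstance
  exact (SeminormFamily.withSeminorms_iff_topologicalSpace_eq_iInf _).2 rfl

theorem emin_ext {α : ℝ} {f g : G.Emin α} (h : ∀ ω, f ω = g ω) : f = g :=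
  Subtype.ext (funext h)

theorem emin_sub_apply {α : ℝ} (f g : G.Emin α) (ω : G.CoTest) : (f - g) ω = f ω - g ω := rfl

theorem isTopologicalAddGroup_emin (α : ℝ) : IsTopologicalAddGroup (G.Emin α) :=
  topologicalAddGroup_iInf fun i =>
    letI := (G.eminSeminorm α i).toSeminormedAddCommGroup
    inferInstance

theorem norm_sub_le_eminSeminorm {α : ℝ} (f g : G.Emin α) (i : orders α × T × ℕ)
    (w : G.Neg i.2.1) : ‖f (G.ofNeg i.2.1 w) - g (G.ofNeg i.2.1 w)‖ ≤
      G.eminSeminorm α i (f - g) * Real.exp (‖w‖ ^ i.1.1 / 2 ^ i.2.2) :=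
  G.norm_le_eminSeminorm (f - g) i w

theorem exists_norm_eval_le {α : ℝ} (hα : 0 ≤ α) (ω : G.CoTest) :
    ∃ (i : orders α × T × ℕ) (C : ℝ), 0 < C ∧ ∀ f : G.Emin α, ‖f ω‖ ≤ C * G.eminSeminorm α i f := by
  obtain ⟨τ, w, rfl⟩ := G.exists_ofNeg ω
  obtain ⟨β⟩ := nonempty_orders hα
  refine ⟨(β, τ, 0), Real.exp (‖w‖ ^ β.1 / 2 ^ 0), Real.exp_pos _, fun f => ?_⟩
  rw [mul_comm]
  exact G.norm_le_eminSeminorm f (β, τ, 0) w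

theorem t2Space_emin {α : ℝ} (hα : 0 ≤ α) : T2Space (G.Emin α) := by
  have : Nonempty (orders α × T × ℕ) := ⟨(nonempty_orders hα).some, G.τ₀, 0⟩
  have := G.isTopologicalAddGroup_emin α
  have : T1Space (G.Emin α) := by
    refine (G.eminSeminorm_withSeminorms hα).T1_of_separating fun f hf => ?_
    by_contra! hall
    refine hf (G.emin_ext fun ω => ?_)
    obtain ⟨i, C, _, hC⟩ := G.exists_norm_eval_le hα ω
    have := hC f
    rw [hall i, mul_zero] at this
    exact norm_le_zero_iff.1 this
  infer_instance

/-- `E^α_min` is complete. -/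
theorem completeSpace_emin {α : ℝ} (hα : 0 ≤ α) :
    haveI := G.isTopologicalAddGroup_emin α
    @CompleteSpace (G.Emin α) (IsTopologicalAddGroup.rightUniformSpace (G.Emin α)) := by
  have : Nonempty (orders α × T × ℕ) := ⟨(nonempty_orders hα).some, G.τ₀, 0⟩
  have := G.isTopologicalAddGroup_emin α
  have hws := G.eminSeminorm_withSeminorms hα
  let := IsTopologicalAddGroup.rightUniformSpace (G.Emin α)
  have := isUniformAddGroup_of_addCommGroup (G := G.Emin α)
  refine ⟨fun {F} hF => ?_⟩
  have hNB := hF.1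
  have hsmall : ∀ (i : orders α × T × ℕ) (ε : ℝ), 0 < ε →
      ∃ S ∈ F, ∀ f ∈ S, ∀ g ∈ S, G.eminSeminorm α i (g - f) < ε := by
    intro i ε hε
    have h1 : ∀ᶠ f in 𝓝 (0 : G.Emin α), G.eminSeminorm α i f < ε := by
      have h2 := (hws.continuous_seminorm i).tendsto 0
      rw [map_zero] at h2
      exact h2.eventually (gt_mem_nhds hε)
    obtain ⟨S, hS, hSS⟩ := (cauchy_iff.1 hF).2 _
      (uniformity_eq_comap_nhds_zero (G.Emin α) ▸ Filter.preimage_mem_comap h1)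
    exact ⟨S, hS, fun f hf g hg => @hSS (f, g) ⟨hf, hg⟩⟩
  have hlim : ∀ ω : G.CoTest, ∃ c, Filter.Tendsto (fun f : G.Emin α => f ω) F (𝓝 c) := by
    intro ω
    obtain ⟨i, C, hC0, hC⟩ := G.exists_norm_eval_le hα ω
    refine CompleteSpace.complete (Metric.cauchy_iff.2 ⟨inferInstance, fun ε hε => ?_⟩)
    obtain ⟨S, hS, hSS⟩ := hsmall i (ε / C) (by positivity)
    refine ⟨_, Filter.image_mem_map hS, ?_⟩
    rintro _ ⟨f, hf, rfl⟩ _ ⟨g, hg, rfl⟩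
    rw [dist_eq_norm, ← emin_sub_apply]
    refine (hC _).trans_lt ?_
    have := hSS g hg f hf
    rwa [lt_div_iff₀ hC0, mul_comm] at this
  choose f hf using hlim
  have happ : ∀ (i : orders α × T × ℕ) (ε : ℝ), 0 < ε → ∃ S ∈ F, ∀ g ∈ S, ∀ w : G.Neg i.2.1,
      ‖f (G.ofNeg i.2.1 w) - g (G.ofNeg i.2.1 w)‖ ≤ ε * Real.exp (‖w‖ ^ i.1.1 / 2 ^ i.2.2) := by
    intro i ε hε
    obtain ⟨S, hS, hSS⟩ := hsmall i ε hε
    refine ⟨S, hS, fun g hg w => ?_⟩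
    refine le_of_tendsto ((hf (G.ofNeg i.2.1 w)).sub_const _).norm ?_
    filter_upwards [hS] with g' hg'
    exact (G.norm_sub_le_eminSeminorm g' g i w).trans
      (mul_le_mul_of_nonneg_right (hSS g hg g' hg').le (Real.exp_pos _).le)
  have hfE : f ∈ G.eminSubmodule α := G.mem_eminSubmodule_of_approx hα fun i ε hε => by
    obtain ⟨S, hS, hSS⟩ := happ i ε hε
    obtain ⟨g, hg⟩ := Filter.nonempty_of_mem hS
    exact ⟨g.1, g.2, hSS g hg⟩
  obtain ⟨f', hf'⟩ : ∃ f' : G.Emin α, ∀ ω, f' ω = f ω := ⟨⟨f, hfE⟩, fun _ => rfl⟩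
  refine ⟨f', (hws.tendsto_nhds id _).2 fun i ε hε => ?_⟩
  obtain ⟨S, hS, hSS⟩ := happ i (ε / 2) (by positivity)
  filter_upwards [hS] with g hg
  refine lt_of_le_of_lt (G.eminSeminorm_le _ i fun w => ?_) (half_lt_self hε)
  rw [id, emin_sub_apply, norm_sub_rev, hf']
  exact hSS g hg w

/-- Extension by continuity from a dense subspace of `E^α_min`, which is given as the range of a
linear map. -/
theorem exists_extension {α : ℝ} (hα : 0 ≤ α) {W : Type*} [AddCommGroup W] [Module ℂ W]
    (E L : W →ₗ[ℂ] G.Emin α) (hE : DenseRange E)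
    (hL : ∀ i, ∃ i' C, 0 ≤ C ∧ ∀ w, G.eminSeminorm α i (L w) ≤ C * G.eminSeminorm α i' (E w)) :
    ∃ Λ : G.Emin α →L[ℂ] G.Emin α, ∀ w, Λ (E w) = L w := by
  have : Nonempty (orders α × T × ℕ) := ⟨(nonempty_orders hα).some, G.τ₀, 0⟩
  have := G.isTopologicalAddGroup_emin α
  have hws := G.eminSeminorm_withSeminorms hα
  let := IsTopologicalAddGroup.rightUniformSpace (G.Emin α)
  have := isUniformAddGroup_of_addCommGroup (G := G.Emin α)
  have := G.completeSpace_emin hα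
  have := G.t2Space_emin hα
  have := hws.continuousSMul
  let : UniformSpace W := UniformSpace.comap E inferInstance
  have hind : IsUniformInducing E := ⟨rfl⟩
  have : IsUniformAddGroup W := hind.isUniformAddGroup E
  let E' : W →L[ℂ] G.Emin α := ⟨E, hind.uniformContinuous.continuous⟩
  have hcont : Continuous L := by
    refine WithSeminorms.continuous_of_continuous_comp hws L fun i => ?_
    obtain ⟨i', C, hC0, hC⟩ := hL i
    let c : NNReal := ⟨C, hC0⟩
    refine Seminorm.continuous_of_le (q := c • (G.eminSeminorm α i').comp E) ?_
      fun w => hC w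
    exact continuous_const.mul ((hws.continuous_seminorm i').comp E'.continuous)
  let L' : W →L[ℂ] G.Emin α := ⟨L, hcont⟩
  exact ⟨L'.extend E', fun w => L'.extend_eq (e := E') hE hind w⟩

end GelfandTriple

/-! ### Operators on the polynomials of finite rank -/

namespace GelfandTriple

variable {T : Type u} (G : GelfandTriple.{u, v} T)

/-- On each `H₋τ`, the polynomial `ω ↦ ⟨ω^⊗ n, φ⟩` comes from a continuous multilinear map. -/
theorem exists_continuousMultilinearMap {n : ℕ} (φ : G.SymPow n) (τ : T) :
    ∃ g : ContinuousMultilinearMap ℂ (fun _ : Fin n => G.Neg τ) ℂ,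
      ∀ w, g w = φ.1 fun i => G.ofNeg τ (w i) := by
  refine ⟨(φ.1.compLinearMap fun _ => G.ofNeg τ).mkContinuous (6 ^ n * G.powSeminorm n τ φ)
    fun w => ?_, fun w => rfl⟩
  refine φ.norm_apply_le τ (apply_nonneg _ _) (fun w hw => ?_) w
  refine (G.norm_eval_le τ w φ).trans ?_
  exact mul_le_of_le_one_left (apply_nonneg _ _) (pow_le_one₀ (norm_nonneg _) hw)

theorem coPow_mem_eminSubmodule (α : ℝ) {n : ℕ} (φ : G.SymPow n) :
    (fun ω => G.coPow ω n φ) ∈ G.eminSubmodule α := by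
  refine G.mem_eminSubmodule_iff.2 ⟨fun τ => ?_, fun β hβ τ l => ?_⟩
  · obtain ⟨g, hg⟩ := G.exists_continuousMultilinearMap φ τ
    have h : (fun w : G.Neg τ => G.coPow (G.ofNeg τ w) n φ) = fun w => g fun _ => w :=
      funext fun w => (hg _).symm
    rw [h]
    have hd : Differentiable ℂ fun w => g fun _ => w :=
      g.contDiff.differentiable (n := 1) one_ne_zero |>.comp (by fun_prop)
    exact isHolomorphicOn_univ hd.continuous fun ξ η => hd.comp (by fun_prop)
  · obtain ⟨K, hK0, hK⟩ := exists_pow_le_exp_rpow (orders_pos hβ) l n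
    refine ⟨K * G.powSeminorm n τ φ, fun w => (G.norm_eval_le τ w φ).trans ?_⟩
    have := hK ‖w‖ (norm_nonneg w)
    have h0 : 0 ≤ G.powSeminorm n τ φ := apply_nonneg _ _
    calc _ ≤ K * Real.exp (‖w‖ ^ β / 2 ^ l) * G.powSeminorm n τ φ := by gcongr
      _ = _ := by ring

/-- The map `φ ↦ ⟨ω^⊗ n, φ⟩` from `Φ^⊙ n` to `E^α_min`. -/
def monomialMap (α : ℝ) (n : ℕ) : G.SymPow n →ₗ[ℂ] G.Emin α where
  toFun φ := ⟨fun ω => G.coPow ω n φ, G.coPow_mem_eminSubmodule α φ⟩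
  map_add' φ ψ := G.emin_ext fun ω => map_add (G.coPow ω n) φ ψ
  map_smul' c φ := G.emin_ext fun ω => map_smul (G.coPow ω n) c φ

theorem monomialMap_apply {α : ℝ} {n : ℕ} (φ : G.SymPow n) (ω : G.CoTest) :
    G.monomialMap α n φ ω = G.coPow ω n φ := rfl

theorem continuous_monomialMap {α : ℝ} (hα : 0 ≤ α) (n : ℕ) :
    Continuous (G.monomialMap α n) := by
  have : Nonempty (orders α × T × ℕ) := ⟨(nonempty_orders hα).some, G.τ₀, 0⟩
  have : Nonempty T := ⟨G.τ₀⟩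
  refine WithSeminorms.continuous_of_continuous_comp (G.eminSeminorm_withSeminorms hα) _ fun i => ?_
  obtain ⟨K, hK0, hK⟩ := exists_pow_le_exp_rpow (orders_pos i.1.2) i.2.2 n
  let c : NNReal := ⟨K, hK0⟩
  refine Seminorm.continuous_of_le (q := c • G.powSeminorm n i.2.1)
    (continuous_const.mul ((G.powSeminorm_withSeminorms n).continuous_seminorm _)) fun φ => ?_
  refine G.eminSeminorm_le _ i fun w => (G.norm_eval_le i.2.1 w φ).trans ?_
  have := hK ‖w‖ (norm_nonneg w)
  have h0 : 0 ≤ G.powSeminorm n i.2.1 φ := apply_nonneg _ _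
  calc _ ≤ K * Real.exp (‖w‖ ^ i.1.1 / 2 ^ i.2.2) * G.powSeminorm n i.2.1 φ := by gcongr
    _ = (K * G.powSeminorm n i.2.1 φ) * Real.exp (‖w‖ ^ i.1.1 / 2 ^ i.2.2) := by ring

/-- Evaluation at `ω`. -/
def evalAt (α : ℝ) (ω : G.CoTest) : G.Emin α →ₗ[ℂ] ℂ where
  toFun f := f ω
  map_add' _ _ := rfl
  map_smul' _ _ := rfl

theorem evalAt_apply {α : ℝ} (ω : G.CoTest) (f : G.Emin α) : G.evalAt α ω f = f ω := rfl

theorem continuous_evalAt {α : ℝ} (hα : 0 ≤ α) (ω : G.CoTest) : Continuous (G.evalAt α ω) := by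
  have : Nonempty (orders α × T × ℕ) := ⟨(nonempty_orders hα).some, G.τ₀, 0⟩
  obtain ⟨i, C, hC0, hC⟩ := G.exists_norm_eval_le hα ω
  refine WithSeminorms.continuous_normedSpace_rng (𝕝 := ℂ) ℂ (G.eminSeminorm_withSeminorms hα) _
    ⟨{i}, ⟨C, hC0.le⟩, fun f => ?_⟩
  rw [Finset.sup_singleton]
  exact hC f

/-- The finite sequences of tensors of finite rank, which represent the polynomials of finite
rank. -/
abbrev FinSeq : Type (max u v) := Π₀ n, G.finRank n

/-- The sequence with the only entry `φ`, at the place `n`. -/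
abbrev single (n : ℕ) : G.finRank n →ₗ[ℂ] G.FinSeq :=
  DFinsupp.lsingle (R := ℂ) (M := fun n => G.finRank n) n

/-- The polynomial of finite rank with the given coefficients. -/
def finPoly (α : ℝ) : G.FinSeq →ₗ[ℂ] G.Emin α :=
  DFinsupp.lsum ℂ fun n => (G.monomialMap α n).comp (G.finRank n).subtype

theorem finPoly_single {α : ℝ} (n : ℕ) (φ : G.finRank n) :
    G.finPoly α (G.single n φ) = G.monomialMap α n φ :=
  DFinsupp.lsum_single _ _ _ _

open Classical in
theorem map_finSeq_apply {X : Type*} [AddCommGroup X] [Module ℂ X] (L : G.FinSeq →ₗ[ℂ] X)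
    (w : G.FinSeq) : L w = ∑ n ∈ w.support, L (G.single n (w n)) := by
  conv_lhs => rw [← DFinsupp.sum_single (f := w), DFinsupp.sum, map_sum]
  rfl

open Classical in
theorem finPoly_apply {α : ℝ} (w : G.FinSeq) (ω : G.CoTest) :
    G.finPoly α w ω = ∑ n ∈ w.support, G.coPow ω n (w n : G.SymPow n) := by
  rw [← evalAt_apply, G.map_finSeq_apply (G.finPoly α), map_sum]
  simp only [finPoly_single, evalAt_apply, monomialMap_apply]

/-- Cauchy's estimate for the homogeneous components of a polynomial. -/
theorem norm_coPow_le_eminSeminorm {α : ℝ} (w : G.FinSeq) (i : orders α × T × ℕ) (n : ℕ)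
    {r : ℝ} (hr : 0 < r) {v : G.Neg i.2.1} (hv : ‖v‖ ≤ 1) :
    ‖G.coPow (G.ofNeg i.2.1 v) n (w n : G.SymPow n)‖ ≤
      G.eminSeminorm α i (G.finPoly α w) * (Real.exp (r ^ i.1.1 / 2 ^ i.2.2) / r ^ n) := by
  classical
  rw [← mul_div_assoc, le_div_iff₀ (by positivity)]
  refine Complex.norm_coeff_mul_pow_le
    (a := fun n => G.coPow (G.ofNeg i.2.1 v) n (w n : G.SymPow n))
    (g := fun z => G.finPoly α w (G.ofNeg i.2.1 (z • v))) hr (fun z _ => ?_) (fun z hz => ?_) n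
  · have h1 : ∀ k, G.coPow (G.ofNeg i.2.1 v) k (w k : G.SymPow k) * z ^ k =
        G.coPow (G.ofNeg i.2.1 (z • v)) k (w k : G.SymPow k) := fun k => by
      rw [map_smul, coPow_smul, mul_comm]
    simp only [h1, finPoly_apply]
    refine hasSum_sum_of_ne_finset_zero fun k hk => ?_
    rw [DFinsupp.notMem_support_iff.1 hk, Submodule.coe_zero, map_zero]
  · refine (G.norm_le_eminSeminorm _ i _).trans (mul_le_mul_of_nonneg_left ?_ (apply_nonneg _ _))
    have h2 : ‖z • v‖ ≤ r := by
      rw [norm_smul]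
      nlinarith [norm_nonneg z, norm_nonneg v]
    have := orders_pos i.1.2
    gcongr

/-- Orders above one, which occur only for `α = 0`, can be lowered to one. -/
theorem min_one_mem_orders {α β : ℝ} (hα : α ∈ Set.Icc (0 : ℝ) 1) (hβ : β ∈ orders α) :
    min β 1 ∈ orders α := by
  rcases hβ with ⟨rfl, h⟩ | ⟨h, h'⟩
  · rw [min_eq_left hα.2]
    exact Or.inl ⟨rfl, h⟩
  · exact Or.inr ⟨h, lt_min h' one_pos⟩

/-- Weights of smaller order are dominated by those of larger order. -/
theorem exp_rpow_le {s γ β : ℝ} (hs : 0 ≤ s) (hγ : 0 < γ) (hγβ : γ ≤ β) (l : ℕ) :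
    Real.exp (s ^ γ / 2 ^ l) ≤ 3 * Real.exp (s ^ β / 2 ^ l) := by
  have h1 : s ^ γ ≤ 1 + s ^ β := by
    have h0 := Real.rpow_nonneg hs β
    rcases le_total s 1 with h | h
    · have := Real.rpow_le_one hs h hγ.le
      linarith
    · have := Real.rpow_le_rpow_of_exponent_le h hγβ
      linarith
  calc Real.exp (s ^ γ / 2 ^ l) ≤ Real.exp (1 + s ^ β / 2 ^ l) := by
        refine Real.exp_le_exp.2 ((div_le_div_of_nonneg_right h1 (by positivity)).trans ?_)
        rw [add_div]
        exact add_le_add_left (div_le_self one_pos.le (one_le_pow₀ one_le_two)) _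
    _ ≤ _ := by
        rw [Real.exp_add]
        have := Real.exp_one_lt_d9
        exact mul_le_mul_of_nonneg_right (by linarith) (Real.exp_pos _).le

/-- A linear map on the polynomials of finite rank is continuous for the topology of `E^α_min` if
its values on the powers `ω ↦ ⟨ω, ξ⟩ⁿ` grow like those of a Sheffer operator. -/
theorem exists_eminSeminorm_le {α : ℝ} (hα : α ∈ Set.Icc (0 : ℝ) 1)
    (L : G.FinSeq →ₗ[ℂ] G.Emin α)
    (hL : ∀ τ, ∃ (σ : T) (C : ℝ), 0 ≤ C ∧ ∀ (n : ℕ) (ξ : G.Test) (x : G.Neg τ),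
      ‖L (G.single n ⟨G.tpow ξ n, G.tpow_mem_finRank ξ n⟩) (G.ofNeg τ x)‖ ≤
        n.factorial * ((C * ‖G.toH σ ξ‖) ^ n *
          ∑ k ∈ Finset.range (n + 1), ‖x‖ ^ k / k.factorial))
    (i : orders α × T × ℕ) :
    ∃ i' C, 0 ≤ C ∧ ∀ w, G.eminSeminorm α i (L w) ≤ C * G.eminSeminorm α i' (G.finPoly α w) := by
  classical
  obtain ⟨⟨β, hβ⟩, τ, l⟩ := i
  have hβ0 := orders_pos hβ
  obtain ⟨σ, C, hC0, hC⟩ := hL τ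
  obtain ⟨σ', K, hK0, hK⟩ := G.exists_norm_finRank_le σ
  obtain ⟨l', hl'⟩ := exists_radius (lt_min hβ0 one_pos) (min_le_right β 1) l
    (mul_nonneg hK0 hC0)
  let i' : orders α × T × ℕ := (⟨min β 1, min_one_mem_orders hα hβ⟩, σ', l')
  refine ⟨i', 18, by norm_num, fun w => ?_⟩
  set P := G.eminSeminorm α i' (G.finPoly α w) with hP
  have hP0 : 0 ≤ P := apply_nonneg _ _
  refine G.eminSeminorm_le _ _ fun x => ?_
  set X := Real.exp (‖x‖ ^ min β 1 / 2 ^ l) with hX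
  have hX0 : 0 < X := Real.exp_pos _
  -- the kernel estimate, with Cauchy's estimate on a ball whose radius depends on `n` and `‖x‖`
  have hterm : ∀ n, ‖L (G.single n (w n)) (G.ofNeg τ x)‖ ≤ P * 3 * X * (1 / 2) ^ n := by
    intro n
    obtain ⟨r, hr, hle⟩ := hl' n ‖x‖ (norm_nonneg x)
    set Q := ∑ k ∈ Finset.range (n + 1), ‖x‖ ^ k / k.factorial with hQ
    have hQ0 : 0 ≤ Q := Finset.sum_nonneg fun k _ => by positivity
    have h1 := hK n ((G.evalAt α (G.ofNeg τ x)).comp (L.comp (G.single n)))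
      (n.factorial * C ^ n * Q) (by positivity)
      (fun ξ => (hC n ξ x).trans_eq (by rw [mul_pow]; ring)) (w n) _ (by positivity)
      (fun v hv => G.norm_coPow_le_eminSeminorm w i' n hr hv)
    refine h1.trans ?_
    calc K ^ n * (n.factorial * C ^ n * Q) * (P * (Real.exp (r ^ min β 1 / 2 ^ l') / r ^ n))
        = P * ((K * C) ^ n * n.factorial * Q * (Real.exp (r ^ min β 1 / 2 ^ l') / r ^ n)) := by
          rw [mul_pow]; ring
      _ ≤ P * (3 * (1 / 2) ^ n * X) := mul_le_mul_of_nonneg_left hle hP0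
      _ = _ := by ring
  rw [← evalAt_apply, G.map_finSeq_apply L, map_sum]
  refine (norm_sum_le_of_le _ fun n _ => hterm n).trans ?_
  rw [← Finset.mul_sum]
  have h2 : ∑ n ∈ w.support, ((1 : ℝ) / 2) ^ n ≤ 2 := by
    exact (summable_geometric_two.sum_le_tsum _ fun _ _ => by positivity).trans_eq
      tsum_geometric_two
  have h3 := exp_rpow_le (norm_nonneg x) (lt_min hβ0 one_pos) (min_le_left β 1) l
  calc _ ≤ P * 3 * X * 2 := by gcongr
    _ ≤ P * 3 * (3 * Real.exp (‖x‖ ^ β / 2 ^ l)) * 2 := by gcongr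
    _ = _ := by ring

end GelfandTriple

/-! ### Directed families of seminorms -/

/-- A criterion for density with respect to a directed family of seminorms. -/
theorem WithSeminorms.dense_of_directed {E ι : Type*} [AddCommGroup E] [Module ℂ E]
    [TopologicalSpace E] [Nonempty ι] {p : SeminormFamily ℂ E ι} (hp : WithSeminorms p)
    (hdir : ∀ i j, ∃ k C, 0 ≤ C ∧ ∀ x, p i x ≤ C * p k x ∧ p j x ≤ C * p k x) {S : Set E}
    (hS : ∀ x i (ε : ℝ), 0 < ε → ∃ y ∈ S, p i (y - x) < ε) : Dense S := by
  classical
  have hfin : ∀ s : Finset ι, ∃ k C, 0 ≤ C ∧ ∀ i ∈ s, ∀ x, p i x ≤ C * p k x := by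
    intro s
    induction s using Finset.induction_on with
    | empty => exact ⟨Classical.arbitrary ι, 0, le_rfl, by simp⟩
    | insert a s _ ih =>
      obtain ⟨k, C, hC0, hC⟩ := ih
      obtain ⟨k', C', hC'0, hC'⟩ := hdir a k
      refine ⟨k', max C' (C * C'), le_max_of_le_left hC'0, fun i hi x => ?_⟩
      have h0 : 0 ≤ p k' x := apply_nonneg _ _
      rcases Finset.mem_insert.1 hi with rfl | hi
      · exact (hC' x).1.trans (mul_le_mul_of_nonneg_right (le_max_left _ _) h0)
      · refine (hC i hi x).trans ((mul_le_mul_of_nonneg_left (hC' x).2 hC0).trans ?_)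
        rw [← mul_assoc]
        exact mul_le_mul_of_nonneg_right (le_max_right _ _) h0
  intro x
  rw [mem_closure_iff_nhds]
  intro U hU
  obtain ⟨s, r, hr, hsub⟩ := (hp.mem_nhds_iff x U).1 hU
  obtain ⟨k, C, hC0, hC⟩ := hfin s
  obtain ⟨y, hyS, hy⟩ := hS x k (r / (C + 1)) (by positivity)
  refine ⟨y, hsub ?_, hyS⟩
  rw [Seminorm.mem_ball]
  refine Seminorm.finset_sup_apply_lt hr fun i hi => (hC i hi _).trans_lt ?_
  rw [lt_div_iff₀ (by positivity)] at hy
  have h0 : 0 ≤ p k (y - x) := apply_nonneg _ _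
  nlinarith

namespace GelfandTriple

variable {T : Type u} (G : GelfandTriple.{u, v} T)

theorem min_mem_orders {α β γ : ℝ} (hβ : β ∈ orders α) (hγ : γ ∈ orders α) :
    min β γ ∈ orders α := by
  rcases min_choice β γ with h | h <;> rw [h] <;> assumption

theorem directed_eminSeminorm {α : ℝ} (i₁ i₂ : orders α × T × ℕ) :
    ∃ i C, 0 ≤ C ∧ ∀ f, G.eminSeminorm α i₁ f ≤ C * G.eminSeminorm α i f ∧
      G.eminSeminorm α i₂ f ≤ C * G.eminSeminorm α i f := by
  obtain ⟨⟨β₁, hβ₁⟩, τ₁, l₁⟩ := i₁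
  obtain ⟨⟨β₂, hβ₂⟩, τ₂, l₂⟩ := i₂
  obtain ⟨τ, j₁, j₂, hj₁, hj₂⟩ := G.directed τ₁ τ₂
  have hγ := min_mem_orders hβ₁ hβ₂
  have hγ0 := orders_pos hγ
  obtain ⟨l, hl⟩ := exists_mul_rpow_div_le (β := min β₁ β₂) (max ‖j₁‖ ‖j₂‖) (by positivity)
    (max l₁ l₂)
  refine ⟨(⟨min β₁ β₂, hγ⟩, τ, l), 3, by norm_num, fun f => ?_⟩
  -- one of the two estimates, for a space `H₋ς`, a weight of order `β` and a number `k`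
  have key : ∀ (β : ℝ) (ς : T) (k : ℕ) (j : G.H τ →L[ℂ] G.H ς), min β₁ β₂ ≤ β →
      k ≤ max l₁ l₂ → ‖j‖ ≤ max ‖j₁‖ ‖j₂‖ → (∀ x, G.emb ς (j x) = G.emb τ x) →
      ∀ w : G.Neg ς, ‖f (G.ofNeg ς w)‖ ≤ 3 * G.eminSeminorm α (⟨min β₁ β₂, hγ⟩, τ, l) f *
        Real.exp (‖w‖ ^ β / 2 ^ k) := by
    intro β ς k j hβ hk hj hj' w
    rw [← G.ofNeg_comp hj']
    refine (G.norm_le_eminSeminorm f (⟨min β₁ β₂, hγ⟩, τ, l) _).trans ?_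
    have h0 : 0 ≤ G.eminSeminorm α (⟨min β₁ β₂, hγ⟩, τ, l) f := apply_nonneg _ _
    rw [mul_comm 3, mul_assoc]
    refine mul_le_mul_of_nonneg_left ?_ h0
    refine le_trans ?_ (exp_rpow_le (norm_nonneg w) hγ0 hβ k)
    refine Real.exp_le_exp.2 ?_
    have h1 : ‖w.comp j‖ ≤ max ‖j₁‖ ‖j₂‖ * ‖w‖ := by
      refine (w.opNorm_comp_le j).trans ?_
      rw [mul_comm]
      gcongr
    refine (div_le_div_of_nonneg_right (Real.rpow_le_rpow (norm_nonneg _) h1 hγ0.le)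
      (by positivity)).trans ((hl _ (norm_nonneg w)).trans ?_)
    have := Real.rpow_nonneg (norm_nonneg w) (min β₁ β₂)
    gcongr
    norm_num
  exact ⟨G.eminSeminorm_le _ _ (key β₁ τ₁ l₁ j₁ (min_le_left _ _) (le_max_left _ _)
      (le_max_left _ _) hj₁), G.eminSeminorm_le _ _ (key β₂ τ₂ l₂ j₂ (min_le_right _ _)
      (le_max_right _ _) (le_max_right _ _) hj₂)⟩

/-! ### Homogeneous components of entire functions -/

theorem differentiable_ray {α : ℝ} (f : G.Emin α) (ω : G.CoTest) :
    Differentiable ℂ fun z : ℂ => f (z • ω) := by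
  obtain ⟨τ, w, rfl⟩ := G.exists_ofNeg ω
  have := (f.2.1 τ).differentiable_line 0 w
  simpa only [zero_add, map_smul] using! this

/-- The dilation `ω ↦ f(cω)`. -/
theorem dilation_mem {α : ℝ} (c : ℂ) {f : G.CoTest → ℂ} (hf : f ∈ G.eminSubmodule α) :
    (fun ω => f (c • ω)) ∈ G.eminSubmodule α := by
  refine G.mem_eminSubmodule_iff.2 ⟨fun τ => ?_, fun β hβ τ l => ?_⟩
  · have h1 : (fun w : G.Neg τ => f (c • G.ofNeg τ w)) =
        (fun w : G.Neg τ => f (G.ofNeg τ w)) ∘ fun w => c • w := by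
      funext w
      simp
    rw [h1]
    refine isHolomorphicOn_univ ((hf.1 τ).continuous.comp (by fun_prop)) fun ξ η => ?_
    have := (hf.1 τ).differentiable_line (c • ξ) (c • η)
    convert! this using 1
    funext z
    simp only [Function.comp_apply, smul_add, smul_comm c z]
  · obtain ⟨l', hl'⟩ := exists_mul_rpow_div_le (β := β) ‖c‖ (norm_nonneg c) l
    obtain ⟨C, hC⟩ := (G.mem_eminSubmodule_iff.1 hf).2 β hβ τ l'
    refine ⟨|C|, fun w => ?_⟩
    have := hC (c • w)
    rw [map_smul] at this
    refine this.trans ((mul_le_mul_of_nonneg_right (le_abs_self C) (Real.exp_pos _).le).trans ?_)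
    rw [norm_smul]
    exact mul_le_mul_of_nonneg_left (Real.exp_le_exp.2 (hl' _ (norm_nonneg w))) (abs_nonneg C)

/-- The homogeneous component of degree `n` of a function which is entire on all lines. -/
def homComponent (f : G.CoTest → ℂ) (n : ℕ) (ω : G.CoTest) : ℂ :=
  (n.factorial : ℂ)⁻¹ * iteratedDeriv n (fun z : ℂ => f (z • ω)) 0

theorem hasSum_homComponent {α : ℝ} (f : G.Emin α) (ω : G.CoTest) (z : ℂ) :
    HasSum (fun n => G.homComponent f n ω * z ^ n) (f (z • ω)) := by
  have := Complex.hasSum_taylorSeries_of_entire (G.differentiable_ray f ω) 0 z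
  convert! this using 2 with n
  simp only [homComponent, sub_zero, smul_eq_mul]
  ring

theorem homComponent_smul {α : ℝ} (f : G.Emin α) (n : ℕ) (c : ℂ) (ω : G.CoTest) :
    G.homComponent f n (c • ω) = c ^ n * G.homComponent f n ω := by
  have h1 : (fun z : ℂ => f (z • c • ω)) = fun z : ℂ => (fun u : ℂ => f (u • ω)) (c * z) := by
    funext z
    simp only [smul_smul, mul_comm]
  rw [homComponent, h1, iteratedDeriv_comp_const_mul (G.differentiable_ray f ω).contDiff]
  simp only [mul_zero, homComponent]
  ring

/-- Cauchy's estimate: the norms of the homogeneous components decay geometrically. -/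
theorem exists_norm_homComponent_le {α : ℝ} (i : orders α × T × ℕ) : ∃ i' : orders α × T × ℕ,
    ∀ (f : G.Emin α) (n : ℕ) (w : G.Neg i.2.1), ‖G.homComponent f n (G.ofNeg i.2.1 w)‖ ≤
      (1 / 4) ^ n * (G.eminSeminorm α i' f * Real.exp (‖w‖ ^ i.1.1 / 2 ^ i.2.2)) := by
  obtain ⟨⟨β, hβ⟩, τ, l⟩ := i
  obtain ⟨l', hl'⟩ := exists_mul_rpow_div_le (β := β) 4 (by norm_num) l
  refine ⟨(⟨β, hβ⟩, τ, l'), fun f n w => ?_⟩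
  rw [one_div, inv_pow, ← div_eq_inv_mul, le_div_iff₀ (by positivity)]
  refine Complex.norm_coeff_mul_pow_le (by norm_num)
    (fun z _ => G.hasSum_homComponent f (G.ofNeg τ w) z) (fun z hz => ?_) n
  rw [← map_smul]
  refine (G.norm_le_eminSeminorm f (⟨β, hβ⟩, τ, l') (z • w)).trans
    (mul_le_mul_of_nonneg_left (Real.exp_le_exp.2 (le_trans ?_ (hl' _ (norm_nonneg w))))
      (apply_nonneg _ _))
  have := orders_pos hβ
  rw [norm_smul]
  dsimp only
  gcongr

theorem hasSum_quarter_shift (N : ℕ) (P : ℝ) :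
    HasSum (fun k : ℕ => (1 / 4 : ℝ) ^ (k + N) * P) ((1 / 4) ^ N * P * (4 / 3)) := by
  have h := (hasSum_geometric_of_lt_one (r := (1 / 4 : ℝ)) (by norm_num) (by norm_num)).mul_left
    ((1 / 4) ^ N * P)
  convert! h using 1
  · funext k
    rw [pow_add]
    ring
  · norm_num

/-- The homogeneous components of a function in `E^α_min` are again in `E^α_min`. -/
theorem homComponent_mem {α : ℝ} (hα : 0 ≤ α) (f : G.Emin α) (n : ℕ) :
    G.homComponent f n ∈ G.eminSubmodule α := by
  induction n using Nat.strong_induction_on with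
  | _ n ih =>
    refine G.mem_eminSubmodule_of_approx hα fun i ε hε => ?_
    obtain ⟨i', hi'⟩ := G.exists_norm_homComponent_le i
    set P := G.eminSeminorm α i' f with hP
    have hP0 : 0 ≤ P := apply_nonneg _ _
    set t : ℝ := min 1 (ε / (4 * (P + 1))) with ht
    have ht0 : 0 < t := by positivity
    -- for `z → 0` the functions `z⁻ⁿ (f(zω) - ∑_{k < n} zᵏ fₖ(ω))` converge to `fₙ(ω)`
    refine ⟨((t : ℂ) ^ n)⁻¹ • ((fun ω => f ((t : ℂ) • ω)) -
      ∑ k ∈ Finset.range n, (t : ℂ) ^ k • G.homComponent f k), ?_, fun w => ?_⟩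
    · exact Submodule.smul_mem _ _ (Submodule.sub_mem _ (G.dilation_mem _ f.2)
        (Submodule.sum_mem _ fun k hk => Submodule.smul_mem _ _ (ih k (Finset.mem_range.1 hk))))
    · set ω := G.ofNeg i.2.1 w with hω
      set X := Real.exp (‖w‖ ^ i.1.1 / 2 ^ i.2.2) with hX
      have hX0 : 0 < X := Real.exp_pos _
      have hs := (hasSum_nat_add_iff' (n + 1)).2 (G.hasSum_homComponent f ω (t : ℂ))
      have hle := hs.norm_le_of_bounded (hasSum_quarter_shift (n + 1) (P * X * t ^ (n + 1)))
        fun k => by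
          rw [norm_mul, norm_pow, Complex.norm_real, Real.norm_of_nonneg ht0.le]
          have h1 : t ^ (k + (n + 1)) ≤ t ^ (n + 1) :=
            pow_le_pow_of_le_one ht0.le (min_le_left _ _) (by omega)
          refine (mul_le_mul (hi' f _ w) h1 (by positivity) (by positivity)).trans_eq ?_
          ring
      have hval : G.homComponent f n ω - (((t : ℂ) ^ n)⁻¹ • ((fun ω => f ((t : ℂ) • ω)) -
          ∑ k ∈ Finset.range n, (t : ℂ) ^ k • G.homComponent f k)) ω =
          -(((t : ℂ) ^ n)⁻¹ * (f ((t : ℂ) • ω) -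
            ∑ k ∈ Finset.range (n + 1), G.homComponent f k ω * (t : ℂ) ^ k)) := by
        have htn : (t : ℂ) ^ n ≠ 0 := pow_ne_zero _ (by exact_mod_cast ht0.ne')
        rw [Finset.sum_range_succ]
        simp only [Pi.smul_apply, Pi.sub_apply, Finset.sum_apply, smul_eq_mul, mul_comm]
        field_simp
        ring
      rw [hval, norm_neg, norm_mul, norm_inv, norm_pow, Complex.norm_real,
        Real.norm_of_nonneg ht0.le, inv_mul_le_iff₀ (by positivity)]
      refine hle.trans ?_
      have h4 : ((1 : ℝ) / 4) ^ (n + 1) ≤ 1 := pow_le_one₀ (by norm_num) (by norm_num)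
      have h5 : t * (4 * (P + 1)) ≤ ε := by
        rw [← le_div_iff₀ (by positivity)]
        exact min_le_right _ _
      calc (1 / 4) ^ (n + 1) * (P * X * t ^ (n + 1)) * (4 / 3)
          ≤ 1 * (P * X * t ^ (n + 1)) * (4 / 3) := by gcongr
        _ = t ^ n * X * (t * (4 / 3 * P)) := by ring
        _ ≤ t ^ n * X * ε := by
            gcongr
            exact (mul_le_mul_of_nonneg_left (by linarith) ht0.le).trans h5
        _ = _ := by ring

/-- The partial sums of the Taylor series converge in `E^α_min`. -/
theorem exists_norm_sub_taylor_le {α : ℝ} (f : G.Emin α) (i : orders α × T × ℕ) {ε : ℝ}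
    (hε : 0 < ε) : ∃ N : ℕ, ∀ w : G.Neg i.2.1,
      ‖f (G.ofNeg i.2.1 w) - ∑ n ∈ Finset.range N, G.homComponent f n (G.ofNeg i.2.1 w)‖ ≤
        ε * Real.exp (‖w‖ ^ i.1.1 / 2 ^ i.2.2) := by
  obtain ⟨i', hi'⟩ := G.exists_norm_homComponent_le i
  set P := G.eminSeminorm α i' f with hP
  have hP0 : 0 ≤ P := apply_nonneg _ _
  obtain ⟨N, hN⟩ := exists_pow_lt_of_lt_one (x := ε / (2 * (P + 1))) (y := (1 / 4 : ℝ))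
    (by positivity) (by norm_num)
  refine ⟨N, fun w => ?_⟩
  set X := Real.exp (‖w‖ ^ i.1.1 / 2 ^ i.2.2) with hX
  have hX0 : 0 < X := Real.exp_pos _
  have hs := (hasSum_nat_add_iff' N).2 (G.hasSum_homComponent f (G.ofNeg i.2.1 w) 1)
  simp only [one_pow, mul_one, one_smul] at hs
  refine (hs.norm_le_of_bounded (hasSum_quarter_shift N (P * X)) fun k => hi' f _ w).trans ?_
  rw [lt_div_iff₀ (by positivity)] at hN
  have h4 : (0 : ℝ) ≤ (1 / 4) ^ N := by positivity
  calc (1 / 4 : ℝ) ^ N * (P * X) * (4 / 3) = ((1 / 4 : ℝ) ^ N * (4 / 3 * P)) * X := by ring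
    _ ≤ ε * X := by
      gcongr
      nlinarith

end GelfandTriple

/-! ### Approximation by functions of finitely many variables -/

/-- A Hilbert–Schmidt operator is small on the orthogonal complement of a suitable finite
orthonormal family. -/
theorem IsHilbertSchmidt.exists_orthonormal_tail {E F : Type*} [NormedAddCommGroup E]
    [InnerProductSpace ℂ E] [NormedAddCommGroup F] [InnerProductSpace ℂ F] {j : E →L[ℂ] F}
    (hj : IsHilbertSchmidt j) {δ : ℝ} (hδ : 0 < δ) :
    ∃ (m : ℕ) (e : Fin m → E), Orthonormal ℂ e ∧
      ∀ x, (∀ a, inner ℂ (e a) x = 0) → ‖j x‖ ≤ δ * ‖x‖ := by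
  obtain ⟨C, hC⟩ := hj
  let S : Set ℝ := {s | ∃ (m : ℕ) (e : Fin m → E), Orthonormal ℂ e ∧ s = ∑ i, ‖j (e i)‖ ^ 2}
  have hne : S.Nonempty := ⟨_, 0, Fin.elim0, by simp, rfl⟩
  have hbdd : BddAbove S := ⟨C, by rintro _ ⟨m, e, he, rfl⟩; exact hC m e he⟩
  obtain ⟨_, ⟨m, e, he, rfl⟩, hlt⟩ :=
    exists_lt_of_lt_csSup hne (sub_lt_self (sSup S) (by positivity : 0 < δ ^ 2))
  refine ⟨m, e, he, fun x hx => ?_⟩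
  by_cases hx0 : x = 0
  · simp [hx0]
  have hn : 0 < ‖x‖ := norm_pos_iff.2 hx0
  let u : E := ((‖x‖⁻¹ : ℝ) : ℂ) • x
  have hu : ‖u‖ = 1 := by
    simp only [u, norm_smul, Complex.norm_real, norm_inv, norm_norm]
    exact inv_mul_cancel₀ hn.ne'
  have hue : ∀ a, inner ℂ (e a) u = 0 := fun a => by simp [u, hx a]
  have hon : Orthonormal ℂ (Fin.cons u e : Fin (m + 1) → E) := by
    refine ⟨fun i => ?_, fun i k hik => ?_⟩
    · refine Fin.cases ?_ (fun i => ?_) i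
      · simpa using hu
      · simpa using he.1 i
    · induction i using Fin.cases with
      | zero =>
        induction k using Fin.cases with
        | zero => exact (hik rfl).elim
        | succ k => simpa using inner_eq_zero_symm.1 (hue k)
      | succ i =>
        induction k using Fin.cases with
        | zero => simpa using hue i
        | succ k => simpa using he.2 fun h => hik (by rw [h])
  have hle : ∑ i, ‖j ((Fin.cons u e : Fin (m + 1) → E) i)‖ ^ 2 ≤ sSup S :=
    le_csSup hbdd ⟨_, _, hon, rfl⟩
  rw [Fin.sum_univ_succ] at hle
  simp only [Fin.cons_zero, Fin.cons_succ] at hle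
  -- the sum over `e` is within `δ ^ 2` of the supremum, and adjoining `u` adds `‖j u‖ ^ 2`
  have h1 : ‖j u‖ ^ 2 ≤ δ ^ 2 := by linarith
  have h2 : ‖j u‖ ≤ δ := (sq_le_sq₀ (norm_nonneg _) hδ.le).1 h1
  simp only [u, map_smul, norm_smul, Complex.norm_real, norm_inv, norm_norm] at h2
  rwa [inv_mul_le_iff₀ hn, mul_comm] at h2

/-- An entire function with at most polynomial growth of degree `n` is determined by its values at
the points `0, …, n`, through Lagrange interpolation. -/
theorem Complex.eq_sum_lagrange_of_growth {h : ℂ → ℂ} (hd : Differentiable ℂ h) {n : ℕ} {M : ℝ}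
    (hM : ∀ z, ‖h z‖ ≤ M * (1 + ‖z‖) ^ n) (z : ℂ) :
    h z = ∑ k ∈ Finset.range (n + 1), h k *
      (Lagrange.basis (Finset.range (n + 1)) (fun k : ℕ => (k : ℂ)) k).eval z := by
  let a : ℕ → ℂ := fun k => (k.factorial : ℂ)⁻¹ * iteratedDeriv k h 0
  have hsum : ∀ z, HasSum (fun k => a k * z ^ k) (h z) := fun z => by
    have := Complex.hasSum_taylorSeries_of_entire hd 0 z
    convert! this using 2 with k
    simp only [a, sub_zero, smul_eq_mul]
    ring
  have hM0 : 0 ≤ M := by simpa using (norm_nonneg _).trans (hM 0)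
  -- Cauchy's estimate on large circles
  have hzero : ∀ k, n < k → a k = 0 := by
    intro k hk
    have hbound : ∀ R : ℝ, 1 ≤ R → ‖a k‖ * R ≤ M * 2 ^ n := by
      intro R hR
      have h1 := Complex.norm_coeff_mul_pow_le (M := M * (2 * R) ^ n) (by linarith : 0 < R)
        (fun z _ => hsum z) (fun z hz => (hM z).trans (by gcongr; linarith)) k
      have h2 : R ^ n * R ≤ R ^ k := by
        rw [← pow_succ]
        exact pow_le_pow_right₀ hR hk
      have h3 : 0 < R ^ n := by positivity
      rw [mul_pow] at h1
      have h4 : R ^ n * (‖a k‖ * R) ≤ R ^ n * (M * 2 ^ n) := by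
        nlinarith [norm_nonneg (a k)]
      exact le_of_mul_le_mul_left h4 h3
    by_contra hne
    have hpos : 0 < ‖a k‖ := norm_pos_iff.2 hne
    have hMn : 0 ≤ M * 2 ^ n := by positivity
    have := hbound (M * 2 ^ n / ‖a k‖ + 1) (by
      have : 0 ≤ M * 2 ^ n / ‖a k‖ := by positivity
      linarith)
    rw [mul_add, mul_one, mul_div_cancel₀ _ hpos.ne'] at this
    linarith
  let P : Polynomial ℂ := ∑ k ∈ Finset.range (n + 1), Polynomial.monomial k (a k)
  have hP : ∀ z, h z = P.eval z := by
    intro z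
    simp only [P, Polynomial.eval_finsetSum, Polynomial.eval_monomial]
    refine (hsum z).unique (hasSum_sum_of_ne_finset_zero fun k hk => ?_)
    rw [hzero k (by simpa using hk), zero_mul]
  have hdeg : P.degree < (Finset.range (n + 1)).card := by
    rw [Finset.card_range]
    refine (Polynomial.degree_sum_le _ _).trans_lt ((Finset.sup_lt_iff (WithBot.bot_lt_coe _)).2
      fun k hk => (Polynomial.degree_monomial_le _ _).trans_lt ?_)
    exact_mod_cast Finset.mem_range.1 hk
  have hint := Lagrange.eq_interpolate (s := Finset.range (n + 1)) (v := fun k : ℕ => (k : ℂ))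
    (Nat.cast_injective.injOn) hdeg
  rw [hP z]
  conv_lhs => rw [hint]
  simp only [Lagrange.interpolate_apply, Polynomial.eval_finsetSum, Polynomial.eval_mul,
    Polynomial.eval_C, hP]

namespace GelfandTriple

variable {T : Type u} (G : GelfandTriple.{u, v} T)

/-- `Φ` is dense in each `H τ`. -/
theorem exists_toH_near (τ : T) (x : G.H τ) {ε : ℝ} (hε : 0 < ε) :
    ∃ ξ : G.Test, ‖G.toH τ ξ - x‖ < ε := by
  obtain ⟨y, hy, hyx⟩ := Metric.mem_closure_iff.1 (G.dense τ x) ε hε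
  choose ξ hξ using hy
  have h0 : ξ G.τ₀ = G.emb τ y := by rw [← hξ G.τ₀, G.emb_center]
  refine ⟨⟨ξ, fun σ => by rw [hξ σ, h0]⟩, ?_⟩
  have : G.toH τ ⟨ξ, fun σ => by rw [hξ σ, h0]⟩ = y := G.emb_injective τ (hξ τ)
  rw [this, ← dist_eq_norm, dist_comm]
  exact hyx

/-- The inclusion `H₋τ ⊂ H₋σ` can be approximated in the operator norm by operators of finite rank
which extend to `Φ'`. -/
theorem exists_finRank_approx (τ : T) : ∃ (σ : T) (j : G.H σ →L[ℂ] G.H τ),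
    (∀ x, G.emb τ (j x) = G.emb σ x) ∧ ∀ δ : ℝ, 0 < δ →
      ∃ (m : ℕ) (e : Fin m → G.Neg σ) (y : Fin m → G.Test), ∀ w : G.Neg τ,
        ‖w.comp j - ∑ a, G.ofNeg τ w (y a) • e a‖ ≤ δ * ‖w‖ := by
  obtain ⟨σ, j, hj, hS⟩ := G.nuclear τ
  refine ⟨σ, j, hj, fun δ hδ => ?_⟩
  obtain ⟨m, e, he, htail⟩ := hS.exists_orthonormal_tail (half_pos hδ)
  -- the vectors `e a` have to be replaced by elements of `Φ`, on which `Φ'` acts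
  set η : ℝ := δ / (2 * (‖j‖ + 1) * (m + 1)) with hη
  have hη0 : 0 < η := by positivity
  choose y hy using fun a => G.exists_toH_near σ (e a) hη0
  refine ⟨m, fun a => InnerProductSpace.toDual ℂ (G.H σ) (e a), y, fun w => ?_⟩
  refine ContinuousLinearMap.opNorm_le_bound _ (by positivity) fun x => ?_
  set x' := x - ∑ a, inner ℂ (e a) x • e a with hx'
  have horth : ∀ a, inner ℂ (e a) x' = 0 := by
    intro a
    rw [hx', inner_sub_right, he.inner_right_fintype, sub_self]
  have hx'x : ‖x'‖ ≤ ‖x‖ := by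
    have h1 : inner ℂ x' x' = inner ℂ x' x := by
      conv_lhs => rw [hx', inner_sub_right, inner_sum]
      simp only [inner_smul_right]
      have h2 : ∀ a, inner ℂ x' (e a) = 0 := fun a => inner_eq_zero_symm.1 (horth a)
      simp [← hx', h2]
    have h3 : ‖x'‖ * ‖x'‖ ≤ ‖x'‖ * ‖x‖ := by
      have h2 := norm_inner_le_norm (𝕜 := ℂ) x' x
      rwa [← h1, inner_self_eq_norm_sq_to_K, norm_pow, RCLike.norm_ofReal, abs_norm, sq] at h2
    by_cases h0 : ‖x'‖ = 0
    · rw [h0]; exact norm_nonneg x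
    · exact le_of_mul_le_mul_left h3 ((norm_nonneg _).lt_of_ne (Ne.symm h0))
  have hval : (w.comp j - ∑ a, G.ofNeg τ w (y a) • InnerProductSpace.toDual ℂ (G.H σ) (e a)) x =
      w (j x' + ∑ a, inner ℂ (e a) x • j (e a - G.toH σ (y a))) := by
    simp only [sub_apply, ContinuousLinearMap.comp_apply,
      sum_apply, smul_apply, ofNeg_apply,
      InnerProductSpace.toDual_apply_apply, hx', map_sub, map_add, map_sum, map_smul, smul_sub,
      Finset.sum_sub_distrib, G.incl_toH hj, smul_eq_mul, mul_comm]
    ring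
  rw [hval]
  have hsum : ‖∑ a, inner ℂ (e a) x • j (e a - G.toH σ (y a))‖ ≤ δ / 2 * ‖x‖ := by
    refine (norm_sum_le_of_le _ (n := fun _ => ‖x‖ * (‖j‖ * η)) fun a _ => ?_).trans ?_
    · rw [norm_smul]
      have h1 : ‖inner ℂ (e a) x‖ ≤ ‖x‖ := by
        simpa [he.1 a] using norm_inner_le_norm (𝕜 := ℂ) (e a) x
      have h2 : ‖e a - G.toH σ (y a)‖ ≤ η := by rw [norm_sub_rev]; exact (hy a).le
      have h3 := (j.le_opNorm (e a - G.toH σ (y a))).trans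
        (mul_le_mul_of_nonneg_left h2 (norm_nonneg _))
      exact mul_le_mul h1 h3 (norm_nonneg _) (norm_nonneg _)
    · rw [Finset.sum_const, Finset.card_univ, Fintype.card_fin, nsmul_eq_mul]
      have h1 : (m : ℝ) * (‖j‖ * η) ≤ δ / 2 := by
        have h2 : η * (2 * (‖j‖ + 1) * (m + 1)) = δ := div_mul_cancel₀ _ (by positivity)
        have h3 : (m : ℝ) * ‖j‖ ≤ (m + 1) * (‖j‖ + 1) := by
          have := norm_nonneg j
          gcongr <;> linarith
        nlinarith
      calc (m : ℝ) * (‖x‖ * (‖j‖ * η)) = (m * (‖j‖ * η)) * ‖x‖ := by ring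
        _ ≤ _ := by gcongr
  refine (w.le_opNorm _).trans ?_
  have h4 : ‖j x'‖ ≤ δ / 2 * ‖x‖ := (htail x' horth).trans (by gcongr)
  calc ‖w‖ * ‖j x' + ∑ a, inner ℂ (e a) x • j (e a - G.toH σ (y a))‖
      ≤ ‖w‖ * (δ / 2 * ‖x‖ + δ / 2 * ‖x‖) := by
        gcongr
        exact (norm_add_le _ _).trans (add_le_add h4 hsum)
    _ = _ := by ring

/-- Functions in `E^α_min` are Lipschitz continuous on bounded sets (Schwarz's lemma), and hence
can be approximated by functions of finitely many variables. -/
theorem exists_norm_sub_finRank_le {α : ℝ} (hα : 0 ≤ α) (f : G.Emin α) (τ : T) {ε : ℝ}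
    (hε : 0 < ε) : ∃ (σ : T) (m : ℕ) (e : Fin m → G.Neg σ) (y : Fin m → G.Test),
      ∀ w : G.Neg τ, ‖w‖ ≤ 1 →
        ‖f (G.ofNeg τ w) - f (G.ofNeg σ (∑ a, G.ofNeg τ w (y a) • e a))‖ ≤ ε := by
  obtain ⟨σ, j, hj, happ⟩ := G.exists_finRank_approx τ
  obtain ⟨β⟩ := nonempty_orders hα
  have hβ := orders_pos β.2
  set M := G.eminSeminorm α (β, σ, 0) f * Real.exp ((‖j‖ + 1) ^ β.1 / 2 ^ 0) with hM
  have hM0 : 0 ≤ M := mul_nonneg (apply_nonneg _ _) (Real.exp_pos _).le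
  have hbound : ∀ v : G.Neg σ, ‖v‖ ≤ ‖j‖ + 1 → ‖f (G.ofNeg σ v)‖ ≤ M := fun v hv => by
    refine (G.norm_le_eminSeminorm f (β, σ, 0) v).trans
      (mul_le_mul_of_nonneg_left ?_ (apply_nonneg _ _))
    dsimp only
    gcongr
  set δ := min (1 / 2) (ε / (2 * M + 1)) with hδ
  have hδ0 : 0 < δ := by positivity
  obtain ⟨m, e, y, hQ⟩ := happ δ hδ0
  refine ⟨σ, m, e, y, fun w hw => ?_⟩
  rw [← G.ofNeg_comp hj]
  set p := w.comp j with hp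
  set q := ∑ a, G.ofNeg σ p (y a) • e a with hq
  have hqp : ‖p - q‖ ≤ δ := by
    have := hQ w
    rw [← G.ofNeg_comp hj] at this
    exact this.trans (mul_le_of_le_one_right hδ0.le hw)
  have hpj : ‖p‖ ≤ ‖j‖ := (w.opNorm_comp_le j).trans (mul_le_of_le_one_left (norm_nonneg _) hw)
  rcases (norm_nonneg (p - q)).eq_or_lt with hd | hd
  · rw [sub_eq_zero.1 (norm_eq_zero.1 hd.symm), sub_self, norm_zero]
    exact hε.le
  set d := ‖p - q‖ with hdd
  -- Schwarz's lemma on the line through `p` and `q`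
  let u : G.Neg σ := ((d⁻¹ : ℝ) : ℂ) • (q - p)
  have hu : ‖u‖ = 1 := by
    simp only [u, norm_smul, Complex.norm_real, norm_inv, norm_sub_rev q p, ← hdd]
    rw [Real.norm_of_nonneg hd.le, inv_mul_cancel₀ hd.ne']
  let φ : ℂ → ℂ := fun z => f (G.ofNeg σ (p + z • u))
  have hφM : ∀ z ∈ Metric.ball (0 : ℂ) 1, ‖φ z‖ ≤ M := fun z hz => hbound _ <| by
    refine (norm_add_le _ _).trans (add_le_add hpj ?_)
    rw [norm_smul, hu, mul_one]
    exact (mem_ball_zero_iff.1 hz).le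
  have hd1 : d < 1 := hqp.trans_lt ((min_le_left _ _).trans_lt (by norm_num))
  have hdc : ‖(d : ℂ)‖ = d := by rw [Complex.norm_real, Real.norm_of_nonneg hd.le]
  have hS := Complex.dist_le_div_mul_dist_of_mapsTo_ball (f := φ) (c := 0) (R₁ := 1) (R₂ := 2 * M)
    (z := (d : ℂ)) ((f.2.1 σ).differentiable_line p u).differentiableOn (fun z hz => by
      rw [mem_closedBall_iff_norm, two_mul]
      exact (norm_sub_le _ _).trans (add_le_add (hφM z hz) (hφM 0 (by simp))))
    (mem_ball_zero_iff.2 (by rw [hdc]; exact hd1))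
  have h1 : φ (d : ℂ) = f (G.ofNeg σ q) := by
    simp only [φ, u, smul_smul]
    rw [← Complex.ofReal_mul, mul_inv_cancel₀ hd.ne', Complex.ofReal_one, one_smul,
      add_sub_cancel]
  have h2 : φ 0 = f (G.ofNeg σ p) := by
    change f (G.ofNeg σ (p + (0 : ℂ) • u)) = _
    rw [zero_smul ℂ u, add_zero p]
  rw [h1, h2, dist_eq_norm, norm_sub_rev, div_one, dist_zero_right, hdc] at hS
  refine hS.trans ?_
  have h3 : δ * (2 * M + 1) ≤ ε := by
    rw [← le_div_iff₀ (by positivity)]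
    exact min_le_right _ _
  nlinarith

end GelfandTriple

/-! ### Density of the polynomials of finite rank -/

theorem exists_eq_norm_smul {E : Type*} [NormedAddCommGroup E] [NormedSpace ℂ E] (w : E) :
    ∃ u : E, ‖u‖ ≤ 1 ∧ w = (‖w‖ : ℂ) • u := by
  refine ⟨((‖w‖⁻¹ : ℝ) : ℂ) • w, ?_, ?_⟩
  · rw [norm_smul, Complex.norm_real, norm_inv, norm_norm]
    exact inv_mul_le_one
  · by_cases h0 : ‖w‖ = 0
    · simp [norm_eq_zero.1 h0]
    · rw [smul_smul, ← Complex.ofReal_mul, mul_inv_cancel₀ h0, Complex.ofReal_one, one_smul]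

namespace GelfandTriple

variable {T : Type u} (G : GelfandTriple.{u, v} T)

/-- The algebra of functions on `Φ'` generated by the linear functions `ω ↦ ⟨ω, ξ⟩`. -/
def cylinderAlgebra : Subalgebra ℂ (G.CoTest → ℂ) :=
  Algebra.adjoin ℂ (Set.range fun (ξ : G.Test) (ω : G.CoTest) => ω ξ)

/-- The functions in the cylinder algebra are polynomials of finite rank. -/
theorem exists_finPoly_eq (α : ℝ) {g : G.CoTest → ℂ} (hg : g ∈ G.cylinderAlgebra) :
    ∃ w : G.FinSeq, ∀ ω, G.finPoly α w ω = g ω := by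
  let P : Submodule ℂ (G.CoTest → ℂ) := LinearMap.range
    ((G.eminSubmodule α).subtype ∘ₗ (G.finPoly α : G.FinSeq →ₗ[ℂ] ↥(G.eminSubmodule α)))
  suffices h : g ∈ P by
    obtain ⟨w, rfl⟩ := h
    exact ⟨w, fun ω => rfl⟩
  have hmon : ∀ h ∈ Submonoid.closure (Set.range fun (ξ : G.Test) (ω : G.CoTest) => ω ξ),
      ∃ (n : ℕ) (x : Fin n → G.Test), h = fun ω => ∏ j, ω (x j) := by
    intro h hh
    induction hh using Submonoid.closure_induction_left with
    | one => exact ⟨0, Fin.elim0, by funext ω; simp⟩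
    | mul_left a ha b hb ih =>
      obtain ⟨ξ, rfl⟩ := ha
      obtain ⟨n, x, rfl⟩ := ih
      exact ⟨n + 1, Fin.cons ξ x, by funext ω; simp [Fin.prod_univ_succ]⟩
  rw [cylinderAlgebra, ← Subalgebra.mem_toSubmodule, Algebra.adjoin_eq_span] at hg
  refine Submodule.span_le.2 (fun h hh => ?_) hg
  obtain ⟨n, x, rfl⟩ := hmon h hh
  refine ⟨G.single n ⟨G.symProd x, G.symProd_mem_finRank x⟩, funext fun ω => ?_⟩
  change (G.finPoly α (G.single n _) : G.Emin α) ω = _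
  rw [finPoly_single, monomialMap_apply, coPow_symProd]

/-- A homogeneous function has polynomial growth on each `H₋τ`. -/
theorem exists_norm_le_mul_pow {α : ℝ} (hα : 0 ≤ α) (f : G.Emin α) {n : ℕ}
    (hf : ∀ (c : ℂ) ω, f (c • ω) = c ^ n * f ω) (τ : T) :
    ∃ M : ℝ, 0 ≤ M ∧ ∀ w : G.Neg τ, ‖f (G.ofNeg τ w)‖ ≤ M * ‖w‖ ^ n := by
  obtain ⟨β⟩ := nonempty_orders hα
  have hβ := orders_pos β.2
  refine ⟨G.eminSeminorm α (β, τ, 0) f * Real.exp ((1 : ℝ) ^ β.1 / 2 ^ 0),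
    mul_nonneg (apply_nonneg _ _) (Real.exp_pos _).le, fun w => ?_⟩
  obtain ⟨u, hu1, hw⟩ := exists_eq_norm_smul w
  have h1 : f (G.ofNeg τ w) = (‖w‖ : ℂ) ^ n * f (G.ofNeg τ u) := by
    conv_lhs => rw [hw]
    rw [map_smul, hf]
  rw [h1, norm_mul, norm_pow, Complex.norm_real, norm_norm, mul_comm]
  refine mul_le_mul_of_nonneg_right ((G.norm_le_eminSeminorm f (β, τ, 0) u).trans
    (mul_le_mul_of_nonneg_left ?_ (apply_nonneg _ _))) (by positivity)
  dsimp only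
  gcongr

/-- A homogeneous function in `E^α_min` is a polynomial on finite-dimensional subspaces. -/
theorem comp_sum_mem_cylinderAlgebra {α : ℝ} (hα : 0 ≤ α) (f : G.Emin α) {n : ℕ}
    (hf : ∀ (c : ℂ) ω, f (c • ω) = c ^ n * f ω) {σ : T} {m : ℕ} (e : Fin m → G.Neg σ)
    (y : Fin m → G.Test) (v : G.Neg σ) :
    (fun ω : G.CoTest => f (G.ofNeg σ (v + ∑ a, ω (y a) • e a))) ∈ G.cylinderAlgebra := by
  induction m generalizing v with
  | zero =>
    simp only [Finset.univ_eq_empty, Finset.sum_empty, add_zero]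
    exact Subalgebra.algebraMap_mem G.cylinderAlgebra (f (G.ofNeg σ v))
  | succ m ih =>
    obtain ⟨M, hM0, hM⟩ := G.exists_norm_le_mul_pow hα f hf σ
    set e' := e (Fin.last m) with he'
    -- the dependence on the last variable is given by Lagrange interpolation
    have key : (fun ω : G.CoTest => f (G.ofNeg σ (v + ∑ a, ω (y a) • e a))) =
        ∑ k ∈ Finset.range (n + 1),
          (fun ω : G.CoTest => f (G.ofNeg σ ((v + (k : ℂ) • e') +
            ∑ a : Fin m, ω (y a.castSucc) • e a.castSucc))) *
          Polynomial.aeval (fun ω : G.CoTest => ω (y (Fin.last m)))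
            (Lagrange.basis (Finset.range (n + 1)) (fun k : ℕ => (k : ℂ)) k) := by
      funext ω
      set p := v + ∑ a : Fin m, ω (y a.castSucc) • e a.castSucc with hp
      have h1 : v + ∑ a, ω (y a) • e a = p + ω (y (Fin.last m)) • e' := by
        rw [Fin.sum_univ_castSucc, hp, he', add_assoc]
      have h2 := Complex.eq_sum_lagrange_of_growth ((f.2.1 σ).differentiable_line p e')
        (n := n) (M := M * (‖p‖ + ‖e'‖) ^ n) (fun z => by
          refine (hM _).trans ?_
          rw [mul_assoc, ← mul_pow]
          refine mul_le_mul_of_nonneg_left (pow_le_pow_left₀ (norm_nonneg _) ?_ n) hM0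
          refine (norm_add_le _ _).trans ?_
          rw [norm_smul]
          nlinarith [norm_nonneg z, norm_nonneg p, norm_nonneg e',
            mul_nonneg (norm_nonneg z) (norm_nonneg p)]) (ω (y (Fin.last m)))
      change f (G.ofNeg σ (v + ∑ a, ω (y a) • e a)) = _
      rw [h1]
      refine h2.trans ?_
      rw [Finset.sum_apply]
      refine Finset.sum_congr rfl fun k _ => ?_
      rw [Pi.mul_apply]
      congr 1
      · rw [hp, add_right_comm]
      · have := Polynomial.aeval_algHom_apply (Pi.evalAlgHom ℂ (fun _ : G.CoTest => ℂ) ω)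
          (fun ω : G.CoTest => ω (y (Fin.last m)))
          (Lagrange.basis (Finset.range (n + 1)) (fun k : ℕ => (k : ℂ)) k)
        simp only [Pi.evalAlgHom_apply] at this
        rw [← this, Polynomial.coe_aeval_eq_eval]
    rw [key]
    refine Subalgebra.sum_mem _ fun k _ => Subalgebra.mul_mem _
      (ih (fun a => e a.castSucc) (fun a => y a.castSucc) _) ?_
    refine Algebra.adjoin_mono (Set.singleton_subset_iff.2 ?_)
      (Polynomial.aeval_mem_adjoin_singleton ℂ fun ω : G.CoTest => ω (y (Fin.last m)))
    exact ⟨y (Fin.last m), rfl⟩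

/-- Homogeneous functions in `E^α_min` can be approximated by polynomials of finite rank. -/
theorem exists_norm_sub_finPoly_le {α : ℝ} (hα : 0 ≤ α) (f : G.Emin α) {n : ℕ}
    (hf : ∀ (c : ℂ) ω, f (c • ω) = c ^ n * f ω) (i : orders α × T × ℕ) {ε : ℝ} (hε : 0 < ε) :
    ∃ p : G.FinSeq, ∀ w : G.Neg i.2.1,
      ‖f (G.ofNeg i.2.1 w) - G.finPoly α p (G.ofNeg i.2.1 w)‖ ≤
        ε * Real.exp (‖w‖ ^ i.1.1 / 2 ^ i.2.2) := by
  obtain ⟨K, hK0, hK⟩ := exists_pow_le_exp_rpow (orders_pos i.1.2) i.2.2 n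
  obtain ⟨σ, m, e, y, h⟩ := G.exists_norm_sub_finRank_le hα f i.2.1
    (by positivity : 0 < ε / (K + 1))
  obtain ⟨p, hp⟩ := G.exists_finPoly_eq α (G.comp_sum_mem_cylinderAlgebra hα f hf e y 0)
  refine ⟨p, fun w => ?_⟩
  rw [hp, zero_add]
  obtain ⟨u, hu1, hw⟩ := exists_eq_norm_smul w
  have h1 : f (G.ofNeg i.2.1 w) = (‖w‖ : ℂ) ^ n * f (G.ofNeg i.2.1 u) := by
    conv_lhs => rw [hw]
    rw [map_smul, hf]
  have h2 : f (G.ofNeg σ (∑ a, G.ofNeg i.2.1 w (y a) • e a)) =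
      (‖w‖ : ℂ) ^ n * f (G.ofNeg σ (∑ a, G.ofNeg i.2.1 u (y a) • e a)) := by
    rw [← hf, ← map_smul]
    conv_lhs => rw [hw]
    simp only [map_smul, Finset.smul_sum, smul_smul, smul_apply, smul_eq_mul]
  rw [h1, h2, ← mul_sub, norm_mul, norm_pow, Complex.norm_real, norm_norm]
  have h3 := hK ‖w‖ (norm_nonneg w)
  have h4 : ε / (K + 1) * K ≤ ε := by
    rw [div_mul_eq_mul_div, div_le_iff₀ (by positivity)]
    nlinarith
  calc ‖w‖ ^ n * ‖f (G.ofNeg i.2.1 u) - f (G.ofNeg σ (∑ a, G.ofNeg i.2.1 u (y a) • e a))‖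
      ≤ (K * Real.exp (‖w‖ ^ i.1.1 / 2 ^ i.2.2)) * (ε / (K + 1)) :=
        mul_le_mul h3 (h u hu1) (norm_nonneg _) (by positivity)
    _ = (ε / (K + 1) * K) * Real.exp (‖w‖ ^ i.1.1 / 2 ^ i.2.2) := by ring
    _ ≤ _ := by gcongr

/-- The polynomials of finite rank are dense in `E^α_min`. -/
theorem denseRange_finPoly {α : ℝ} (hα : 0 ≤ α) : DenseRange (G.finPoly α) := by
  have : Nonempty (orders α × T × ℕ) := ⟨(nonempty_orders hα).some, G.τ₀, 0⟩
  refine (G.eminSeminorm_withSeminorms hα).dense_of_directed G.directed_eminSeminorm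
    fun f i ε hε => ?_
  obtain ⟨N, hN⟩ := G.exists_norm_sub_taylor_le f i (by positivity : 0 < ε / 3)
  have hη : 0 < ε / (3 * (N + 1)) := by positivity
  choose p hp using fun n => G.exists_norm_sub_finPoly_le hα
    (⟨G.homComponent f n, G.homComponent_mem hα f n⟩ : G.Emin α)
    (G.homComponent_smul f n) i hη
  refine ⟨_, ⟨∑ n ∈ Finset.range N, p n, rfl⟩, ?_⟩
  refine lt_of_le_of_lt (G.eminSeminorm_le _ i (C := 2 * ε / 3) fun w => ?_) (by linarith)
  set ω := G.ofNeg i.2.1 w with hω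
  set X := Real.exp (‖w‖ ^ i.1.1 / 2 ^ i.2.2) with hX
  have hX0 : 0 < X := Real.exp_pos _
  rw [emin_sub_apply, map_sum, ← evalAt_apply, map_sum]
  simp only [evalAt_apply]
  have h1 : (∑ n ∈ Finset.range N, G.finPoly α (p n) ω) - f ω =
      -(f ω - ∑ n ∈ Finset.range N, G.homComponent f n ω) -
        ∑ n ∈ Finset.range N, (G.homComponent f n ω - G.finPoly α (p n) ω) := by
    rw [Finset.sum_sub_distrib]
    ring
  rw [h1]
  refine (norm_sub_le _ _).trans ?_
  rw [norm_neg]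
  have h2 : ‖∑ n ∈ Finset.range N, (G.homComponent f n ω - G.finPoly α (p n) ω)‖ ≤
      N * (ε / (3 * (N + 1)) * X) := by
    refine (norm_sum_le_of_le _ fun n _ => hp n w).trans_eq ?_
    rw [Finset.sum_const, Finset.card_range, nsmul_eq_mul]
  have h3 : N * (ε / (3 * (N + 1))) ≤ ε / 3 := by
    rw [← mul_div_assoc, div_le_div_iff₀ (by positivity) (by positivity)]
    nlinarith
  have h4 : N * (ε / (3 * (N + 1)) * X) ≤ ε / 3 * X := by
    rw [← mul_assoc]
    gcongr
  calc _ ≤ ε / 3 * X + ε / 3 * X := add_le_add (hN w) (h2.trans h4)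
    _ = _ := by ring

/-- The norms `‖·‖_τ` on `Φ^⊙ n` are directed; they are compared through the suprema of polynomials over
unit balls. -/
theorem directed_powSeminorm (n : ℕ) (τ₁ τ₂ : T) : ∃ τ C, 0 ≤ C ∧ ∀ φ : G.SymPow n,
    G.powSeminorm n τ₁ φ ≤ C * G.powSeminorm n τ φ ∧
      G.powSeminorm n τ₂ φ ≤ C * G.powSeminorm n τ φ := by
  obtain ⟨σ₁, K₁, hK₁0, hK₁⟩ := G.exists_powSeminorm_le τ₁
  obtain ⟨σ₂, K₂, hK₂0, hK₂⟩ := G.exists_powSeminorm_le τ₂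
  obtain ⟨τ, j₁, j₂, hj₁, hj₂⟩ := G.directed σ₁ σ₂
  have key : ∀ (σ : T) (j : G.H τ →L[ℂ] G.H σ), (∀ x, G.emb σ (j x) = G.emb τ x) →
      ∀ (φ : G.SymPow n) (w : G.Neg σ), ‖w‖ ≤ 1 →
        ‖G.coPow (G.ofNeg σ w) n φ‖ ≤ ‖j‖ ^ n * G.powSeminorm n τ φ := by
    intro σ j hj φ w hw
    rw [← G.ofNeg_comp hj]
    refine (G.norm_eval_le τ _ φ).trans (mul_le_mul_of_nonneg_right ?_ (apply_nonneg _ _))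
    exact pow_le_pow_left₀ (norm_nonneg _) ((w.opNorm_comp_le j).trans
      (mul_le_of_le_one_left (norm_nonneg _) hw)) n
  refine ⟨τ, max (K₁ ^ n * ‖j₁‖ ^ n) (K₂ ^ n * ‖j₂‖ ^ n), le_max_of_le_left (by positivity),
    fun φ => ⟨?_, ?_⟩⟩
  · have h0 : 0 ≤ G.powSeminorm n τ φ := apply_nonneg _ _
    refine (hK₁ n φ _ (by positivity) (key σ₁ j₁ hj₁ φ)).trans ?_
    rw [← mul_assoc]
    exact mul_le_mul_of_nonneg_right (le_max_left _ _) h0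
  · have h0 : 0 ≤ G.powSeminorm n τ φ := apply_nonneg _ _
    refine (hK₂ n φ _ (by positivity) (key σ₂ j₂ hj₂ φ)).trans ?_
    rw [← mul_assoc]
    exact mul_le_mul_of_nonneg_right (le_max_right _ _) h0

/-- The tensors of finite rank are dense in `Φ^⊙ n`. -/
theorem dense_finRank (n : ℕ) : Dense (G.finRank n : Set (G.SymPow n)) := by
  have : Nonempty T := ⟨G.τ₀⟩
  refine (G.powSeminorm_withSeminorms n).dense_of_directed (G.directed_powSeminorm n)
    fun φ τ ε hε => ?_
  obtain ⟨σ, K, hK0, hK⟩ := G.exists_powSeminorm_le τ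
  obtain ⟨σ', m, e, y, h⟩ := G.exists_norm_sub_finRank_le zero_le_one (G.monomialMap 1 n φ) σ
    (by positivity : 0 < ε / (2 * (K ^ n + 1)))
  refine ⟨∑ i : Fin n → Fin m, (φ.1 fun k => G.ofNeg σ' (e (i k))) • G.symProd (y ∘ i),
    Submodule.sum_mem _ fun i _ => Submodule.smul_mem _ _ (G.symProd_mem_finRank _), ?_⟩
  have hval : ∀ ω, G.coPow ω n (∑ i : Fin n → Fin m,
      (φ.1 fun k => G.ofNeg σ' (e (i k))) • G.symProd (y ∘ i)) =
      G.monomialMap 1 n φ (G.ofNeg σ' (∑ a, ω (y a) • e a)) := by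
    intro ω
    rw [monomialMap_apply]
    change _ = φ.1 fun _ => G.ofNeg σ' (∑ a, ω (y a) • e a)
    have h1 : (fun _ : Fin n => G.ofNeg σ' (∑ a, ω (y a) • e a)) =
        fun _ => ∑ a, ω (y a) • G.ofNeg σ' (e a) := by simp only [map_sum, map_smul]
    rw [h1, φ.1.map_sum]
    simp only [map_sum, map_smul, coPow_symProd, smul_eq_mul]
    refine Finset.sum_congr rfl fun i _ => ?_
    rw [φ.1.map_smul_univ (fun k => ω (y (i k))), smul_eq_mul, mul_comm]
    rfl
  refine lt_of_le_of_lt (hK n _ (ε / (2 * (K ^ n + 1))) (by positivity) fun w hw => ?_) ?_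
  · rw [map_sub, hval, norm_sub_rev]
    exact h w hw
  · rw [← mul_div_assoc, div_lt_iff₀ (by positivity)]
    have : 0 ≤ K ^ n := by positivity
    nlinarith

end GelfandTriple

/-! ### Geometric bounds for formal power series -/

theorem sum_range_pow_le_one_add_pow {x : ℝ} (hx : 0 ≤ x) (n : ℕ) :
    ∑ m ∈ Finset.range (n + 1), x ^ m ≤ (1 + x) ^ n := by
  induction n with
  | zero => simp
  | succ n ih =>
    rw [Finset.sum_range_succ, pow_succ (1 + x), mul_add, mul_one, pow_succ x]
    have : x ^ n ≤ (1 + x) ^ n := pow_le_pow_left₀ hx (by linarith) n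
    nlinarith

namespace GelfandTriple

variable {T : Type u} (G : GelfandTriple.{u, v} T)

theorem tpow_smul (c : ℂ) (ξ : G.Test) (n : ℕ) : G.tpow (c • ξ) n = c ^ n • G.tpow ξ n := by
  refine SymPow.eq_of_coPow_eq fun ω => ?_
  rw [map_smul, coPow_tpow, coPow_tpow, map_smul, smul_eq_mul, smul_eq_mul, mul_pow]

theorem exists_powSeminorm_tpow_le (τ : T) : ∃ (σ : T) (K : ℝ), 0 ≤ K ∧ ∀ (n : ℕ) (ξ : G.Test),
    G.powSeminorm n τ (G.tpow ξ n) ≤ (K * ‖G.toH σ ξ‖) ^ n := by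
  obtain ⟨σ, K, hK0, hK⟩ := G.exists_powSeminorm_le τ
  refine ⟨σ, K, hK0, fun n ξ => ?_⟩
  rw [mul_pow]
  refine hK n _ _ (by positivity) fun w hw => ?_
  rw [coPow_tpow, norm_pow]
  refine pow_le_pow_left₀ (norm_nonneg _) ((G.norm_ofNeg_apply_le σ w ξ).trans ?_) n
  exact mul_le_of_le_one_left (norm_nonneg _) hw

/-- The neighborhoods of zero in `Φ` contain the balls of the norms `‖·‖_τ`. -/
theorem exists_norm_toH_lt_subset {U : Set G.Test} (hU : U ∈ 𝓝 (0 : G.Test)) :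
    ∃ (τ : T) (r : ℝ), 0 < r ∧ ∀ ξ, ‖G.toH τ ξ‖ < r → ξ ∈ U := by
  classical
  have hdir : ∀ s : Finset T, ∃ τ, ∀ σ ∈ s, ∃ j : G.H τ →L[ℂ] G.H σ,
      ∀ x, G.emb σ (j x) = G.emb τ x := by
    intro s
    induction s using Finset.induction_on with
    | empty => exact ⟨G.τ₀, by simp⟩
    | insert a s _ ih =>
      obtain ⟨τ, hτ⟩ := ih
      obtain ⟨τ₃, j₁, j₂, h₁, h₂⟩ := G.directed a τ
      refine ⟨τ₃, fun σ hσ => ?_⟩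
      rcases Finset.mem_insert.1 hσ with rfl | hσ
      · exact ⟨j₁, h₁⟩
      · obtain ⟨j, hj⟩ := hτ σ hσ
        exact ⟨j.comp j₂, fun x => by simp [hj, h₂]⟩
  rw [nhds_subtype_eq_comap] at hU
  obtain ⟨S, hS, hSU⟩ := hU
  rw [nhds_pi, Filter.mem_pi] at hS
  obtain ⟨I, hI, t, ht, htS⟩ := hS
  obtain ⟨τ, hτ⟩ := hdir hI.toFinset
  choose! j hj using hτ
  have hnear : ∀ᶠ x in 𝓝 (0 : G.H τ), ∀ σ ∈ I, j σ x ∈ t σ := by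
    rw [Filter.eventually_all_finite hI]
    intro σ hσ
    have : Filter.Tendsto (j σ) (𝓝 0) (𝓝 0) := by simpa using (j σ).continuous.tendsto 0
    exact this.eventually (ht σ)
  obtain ⟨r, hr, hball⟩ := Metric.eventually_nhds_iff.1 hnear
  refine ⟨τ, r, hr, fun ξ hξ => hSU (htS fun σ hσ => ?_)⟩
  have := hball (y := G.toH τ ξ) (by simpa using hξ) σ hσ
  rwa [G.incl_toH (hj σ (hI.mem_toFinset.2 hσ))] at this

/-- A family of formal power series, indexed by `ξ ∈ Φ`, whose coefficients are bounded by
`(C ‖ξ‖_σ) ^ n`. -/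
def HasGeometricBound (s : G.Test → PowerSeries ℂ) : Prop :=
  ∃ (σ : T) (C : ℝ), 0 ≤ C ∧ ∀ ξ n, ‖PowerSeries.coeff n (s ξ)‖ ≤ (C * ‖G.toH σ ξ‖) ^ n

variable {G}

/-- Cauchy's estimate for `ρ` on the lines through zero. -/
theorem FormalFun.IsHolomorphicNearZero.hasGeometricBound {ρ : G.FormalFun}
    (hρ : ρ.IsHolomorphicNearZero) (h1 : ∀ ξ, ρ 0 (G.tpow ξ 0) = 1) :
    G.HasGeometricBound fun ξ => PowerSeries.mk fun n => ρ n (G.tpow ξ n) := by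
  obtain ⟨U, r, hUo, h0U, hr, hsum⟩ := hρ
  have hrc : ContinuousAt r 0 := hr.1.continuousAt (hUo.mem_nhds h0U)
  have hev : ∀ᶠ ξ in 𝓝 (0 : G.Test), ξ ∈ U ∧ ‖r ξ‖ < ‖r 0‖ + 1 :=
    (hUo.mem_nhds h0U |> Filter.eventually_mem_set.2).and
      (hrc.norm.eventually (gt_mem_nhds (lt_add_one _)))
  obtain ⟨τ, ε, hε, hball⟩ := G.exists_norm_toH_lt_subset hev
  set M := ‖r 0‖ + 1 with hM
  have hM1 : 1 ≤ M := by have := norm_nonneg (r 0); linarith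
  refine ⟨τ, M / ε, by positivity, fun ξ n => ?_⟩
  rw [PowerSeries.coeff_mk]
  rcases Nat.eq_zero_or_pos n with rfl | hn
  · simp [h1]
  by_cases hξ : ‖G.toH τ ξ‖ = 0
  · have hξ0 : ξ = (0 : ℂ) • ξ := by rw [zero_smul]; exact G.eq_zero_of_testSeminorm τ ξ hξ
    rw [hξ0, tpow_smul, zero_pow hn.ne', zero_smul, map_zero, norm_zero]
    positivity
  have hN : 0 < ‖G.toH τ ξ‖ := (norm_nonneg _).lt_of_ne (Ne.symm hξ)
  have hmem : ∀ z : ℂ, ‖z‖ < ε / ‖G.toH τ ξ‖ → z • ξ ∈ U ∧ ‖r (z • ξ)‖ < M := fun z hz =>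
    hball _ (by rwa [map_smul, norm_smul, ← lt_div_iff₀ hN])
  have key := Complex.norm_coeff_mul_pow_le (a := fun n => ρ n (G.tpow ξ n))
    (g := fun z => r (z • ξ)) (div_pos hε hN) (fun z hz => by
      have := hsum _ (hmem z hz).1
      simpa only [tpow_smul, map_smul, smul_eq_mul, mul_comm] using this)
    (fun z hz => (hmem z hz).2.le) n
  rw [← le_div_iff₀ (by positivity)] at key
  refine key.trans ?_
  rw [div_pow, div_div_eq_mul_div, div_mul_eq_mul_div, div_pow, mul_pow]
  have : M ≤ M ^ n := le_self_pow₀ hM1 hn.ne'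
  gcongr

theorem HasGeometricBound.inv {s : G.Test → PowerSeries ℂ} (hs : G.HasGeometricBound s)
    (h1 : ∀ ξ, PowerSeries.constantCoeff (s ξ) = 1) : G.HasGeometricBound fun ξ => (s ξ)⁻¹ := by
  obtain ⟨σ, C, hC0, hC⟩ := hs
  refine ⟨σ, 2 * C, by positivity, fun ξ n => ?_⟩
  rw [mul_assoc]
  exact PowerSeries.norm_coeff_inv_le (by positivity) (h1 ξ) (hC ξ) n

/-- The values of a quasi-holomorphic series on the powers `ξ^⊗ n`. -/
theorem FormalMap.IsQuasiHolomorphic.exists_norm_toH_le {F : G.FormalMap}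
    (hF : F.IsQuasiHolomorphic) (h0 : F.NoConst) (τ : T) :
    ∃ (σ : T) (C : ℝ), 0 ≤ C ∧ ∀ n ξ, ‖G.toH τ (F n (G.tpow ξ n))‖ ≤ (C * ‖G.toH σ ξ‖) ^ n := by
  obtain ⟨τ', C, hC0, hC⟩ := hF τ
  obtain ⟨σ, K, hK0, hK⟩ := G.exists_powSeminorm_tpow_le τ'
  refine ⟨σ, C * K, by positivity, fun n ξ => ?_⟩
  rcases Nat.eq_zero_or_pos n with rfl | hn
  · have h0' : F 0 = 0 := h0
    simp [h0']
  · refine (hC n hn _).trans ?_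
    rw [mul_assoc, mul_pow]
    exact mul_le_mul_of_nonneg_left (hK n ξ) (by positivity)

/-- The formal curve `z ↦ F(zξ)`. -/
def FormalMap.curve (F : G.FormalMap) (ξ : G.Test) (k : ℕ) : G.Test := F k (G.tpow ξ k)

theorem FormalMap.NoConst.curve_zero {F : G.FormalMap} (h0 : F.NoConst) (ξ : G.Test) :
    F.curve ξ 0 = 0 := by
  have h0' : F 0 = 0 := h0
  rw [curve, h0']
  rfl

/-- The composition of a geometrically bounded series with a quasi-holomorphic one is
geometrically bounded. -/
theorem HasGeometricBound.alongCurve {ℓ : ∀ m, G.SymPow m →ₗ[ℂ] ℂ}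
    (hℓ : G.HasGeometricBound fun ξ => PowerSeries.mk fun n => ℓ n (G.tpow ξ n))
    {F : G.FormalMap} (hF : F.IsQuasiHolomorphic) (h0 : F.NoConst) :
    G.HasGeometricBound fun ξ => G.alongCurve ℓ (F.curve ξ) := by
  obtain ⟨τ, D, hD0, hD⟩ := hℓ
  obtain ⟨σ, C, hC0, hC⟩ := hF.exists_norm_toH_le h0 τ
  simp only [PowerSeries.coeff_mk] at hD
  refine ⟨σ, (1 + 6 * D) * (2 * C), by positivity, fun ξ n => ?_⟩
  set N := ‖G.toH σ ξ‖ with hN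
  have hN0 : 0 ≤ N := norm_nonneg _
  let b : ℕ → ℝ := fun k => ‖G.toH τ (F.curve ξ k)‖
  have hterm : ∀ m, ‖ℓ m (G.symCoeff (F.curve ξ) m n)‖ ≤ (6 * D) ^ m * (2 * (C * N)) ^ n := by
    intro m
    have h1 : ∀ x : Fin m → G.Test, ‖ℓ m (G.symProd x)‖ ≤ 6 ^ m * D ^ m * ∏ i, ‖G.toH τ (x i)‖ :=
      G.norm_finRank_symProd_le ((ℓ m).comp (G.finRank m).subtype) τ (by positivity)
        fun η => (hD η m).trans_eq (mul_pow _ _ _)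
    have h2 := PowerSeries.norm_coeff_pow_le (a := PowerSeries.mk fun k => (b k : ℂ)) (W := 1)
      (c := C * N) zero_le_one (by positivity)
      (by simp [b, h0.curve_zero]) (fun k => by
        rw [PowerSeries.coeff_mk, Complex.norm_real, norm_norm, one_mul]
        exact hC k ξ) m n
    rw [PowerSeries.coeff_pow_eq_sum_antidiagonalTuple, one_pow, one_mul] at h2
    have h3 : ∑ k ∈ Finset.Nat.antidiagonalTuple m n, ∏ i, b (k i) ≤ (2 * (C * N)) ^ n := by
      refine le_trans (le_of_eq ?_) h2
      have h4 : ∑ k ∈ Finset.Nat.antidiagonalTuple m n,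
          ∏ i, PowerSeries.coeff (k i) (PowerSeries.mk fun k => (b k : ℂ)) =
          ((∑ k ∈ Finset.Nat.antidiagonalTuple m n, ∏ i, b (k i) : ℝ) : ℂ) := by
        push_cast
        simp only [PowerSeries.coeff_mk]
      rw [h4, Complex.norm_real, Real.norm_of_nonneg]
      exact Finset.sum_nonneg fun k _ => Finset.prod_nonneg fun i _ => norm_nonneg _
    rw [symCoeff, map_sum]
    refine (norm_sum_le_of_le _ fun k _ => h1 _).trans ?_
    rw [← Finset.mul_sum, ← mul_pow]
    exact mul_le_mul_of_nonneg_left h3 (by positivity)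
  dsimp only
  rw [GelfandTriple.alongCurve, PowerSeries.coeff_mk]
  refine (norm_sum_le_of_le _ fun m _ => hterm m).trans ?_
  rw [← Finset.sum_mul]
  calc _ ≤ (1 + 6 * D) ^ n * (2 * (C * N)) ^ n := by
        gcongr
        exact sum_range_pow_le_one_add_pow (by positivity) n
    _ = _ := by rw [← mul_pow]; ring

/-- The growth of the coefficients of `s_ξ(z) exp ⟨ω, F(zξ)⟩` in `ω ∈ H₋τ`. -/
theorem HasGeometricBound.exists_norm_coeff_mul_exp_le {s : G.Test → PowerSeries ℂ}
    (hs : G.HasGeometricBound s) {F : G.FormalMap} (hF : F.IsQuasiHolomorphic) (h0 : F.NoConst)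
    (τ : T) : ∃ (σ : T) (C : ℝ), 0 ≤ C ∧ ∀ (n : ℕ) (ξ : G.Test) (x : G.Neg τ),
      ‖PowerSeries.coeff n (s ξ * (PowerSeries.exp ℂ).subst
        (PowerSeries.mk fun k => G.ofNeg τ x (F.curve ξ k)))‖ ≤
          (C * ‖G.toH σ ξ‖) ^ n * ∑ k ∈ Finset.range (n + 1), ‖x‖ ^ k / k.factorial := by
  obtain ⟨σ₁, C₁, hC₁0, hC₁⟩ := hs
  obtain ⟨σ₂, C₂, hC₂0, hC₂⟩ := hF.exists_norm_toH_le h0 τ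
  obtain ⟨σ, j₁, j₂, hj₁, hj₂⟩ := G.directed σ₁ σ₂
  set c := max (C₁ * ‖j₁‖) (C₂ * ‖j₂‖) with hc
  have hc0 : 0 ≤ c := le_max_of_le_left (by positivity)
  refine ⟨σ, 4 * c, by positivity, fun n ξ x => ?_⟩
  have h1 : C₁ * ‖G.toH σ₁ ξ‖ ≤ c * ‖G.toH σ ξ‖ := by
    have := mul_le_mul_of_nonneg_left (G.norm_toH_le hj₁ ξ) hC₁0
    rw [← mul_assoc] at this
    exact this.trans (mul_le_mul_of_nonneg_right (le_max_left _ _) (norm_nonneg _))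
  have h2 : C₂ * ‖G.toH σ₂ ξ‖ ≤ c * ‖G.toH σ ξ‖ := by
    have := mul_le_mul_of_nonneg_left (G.norm_toH_le hj₂ ξ) hC₂0
    rw [← mul_assoc] at this
    exact this.trans (mul_le_mul_of_nonneg_right (le_max_right _ _) (norm_nonneg _))
  rw [mul_assoc]
  refine PowerSeries.norm_coeff_mul_exp_subst_le (norm_nonneg x) (by positivity)
    (by simp [h0.curve_zero]) (fun k => (hC₁ ξ k).trans (by gcongr)) (fun k => ?_) n
  rw [PowerSeries.coeff_mk]
  refine (G.norm_ofNeg_apply_le τ x _).trans (mul_le_mul_of_nonneg_left ?_ (norm_nonneg x))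
  exact (hC₂ k ξ).trans (by gcongr)

end GelfandTriple

/-! ### The Sheffer operator on the polynomials of finite rank -/

namespace PowerSeries

theorem exp_subst_zero : (PowerSeries.exp ℂ).subst (0 : PowerSeries ℂ) = 1 := by
  ext n
  rw [coeff_exp_subst (by simp) le_rfl, Finset.sum_eq_single 0]
  · simp
  · intro k _ hk
    simp [zero_pow hk]
  · simp

theorem coeff_exp_subst_linear (c : ℂ) (n : ℕ) :
    coeff n ((PowerSeries.exp ℂ).subst (PowerSeries.mk fun k => if k = 1 then c else 0)) =
      (n.factorial : ℂ)⁻¹ * c ^ n := by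
  have h : (PowerSeries.mk fun k => if k = 1 then c else 0) = C c * X := by
    ext k
    rw [coeff_mk, coeff_C_mul, coeff_X, mul_ite, mul_one, mul_zero]
  rw [coeff_exp_subst (by simp) le_rfl, h, Finset.sum_eq_single n]
  · rw [mul_pow, ← map_pow, coeff_C_mul, coeff_X_pow_self, mul_one]
  · intro k _ hk
    rw [mul_pow, ← map_pow, coeff_C_mul, coeff_X_pow, if_neg (Ne.symm hk), mul_zero, mul_zero]
  · simp

end PowerSeries

namespace GelfandTriple

variable {T : Type u} (G : GelfandTriple.{u, v} T)

theorem constantCoeff_alongCurve (ℓ : ∀ m, G.SymPow m →ₗ[ℂ] ℂ) (x : ℕ → G.Test) (ξ : G.Test) :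
    PowerSeries.constantCoeff (G.alongCurve ℓ x) = ℓ 0 (G.tpow ξ 0) := by
  rw [← PowerSeries.coeff_zero_eq_constantCoeff_apply, alongCurve, PowerSeries.coeff_mk,
    Finset.sum_range_one]
  congr 1
  refine SymPow.eq_of_coPow_eq fun ω => ?_
  rw [coPow_symCoeff, coPow_tpow, pow_zero, pow_zero, PowerSeries.coeff_zero_one]

/-- The polynomial of finite rank `ω ↦ n! [zⁿ] s(z) exp ⟨ω, x(z)⟩`, for a formal power series `s`
and a formal curve `x` without constant term. -/
def expPoly (s : PowerSeries ℂ) (x : ℕ → G.Test) (n : ℕ) : G.FinSeq :=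
  (n.factorial : ℂ) • ∑ p ∈ Finset.HasAntidiagonal.antidiagonal n, PowerSeries.coeff p.1 s •
    ∑ m ∈ Finset.range (p.2 + 1), (m.factorial : ℂ)⁻¹ •
      G.single m ⟨G.symCoeff x m p.2, G.symCoeff_mem_finRank x m p.2⟩

/-- A linear functional which acts on tensors of degree `m` by `ℓ m` maps the polynomial
`n! [zⁿ] s(z) exp ⟨·, x(z)⟩` to `n! [zⁿ] s(z) ∑ₘ ℓₘ(x(z)^⊗ m) / m!`. -/
theorem map_expPoly (M : G.FinSeq →ₗ[ℂ] ℂ) (ℓ : ∀ m, G.SymPow m →ₗ[ℂ] ℂ)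
    (hM : ∀ m (φ : G.finRank m), M (G.single m φ) = ℓ m φ) (s : PowerSeries ℂ) (x : ℕ → G.Test)
    (n : ℕ) : M (G.expPoly s x n) = n.factorial *
      PowerSeries.coeff n (s * G.alongCurve (fun m => (m.factorial : ℂ)⁻¹ • ℓ m) x) := by
  simp only [expPoly, map_smul, map_sum, hM, smul_eq_mul, PowerSeries.coeff_mul, alongCurve,
    PowerSeries.coeff_mk, LinearMap.smul_apply]

theorem finPoly_expPoly {α : ℝ} (s : PowerSeries ℂ) {x : ℕ → G.Test} (hx : x 0 = 0) (n : ℕ)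
    (ω : G.CoTest) : G.finPoly α (G.expPoly s x n) ω = n.factorial * PowerSeries.coeff n
      (s * (PowerSeries.exp ℂ).subst (PowerSeries.mk fun k => ω (x k))) := by
  have h := G.map_expPoly ((G.evalAt α ω).comp (G.finPoly α)) (fun m => (G.coPow ω m).toLinearMap)
    (fun m φ => by rw [LinearMap.comp_apply, finPoly_single]; rfl) s x n
  refine h.trans ?_
  congr 3
  ext j
  rw [PowerSeries.coeff_exp_subst (by simp [hx]) le_rfl, alongCurve, PowerSeries.coeff_mk]
  refine Finset.sum_congr rfl fun m _ => ?_
  rw [LinearMap.smul_apply, smul_eq_mul, ← coPow_symCoeff]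
  rfl

variable {G}

/-- The map `φ ↦ ⟨Sₙ(·), φ⟩`. -/
def shefferForm (S : ∀ n : ℕ, G.CoTest → G.CoPow n) (n : ℕ) :
    G.SymPow n →ₗ[ℂ] (G.CoTest → ℂ) :=
  LinearMap.pi fun ω => (S n ω).toLinearMap

variable {S : ∀ n : ℕ, G.CoTest → G.CoPow n} {A B : G.FormalMap} {ρ : G.FormalFun}

namespace IsSheffer

/-- The coefficients of the power series `1 / ρ(A(ξ))`. -/
theorem mk_zero (hS : IsSheffer S A ρ) (ξ : G.Test) :
    (PowerSeries.mk fun n => ((n.factorial : ℂ)⁻¹ • (S n 0).toLinearMap) (G.tpow ξ n)) =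
      (ρ.comp A ξ)⁻¹ := by
  refine (hS.genFun 0 ξ).trans ?_
  have h : (PowerSeries.mk fun n => (0 : G.CoTest) (A n (G.tpow ξ n))) = 0 := by
    ext n
    simp
  rw [h, PowerSeries.exp_subst_zero, one_mul]

/-- The generating function, with `1 / ρ(A(ξ))` expressed through the values `S n 0`. -/
theorem mk_eq (hS : IsSheffer S A ρ) (ω : G.CoTest) (ξ : G.Test) :
    (PowerSeries.mk fun n => ((n.factorial : ℂ)⁻¹ • (S n ω).toLinearMap) (G.tpow ξ n)) =
      (PowerSeries.mk fun n => ((n.factorial : ℂ)⁻¹ • (S n 0).toLinearMap) (G.tpow ξ n)) *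
      (PowerSeries.exp ℂ).subst (PowerSeries.mk fun n => ω (A n (G.tpow ξ n))) := by
  rw [hS.mk_zero, mul_comm]
  exact hS.genFun ω ξ

theorem comp_eq_alongCurve (ξ : G.Test) :
    ρ.comp A ξ = G.alongCurve (fun m => (ρ m).toLinearMap) (A.curve ξ) := rfl

theorem constantCoeff_comp (hS : IsSheffer S A ρ) (ξ : G.Test) :
    PowerSeries.constantCoeff (ρ.comp A ξ) = 1 := by
  rw [comp_eq_alongCurve, G.constantCoeff_alongCurve _ _ ξ]
  exact hS.const_term ξ

theorem hasGeometricBound (hS : IsSheffer S A ρ) (hρ : ρ.IsHolomorphicNearZero)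
    (hA : A.IsQuasiHolomorphic) : G.HasGeometricBound fun ξ =>
      PowerSeries.mk fun n => ((n.factorial : ℂ)⁻¹ • (S n 0).toLinearMap) (G.tpow ξ n) := by
  simp only [hS.mk_zero]
  refine HasGeometricBound.inv (s := fun ξ => ρ.comp A ξ) ?_ hS.constantCoeff_comp
  exact HasGeometricBound.alongCurve (ℓ := fun m => (ρ m).toLinearMap)
    (hρ.hasGeometricBound hS.const_term) hA hS.noConst

/-- The power series `1 / ρ(ξ)`, which is obtained by composing `1 / ρ(A(ξ))` with `B`. -/
def invSeries (S : ∀ n : ℕ, G.CoTest → G.CoPow n) (B : G.FormalMap) (ξ : G.Test) :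
    PowerSeries ℂ :=
  G.alongCurve (fun n => (n.factorial : ℂ)⁻¹ • (S n 0).toLinearMap) (B.curve ξ)

theorem constantCoeff_invSeries (hS : IsSheffer S A ρ) (ξ : G.Test) :
    PowerSeries.constantCoeff (invSeries S B ξ) = 1 := by
  rw [invSeries, G.constantCoeff_alongCurve _ _ ξ]
  have h := congrArg PowerSeries.constantCoeff (hS.mk_zero ξ)
  rw [PowerSeries.constantCoeff_inv, hS.constantCoeff_comp, inv_one] at h
  exact h

/-- The generating function along the curves `z ↦ B(zξ)`. -/
theorem alongCurve_eq (hS : IsSheffer S A ρ) (hB : B.IsCompInverse A) (ω : G.CoTest)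
    (ξ : G.Test) :
    G.alongCurve (fun n => (n.factorial : ℂ)⁻¹ • (S n ω).toLinearMap) (B.curve ξ) =
      invSeries S B ξ *
        (PowerSeries.exp ℂ).subst (PowerSeries.mk fun k => if k = 1 then ω ξ else 0) := by
  have h := G.alongCurve_eq_mul_exp (a := fun n => (ω.comp (A n)).toLinearMap)
    (by have h0 : A 0 = 0 := hS.noConst
        simp [h0]) (hS.mk_eq ω) (hB.2.1.curve_zero ξ)
  rw [h, invSeries]
  congr 2
  ext n
  rw [alongCurve, PowerSeries.coeff_mk, PowerSeries.coeff_mk]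
  have := congrArg ω (hB.2.2.1 ξ n)
  rw [map_sum] at this
  refine this.trans ?_
  split_ifs <;> simp

theorem shefferForm_tpow (hS : IsSheffer S A ρ) (α : ℝ) (n : ℕ) (ξ : G.Test) :
    shefferForm S n (G.tpow ξ n) = (G.finPoly α (G.expPoly (PowerSeries.mk fun n =>
      ((n.factorial : ℂ)⁻¹ • (S n 0).toLinearMap) (G.tpow ξ n)) (A.curve ξ) n)).1 := by
  funext ω
  refine Eq.trans ?_ (G.finPoly_expPoly _ (hS.noConst.curve_zero ξ) n ω).symm
  have h := congrArg (PowerSeries.coeff n) (hS.mk_eq ω ξ)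
  rw [PowerSeries.coeff_mk] at h
  have h2 : (PowerSeries.mk fun k => ω (A.curve ξ k)) =
    PowerSeries.mk fun n => ω (A n (G.tpow ξ n)) := rfl
  rw [h2, ← h, LinearMap.smul_apply, smul_eq_mul, ← mul_assoc,
    mul_inv_cancel₀ (Nat.cast_ne_zero.2 n.factorial_ne_zero), one_mul]
  rfl

/-- A Sheffer operator maps polynomials of finite rank to polynomials of finite rank. -/
theorem exists_finPoly_eq_shefferForm (hS : IsSheffer S A ρ) (α : ℝ) (n : ℕ) (φ : G.finRank n) :
    ∃ w, shefferForm S n φ = (G.finPoly α w).1 := by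
  let P : Submodule ℂ (G.CoTest → ℂ) := LinearMap.range
    ((G.eminSubmodule α).subtype ∘ₗ (G.finPoly α : G.FinSeq →ₗ[ℂ] ↥(G.eminSubmodule α)))
  have h : G.finRank n ≤ P.comap (shefferForm S n) := by
    refine Submodule.span_le.2 ?_
    rintro _ ⟨ξ, rfl⟩
    exact ⟨_, (hS.shefferForm_tpow α n ξ).symm⟩
  obtain ⟨w, hw⟩ := h φ.2
  exact ⟨w, hw.symm⟩

/-- The map `φ ↦ ⟨Sₙ(·), φ⟩` from the tensors of finite rank to `E^α_min`. -/
def shefferMap (hS : IsSheffer S A ρ) (α : ℝ) (n : ℕ) : G.finRank n →ₗ[ℂ] G.Emin α :=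
  ((shefferForm S n).comp (G.finRank n).subtype).codRestrict (G.eminSubmodule α) fun φ => by
    obtain ⟨w, hw⟩ := hS.exists_finPoly_eq_shefferForm α n φ
    rw [LinearMap.comp_apply, Submodule.subtype_apply, hw]
    exact (G.finPoly α w).2

/-- The Sheffer operator on the polynomials of finite rank. -/
def shefferOp (hS : IsSheffer S A ρ) (α : ℝ) : G.FinSeq →ₗ[ℂ] G.Emin α :=
  DFinsupp.lsum ℂ fun n => hS.shefferMap α n

theorem shefferOp_single (hS : IsSheffer S A ρ) (α : ℝ) (n : ℕ) (φ : G.finRank n) (ω : G.CoTest) :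
    hS.shefferOp α (G.single n φ) ω = S n ω φ := by
  have : hS.shefferOp α (G.single n φ) = hS.shefferMap α n φ := DFinsupp.lsum_single _ _ _ _
  rw [this]
  rfl

theorem shefferOp_mem_range (hS : IsSheffer S A ρ) (α : ℝ) (w : G.FinSeq) :
    hS.shefferOp α w ∈ LinearMap.range (G.finPoly α) := by
  classical
  rw [G.map_finSeq_apply]
  refine Submodule.sum_mem _ fun n _ => ?_
  obtain ⟨w', hw'⟩ := hS.exists_finPoly_eq_shefferForm α n (w n)
  refine ⟨w', G.emin_ext fun ω => ?_⟩
  rw [shefferOp_single]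
  exact (congrFun hw' ω).symm

/-- The preimage of `⟨·, ξ⟩ⁿ` under a Sheffer operator. -/
theorem shefferOp_expPoly (hS : IsSheffer S A ρ) (hB : B.IsCompInverse A) (α : ℝ) (n : ℕ)
    (ξ : G.Test) : hS.shefferOp α (G.expPoly (invSeries S B ξ)⁻¹ (B.curve ξ) n) =
      G.finPoly α (G.single n ⟨G.tpow ξ n, G.tpow_mem_finRank ξ n⟩) := by
  refine G.emin_ext fun ω => ?_
  have h := G.map_expPoly ((G.evalAt α ω).comp (hS.shefferOp α)) (fun m => (S m ω).toLinearMap)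
    (fun m φ => hS.shefferOp_single α m φ ω) (invSeries S B ξ)⁻¹ (B.curve ξ) n
  refine h.trans ?_
  rw [hS.alongCurve_eq hB, ← mul_assoc, PowerSeries.inv_mul_cancel _ (by
    rw [hS.constantCoeff_invSeries]
    exact one_ne_zero), one_mul, PowerSeries.coeff_exp_subst_linear, ← mul_assoc,
    mul_inv_cancel₀ (Nat.cast_ne_zero.2 n.factorial_ne_zero), one_mul, finPoly_single,
    monomialMap_apply, coPow_tpow]

/-- A Sheffer operator maps onto the polynomials of finite rank. -/
theorem finPoly_mem_range_shefferOp (hS : IsSheffer S A ρ) (hB : B.IsCompInverse A) (α : ℝ) (w : G.FinSeq) :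
    G.finPoly α w ∈ LinearMap.range (hS.shefferOp α) := by
  classical
  rw [G.map_finSeq_apply]
  refine Submodule.sum_mem _ fun n _ => ?_
  rw [finPoly_single]
  have h : G.finRank n ≤ (LinearMap.range (hS.shefferOp α)).comap (G.monomialMap α n) := by
    refine Submodule.span_le.2 ?_
    rintro _ ⟨ξ, rfl⟩
    exact ⟨_, (hS.shefferOp_expPoly hB α n ξ).trans (G.finPoly_single _ _)⟩
  exact h (w n).2

/-- A Sheffer operator is injective: by monicity, the leading term of `⟨Sₙ(zω), φ⟩` as a polynomial in `z` is `zⁿ ⟨ω^⊗ n, φ⟩`. -/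
theorem injective_shefferOp (hS : IsSheffer S A ρ) (α : ℝ) :
    Function.Injective (hS.shefferOp α) := by
  classical
  rw [injective_iff_map_eq_zero]
  intro w hw
  by_contra hne
  obtain ⟨U, -, hU1, hU⟩ := hS.monic
  have hsupp : w.support.Nonempty := by
    rw [Finset.nonempty_iff_ne_empty, Ne, DFinsupp.support_eq_empty]
    exact hne
  set N := w.support.max' hsupp with hN
  refine DFinsupp.mem_support_iff.1 (w.support.max'_mem hsupp) (Subtype.ext ?_)
  refine SymPow.eq_of_coPow_eq fun ω => ?_
  let P : Polynomial ℂ := ∑ n ∈ w.support, ∑ k ∈ Finset.range (n + 1),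
    Polynomial.monomial k (U n k (G.coPow ω k) (w n : G.SymPow n))
  have hP : P = 0 := by
    refine Polynomial.funext fun z => ?_
    rw [Polynomial.eval_zero]
    have h1 : hS.shefferOp α w (z • ω) = 0 := by rw [hw]; rfl
    rw [← evalAt_apply, G.map_finSeq_apply (hS.shefferOp α), map_sum] at h1
    simp only [evalAt_apply, shefferOp_single, hU] at h1
    rw [← h1]
    simp only [P, Polynomial.eval_finsetSum, Polynomial.eval_monomial]
    refine Finset.sum_congr rfl fun n _ => ?_
    rw [sum_apply]
    refine Finset.sum_congr rfl fun k _ => ?_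
    have h2 : G.coPow (z • ω) k = z ^ k • G.coPow ω k :=
      ContinuousLinearMap.ext fun φ => G.coPow_smul z ω φ
    rw [h2, map_smul, smul_apply, smul_eq_mul, mul_comm]
  have h3 : P.coeff N = G.coPow ω N (w N : G.SymPow N) := by
    simp only [P, Polynomial.finsetSum_coeff, Polynomial.coeff_monomial]
    rw [Finset.sum_eq_single_of_mem N (w.support.max'_mem hsupp)]
    · rw [Finset.sum_ite_eq' , if_pos (by simp), hU1]
      rfl
    · intro n hn hnN
      have : n < N := lt_of_le_of_ne (w.support.le_max' n hn) hnN
      refine Finset.sum_eq_zero fun k hk => if_neg ?_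
      have := Finset.mem_range.1 hk
      omega
  rw [← h3, hP, Polynomial.coeff_zero, ZeroMemClass.coe_zero, map_zero]

end IsSheffer

end GelfandTriple

/-! ### Extension by continuity -/

namespace GelfandTriple

variable {T : Type u} (G : GelfandTriple.{u, v} T)

/-- A linear map on the polynomials of finite rank with `L ξ^⊗ n = n! [zⁿ] s_ξ(z) exp ⟨·, F(zξ)⟩`
extends to a continuous operator on `E^α_min`. -/
theorem exists_extension_of_expPoly {α : ℝ} (hα : α ∈ Set.Icc (0 : ℝ) 1)
    (L : G.FinSeq →ₗ[ℂ] G.Emin α) {s : G.Test → PowerSeries ℂ} (hs : G.HasGeometricBound s)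
    {F : G.FormalMap} (hF : F.IsQuasiHolomorphic) (h0 : F.NoConst)
    (hL : ∀ n ξ, L (G.single n ⟨G.tpow ξ n, G.tpow_mem_finRank ξ n⟩) =
      G.finPoly α (G.expPoly (s ξ) (F.curve ξ) n)) :
    ∃ Λ : G.Emin α →L[ℂ] G.Emin α, ∀ w, Λ (G.finPoly α w) = L w := by
  refine G.exists_extension hα.1 (G.finPoly α) L (G.denseRange_finPoly hα.1)
    (G.exists_eminSeminorm_le hα L fun τ => ?_)
  obtain ⟨σ, C, hC0, hC⟩ := hs.exists_norm_coeff_mul_exp_le hF h0 τ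
  refine ⟨σ, C, hC0, fun n ξ x => ?_⟩
  rw [hL, G.finPoly_expPoly _ (h0.curve_zero ξ), norm_mul, Complex.norm_natCast]
  exact mul_le_mul_of_nonneg_left (hC n ξ x) (Nat.cast_nonneg _)

theorem poly_mem_eminSubmodule (α : ℝ) {p : G.CoTest → ℂ} (hp : p ∈ G.polynomials) :
    p ∈ G.eminSubmodule α := by
  obtain ⟨N, φ, rfl⟩ := hp
  have h : G.poly N φ = ∑ k ∈ Finset.range (N + 1), fun ω => G.coPow ω k (φ k) := by
    funext ω
    rw [Finset.sum_apply]
    rfl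
  rw [h]
  exact Submodule.sum_mem _ fun k _ => G.coPow_mem_eminSubmodule α (φ k)

theorem finPoly_mem_polynomials (α : ℝ) (w : G.FinSeq) :
    (G.finPoly α w : G.CoTest → ℂ) ∈ G.polynomials := by
  classical
  refine ⟨w.support.sup id, fun n => (w n : G.SymPow n), funext fun ω => ?_⟩
  rw [finPoly_apply, poly]
  refine Finset.sum_subset (fun n hn => ?_) fun n _ hn => ?_
  · exact Finset.mem_range.2 (Nat.lt_succ_of_le (Finset.le_sup (f := id) hn))
  · rw [DFinsupp.notMem_support_iff.1 hn, Submodule.coe_zero, map_zero]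

variable {G} in
/-- The inverse of a Sheffer operator on the polynomials of finite rank. -/
theorem IsSheffer.exists_inverse {S : ∀ n : ℕ, G.CoTest → G.CoPow n} {A B : G.FormalMap}
    {ρ : G.FormalFun} (hS : IsSheffer S A ρ) (hB : B.IsCompInverse A) (α : ℝ) :
    ∃ L : G.FinSeq →ₗ[ℂ] G.Emin α,
      ∀ w w', hS.shefferOp α w' = G.finPoly α w → L w = G.finPoly α w' := by
  let e := LinearEquiv.ofInjective (hS.shefferOp α) (hS.injective_shefferOp α)
  refine ⟨(G.finPoly α).comp ((e.symm : _ →ₗ[ℂ] G.FinSeq).comp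
    ((G.finPoly α).codRestrict _ (hS.finPoly_mem_range_shefferOp hB α))), fun w w' h => ?_⟩
  have h1 : (G.finPoly α).codRestrict _ (hS.finPoly_mem_range_shefferOp hB α) w = e w' :=
    Subtype.ext h.symm
  rw [LinearMap.comp_apply, LinearMap.comp_apply, h1, LinearEquiv.coe_coe,
    LinearEquiv.symm_apply_apply]

end GelfandTriple

end

theorem theorem3p1 {T : Type u} (G : GelfandTriple.{u, v} T)
    (S : ∀ n : ℕ, G.CoTest → G.CoPow n) (A B : G.FormalMap) (ρ : G.FormalFun)
    (hS : GelfandTriple.IsSheffer S A ρ)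
    (hρ : ρ.IsHolomorphicNearZero)
    (hB : B.IsCompInverse A)
    (hAqh : A.IsQuasiHolomorphic) (hBqh : B.IsQuasiHolomorphic)
    (α : ℝ) (hα : α ∈ Set.Icc (0 : ℝ) 1) :
    (∀ p ∈ G.polynomials, p ∈ G.eminSubmodule α) ∧
    Dense {f : G.Emin α | (f : G.CoTest → ℂ) ∈ G.polynomials} ∧
    ∃ 𝔖 : G.Emin α ≃L[ℂ] G.Emin α,
      ∀ (N : ℕ) (φ : ∀ k, G.SymPow k) (f : G.Emin α), (f : G.CoTest → ℂ) = G.poly N φ →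
        ∀ ω, 𝔖 f ω = ∑ k ∈ Finset.range (N + 1), S k ω (φ k) := by
  have hdense := G.denseRange_finPoly hα.1
  refine ⟨fun p hp => G.poly_mem_eminSubmodule α hp, hdense.mono ?_, ?_⟩
  · rintro _ ⟨w, rfl⟩
    exact G.finPoly_mem_polynomials α w
  have := G.t2Space_emin hα.1
  have hσ := hS.hasGeometricBound hρ hAqh
  obtain ⟨𝔖, h𝔖⟩ := G.exists_extension_of_expPoly hα (hS.shefferOp α) hσ hAqh hS.noConst
    fun n ξ => Subtype.ext (by
      rw [← hS.shefferForm_tpow α n ξ]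
      funext ω
      exact hS.shefferOp_single α n _ ω)
  obtain ⟨L, hL⟩ := hS.exists_inverse hB α
  obtain ⟨𝔗, h𝔗⟩ := G.exists_extension_of_expPoly hα L
    ((hσ.alongCurve hBqh hB.2.1).inv hS.constantCoeff_invSeries) hBqh hB.2.1
    fun n ξ => hL _ _ (hS.shefferOp_expPoly hB α n ξ)
  -- the extensions are inverse to each other, because they are so on a dense subspace
  have h1 : ∀ f, 𝔗 (𝔖 f) = f := congrFun (hdense.equalizer (by fun_prop) continuous_id
    (funext fun w => by
      obtain ⟨w', hw'⟩ := hS.shefferOp_mem_range α w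
      change 𝔗 (𝔖 (G.finPoly α w)) = G.finPoly α w
      rw [h𝔖, ← hw', h𝔗]
      exact hL w' w hw'.symm))
  have h2 : ∀ f, 𝔖 (𝔗 f) = f := congrFun (hdense.equalizer (by fun_prop) continuous_id
    (funext fun w => by
      obtain ⟨w', hw'⟩ := hS.finPoly_mem_range_shefferOp hB α w
      change 𝔖 (𝔗 (G.finPoly α w)) = G.finPoly α w
      rw [h𝔗, hL w w' hw', h𝔖, hw']))
  -- the tensors of finite rank are dense, so that `𝔖` is the Sheffer operator on all polynomials
  have hmon : ∀ (k : ℕ) (ω : G.CoTest) (φ : G.SymPow k), 𝔖 (G.monomialMap α k φ) ω = S k ω φ := by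
    intro k ω
    refine congrFun (Continuous.ext_on (G.dense_finRank k)
      (((G.continuous_evalAt hα.1 ω).comp 𝔖.continuous).comp (G.continuous_monomialMap hα.1 k))
      (S k ω).continuous fun φ hφ => ?_)
    have h3 := congrArg (G.evalAt α ω) (h𝔖 (G.single k ⟨φ, hφ⟩))
    rw [G.finPoly_single] at h3
    exact h3.trans (hS.shefferOp_single α k _ ω)
  refine ⟨ContinuousLinearEquiv.equivOfInverse 𝔖 𝔗 h1 h2, fun N φ f hf ω => ?_⟩
  have hf' : f = ∑ k ∈ Finset.range (N + 1), G.monomialMap α k (φ k) := by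
    refine G.emin_ext fun ω => ?_
    rw [hf, ← G.evalAt_apply ω (∑ k ∈ Finset.range (N + 1), G.monomialMap α k (φ k)), map_sum]
    rfl
  rw [ContinuousLinearEquiv.equivOfInverse_apply, hf', map_sum, ← G.evalAt_apply, map_sum]
  exact Finset.sum_congr rfl fun k _ => hmon k ω (φ k)
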